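/- \textbf{Theorem (Anonymity of TrollThrottle).} Throughout, ``PPT'' means (uniform) probabilistic polynomial time in the security parameter $\lambda$ (resp. in the input size), $\bot$ is an error symbol, and all algorithms also receive $1^\lambda$. \emph{Building blocks.} (i) A DAA scheme: PPT algorithms $\mathsf{Setup}_{DAA}$ (issuer keys $(pk,sk)$), a sampler for user secret keys $sk_S$, $\mathsf{Join}_{DAA}(pk,sk_S;r)$ (outputs a commitment $com$; $r$ are its uniform coins, polynomially many), $\mathsf{Issue}_{DAA}(sk,com)$ (outputs a credential $cred$), a deterministic check, made by the user at the end of the join protocol, that a received credential is valid for $(pk,sk_S)$ (the check may be trivial), $\mathsf{Sign}_{DAA}(sk_S,cred,dom,m)$ with a basename $dom$ that is a string or $\bot$, and deterministic algorithms $\mathsf{Verify}_{DAA},\mathsf{Link}_{DAA}$, $\mathsf{NymGen}$, $\mathsf{NymExtract}$, $\mathsf{VerifyBsn}$. Users and verifiers know $pk$, which contains the public parameters. The scheme satisfies $\mathsf{NymGen}(sk_S,dom)=\mathsf{NymExtract}(\mathsf{Sign}_{DAA}(sk_S,cred,dom,m))$ for all honestly generated keys, valid credentials, basenames $dom\ne\bot$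 and messages $m$. (ii) A non-interactive proof system $(\mathsf{Setup}_{ZK},\mathsf{CreateProof},\mathsf{VerifyProof})$ for the relation $\mathcal R_{Join}$ in which $(sk_S,r)$ is a witness for $(com,pk)$ iff $com=\mathsf{Join}_{DAA}(pk,sk_S;r)$. (iii) A polynomial-time hash function $h$. \emph{Protocol.} The public parameter is $\rho=(1^\lambda,\rho_J)$ with $\rho_J\leftarrow\mathsf{Setup}_{ZK}$; the issuer has $pk_I=pk$ and $sk_I=(pk,sk)$. To join, a user with secret key $sk_U$ sends $com\leftarrow\mathsf{Join}_{DAA}(pk,sk_U;r)$ and $\Pi=\mathsf{CreateProof}(\rho_J,(com,pk),(sk_U,r))$; the issuer aborts if $\mathsf{VerifyProof}$ rejects and otherwise returns $cred\leftarrow\mathsf{Issue}_{DAA}(sk,com)$; the user aborts if $cred$ is not valid. $\mathsf{Comment}(sk_U,cred,dom,m)$ outputs $nym=\mathsf{NymGen}(sk_U,dom)$ and $\gamma=(\sigma,nym,dom,h(m))$ with $\sigma\leftarrow\mathsf{Sign}_{DAA}(sk_U,cred,dom,h(m))$. \emph{Anonymity game.} The adversary gets $\rho$ and $sk_I$. It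 may: create an honest user $U$ (not yet honest or corrupted) by an honest run of the join protocol with a fresh key, and gets the credential; let such a $U$, with a fresh key, join with the adversary in the role of the issuer; corrupt $U$, which yields $(sk_U,cred_U)$ if $U$ has joined, and makes $U$ corrupted and no longer honest; and obtain comments $(nym,\gamma)$ of honest users $U$ for $(dom,m)$ of its choice. Runs of the join protocol with the adversary may be interleaved with other queries. Once, it chooses $(U^*,dom^*,m^*)$; for a uniform bit $b$, a fresh user joins by an honest run, and the adversary gets a comment for $(dom^*,m^*)$ made by $U^*$ if $b=0$ and by the fresh user if $b=1$ (it gets $\bot$ if $U^*$ is not an honest user or the run aborts). It continues its queries and outputs a bit $b^*$. It wins if $b^*=b$, at the end $U^*$ is honest, and no comment of $U^*$ for $dom^*$ was requested. The system is anonymous if for every PPT adversary there is a negligible $\nu$ with $\Pr[\text{win}]\le\frac12+\nu(\lambda)$ for all $\lambda$. \emph{Assumptions.} \emph{User-controlled anonymity of the DAA scheme}: the following game is won by each PPT adversary with probability at most $\frac12+\nu(\lambda)$ for some negligible $\nu$. The adversary gets $(sk,pk)\leftarrow\mathsf{Setup}_{DAA}$. It may request joins of identities $S$ (the challenger acts as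 the user with a fresh key, sends $com$, receives a credential from the adversary and accepts it if it is valid), signatures of joined $S$ on $(dom,m)$, and the secret keys of joined $S$ (corruption); joins may be interleaved with other queries. Once, it chooses joined $S_0,S_1$, $m$ and $dom$ and gets $\mathsf{Sign}_{DAA}(sk_{S_b},cred_{S_b},dom,m)$ for a uniform bit $b$. It wins if it outputs $b$, never corrupted $S_0$ or $S_1$, and, if $dom\neq\bot$, never requested a signature of $S_0$ or $S_1$ for $dom$. \emph{Zero-knowledge for $\mathcal R_{Join}$}: there are PPT simulators $S_1,S_2$ such that for every PPT $\mathcal A$ the difference of the following two probabilities is negligible: that $\mathcal A(\rho_J)=1$ when $\rho_J\leftarrow\mathsf{Setup}_{ZK}$ and $\mathcal A$ has an oracle that answers $(x,w)$ by $\mathsf{CreateProof}(\rho_J,x,w)$; and that $\mathcal A(\rho_J)=1$ when $(\rho_J,\tau)\leftarrow S_1(1^\lambda)$ and the oracle answers $(x,w)$ by $S_2(\rho_J,\tau,x)$; both oracles answer $\bot$ if $(x,w)\notin\mathcal R_{Join}$. \emph{Claim.} If the DAA scheme provides user-controlled anonymity and the proof system is zero-knowledge for $\mathcal R_{Join}$,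 then TrollThrottle satisfies anonymity. -/

import Mathlib

namespace Troll

/-! ## Data

All values (keys, messages, basenames, proofs, tuples, ...) are finite binary trees, which serve as
the strings of the machine model. -/

/-- Finite binary trees: the values that programs compute with. -/
inductive Data : Type
  | nil : Data
  | cons : Data → Data → Data
  deriving DecidableEq

namespace Data

/-- Number of nodes. -/
def size : Data → ℕ
  | nil => 1
  | cons a b => a.size + b.size + 1

/-- First component (`nil` for `nil`). -/
def hd : Data → Data
  | nil => nil
  | cons a _ => a

/-- Second component (`nil` for `nil`). -/
def tl : Data → Data
  | nil => nil
  | cons _ b => b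

/-- Length of a tree read as a list `cons a₀ (cons a₁ ( … nil))`. -/
def len : Data → ℕ
  | nil => 0
  | cons _ b => b.len + 1

/-- Entry number `i` of a tree read as a list (`nil` if there is none). -/
def nth : Data → ℕ → Data
  | d, 0 => d.hd
  | d, i + 1 => d.tl.nth i

/-- Tuples are coded as lists. -/
def tuple : List Data → Data
  | [] => nil
  | a :: l => cons a (tuple l)

/-- The unary number `1ⁿ`. -/
def unary : ℕ → Data
  | 0 => nil
  | n + 1 => cons nil (unary n)

/-- The bits `0` and `1`. -/
def bit : Bool → Data
  | false => nil
  | true => cons nil nil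

/-- The string with the given bits. -/
def bits : List Bool → Data
  | [] => nil
  | b :: l => cons (bit b) (bits l)

/-- A value read as a truth value: `nil` is `0`, everything else is `1`. -/
def toBool : Data → Bool
  | nil => false
  | cons _ _ => true

/-- Code of an optional value; `none` is the symbol `⊥`. -/
def opt : Option Data → Data
  | none => nil
  | some d => cons nil d

/-- Decoding of optional values. -/
def toOpt : Data → Option Data
  | nil => none
  | cons _ d => some d

end Data

/-! ## Programs and their running time

The WHILE language over binary trees, with fair coin flips and with calls to an oracle. Evaluating
an expression costs at least the sizes of all values that are touched, so that cost is polynomially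
related to the running time of (probabilistic, oracle) Turing machines. -/

/-- Contents of the variables `x₀, x₁, …`. -/
abbrev Store := ℕ → Data

/-- Expressions. -/
inductive Expr : Type
  | var : ℕ → Expr
  | nil : Expr
  | cons : Expr → Expr → Expr
  | hd : Expr → Expr
  | tl : Expr → Expr
  | eq : Expr → Expr → Expr

namespace Expr

/-- Value of an expression. -/
def eval (s : Store) : Expr → Data
  | var i => s i
  | nil => Data.nil
  | cons e f => Data.cons (e.eval s) (f.eval s)
  | hd e => (e.eval s).hd
  | tl e => (e.eval s).tl
  | eq e f => Data.bit (decide (e.eval s = f.eval s))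

/-- Cost of the evaluation; it is at least the size of the value. -/
def cost (s : Store) : Expr → ℕ
  | var i => (s i).size
  | nil => 1
  | cons e f => e.cost s + f.cost s + 1
  | hd e => e.cost s + 1
  | tl e => e.cost s + 1
  | eq e f => e.cost s + f.cost s + 1

end Expr

/-- Programs. `flip x` stores a fair random bit in `x`; `call x e` sends the value of `e` to the
oracle and stores the answer in `x`. -/
inductive Cmd : Type
  | assign : ℕ → Expr → Cmd
  | flip : ℕ → Cmd
  | call : ℕ → Expr → Cmd
  | seq : Cmd → Cmd → Cmd
  | cond : Expr → Cmd → Cmd → Cmd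
  | loop : Expr → Cmd → Cmd

/-- The behaviour of a terminating (or interrupted) computation, seen from outside: a tree of coin
flips and oracle queries that ends with a result, or with `timeout` when time has run out. -/
inductive Interaction (α : Type) : Type
  | ret : α → Interaction α
  | timeout : Interaction α
  | flip : (Bool → Interaction α) → Interaction α
  | ask : Data → (Data → Interaction α) → Interaction α

namespace Interaction

/-- Apply a function to the result. -/
def map {α β : Type} (f : α → β) : Interaction α → Interaction β
  | ret a => ret (f a)
  | timeout => timeout
  | flip k => flip fun b => (k b).map f
  | ask q k => ask q fun a => (k a).map f

/-- Whatever the coins are, the computation ends in time, and it makes no oracle query. -/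
def Halts {α : Type} : Interaction α → Prop
  | ret _ => True
  | timeout => False
  | flip k => ∀ b, (k b).Halts
  | ask _ _ => False

/-- Run a computation with fresh fair coins against a stateful randomized oracle `O`, started in a
given state of the oracle; the outcome is the result (`none` after a timeout) with the final state
of the oracle. -/
noncomputable def play {α σ : Type} (O : σ → Data → PMF (Data × σ)) :
    Interaction α → σ → PMF (Option α × σ)
  | ret a, s => PMF.pure (some a, s)
  | timeout, s => PMF.pure (none, s)
  | flip k, s => (PMF.uniformOfFintype Bool).bind fun b => (k b).play O s
  | ask q k, s => (O s q).bind fun r => (k r.1).play O r.2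

end Interaction

/-- Execution of a stack of commands with time budget `n`. Every command costs at least one unit;
expressions cost `Expr.cost`, and receiving an answer of the oracle costs its size. -/
def exec (n : ℕ) (p : List Cmd) (s : Store) : Interaction Store :=
  match n, p with
  | _, [] => .ret s
  | 0, _ :: _ => .timeout
  | n + 1, .assign x e :: p =>
      if e.cost s ≤ n then exec (n - e.cost s) p (Function.update s x (e.eval s)) else .timeout
  | n + 1, .flip x :: p => .flip fun b => exec n p (Function.update s x (Data.bit b))
  | n + 1, .call x e :: p =>
      if e.cost s ≤ n then
        .ask (e.eval s) fun a =>
          if e.cost s + a.size ≤ n then exec (n - (e.cost s + a.size)) p (Function.update s x a)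
          else .timeout
      else .timeout
  | n + 1, .seq c d :: p => exec n (c :: d :: p) s
  | n + 1, .cond e c d :: p =>
      if e.cost s ≤ n then
        exec (n - e.cost s) ((if (e.eval s).toBool then c else d) :: p) s
      else .timeout
  | n + 1, .loop e c :: p =>
      if e.cost s ≤ n then
        exec (n - e.cost s) (if (e.eval s).toBool then c :: .loop e c :: p else p) s
      else .timeout
termination_by n
decreasing_by all_goals omega

/-- Run a program with time budget `t`: the input is in variable `0`, all other variables are `nil`,
and the output is the final content of variable `0`. -/
def Cmd.run (c : Cmd) (t : ℕ) (x : Data) : Interaction Data :=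
  (exec t [c] (Function.update (fun _ => Data.nil) 0 x)).map fun s => s 0

/-- The input `(1ⁿ, x)` of an algorithm with security parameter `n`. -/
def withParam (n : ℕ) (x : Data) : Data := Data.cons (Data.unary n) x

/-- A probabilistic polynomial-time algorithm: a program that halts, on every input and for all
outcomes of its coins, within a polynomial in the size of its input (which includes the security
parameter in unary). -/
structure PPTAlgorithm where
  code : Cmd
  time : Polynomial ℕ
  halts : ∀ (n : ℕ) (x : Data),
    (code.run (time.eval (withParam n x).size) (withParam n x)).Halts

/-- The output distribution of a probabilistic polynomial-time algorithm. -/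
noncomputable def PPTAlgorithm.out (F : PPTAlgorithm) (n : ℕ) (x : Data) : PMF Data :=
  ((F.code.run (F.time.eval (withParam n x).size) (withParam n x)).play
    (fun (_ : Unit) _ => PMF.pure (Data.nil, ())) ()).map fun r => r.1.getD Data.nil

/-- A deterministic polynomial-time algorithm: it halts without flipping coins. -/
structure PTAlgorithm where
  code : Cmd
  time : Polynomial ℕ
  halts : ∀ (n : ℕ) (x : Data), ∃ y : Data,
    code.run (time.eval (withParam n x).size) (withParam n x) = .ret y

/-- The output of a deterministic polynomial-time algorithm. -/
noncomputable def PTAlgorithm.out (F : PTAlgorithm) (n : ℕ) (x : Data) : Data :=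
  (F.halts n x).choose

/-- A probabilistic polynomial-time adversary: an oracle program with a polynomial clock that stops
it after `time n` units. An adversary that is stopped by its clock has no output. -/
structure Adversary where
  code : Cmd
  time : Polynomial ℕ

/-- The behaviour of an adversary on security parameter `n` and input `x`. -/
def Adversary.run (A : Adversary) (n : ℕ) (x : Data) : Interaction Data :=
  A.code.run (A.time.eval n) (withParam n x)

/-- A function of the security parameter is negligible if it decays faster than `1 / n ^ k` for
every `k`. -/
def Negligible (f : ℕ → ℝ) : Prop :=
  Asymptotics.SuperpolynomialDecay Filter.atTop (fun n : ℕ => (n : ℝ)) f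

/-- The probability that an experiment returns `1`. -/
noncomputable def Pr (e : PMF Bool) : ℝ := (e true).toReal

/-- A string of `k` independent fair coins. -/
noncomputable def coins : ℕ → PMF (List Bool)
  | 0 => PMF.pure []
  | k + 1 => (PMF.uniformOfFintype Bool).bind fun b => (coins k).map fun r => b :: r

/-! ## Non-interactive proof systems -/

/-- The algorithms of a non-interactive proof system (all of them receive `1ⁿ`). -/
structure ProofSystem where
  /-- common reference string `ρ` -/
  setupAlg : PPTAlgorithm
  /-- input `(ρ, x, w)` -/
  createAlg : PPTAlgorithm
  /-- input `(ρ, x, π)` -/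
  verifyAlg : PPTAlgorithm

namespace ProofSystem

variable (P : ProofSystem)

noncomputable def setup (n : ℕ) : PMF Data := P.setupAlg.out n Data.nil

noncomputable def createProof (n : ℕ) (ρ x w : Data) : PMF Data :=
  P.createAlg.out n (Data.tuple [ρ, x, w])

noncomputable def verifyProof (n : ℕ) (ρ x π : Data) : PMF Bool :=
  (P.verifyAlg.out n (Data.tuple [ρ, x, π])).map Data.toBool

/-- The oracle that, on a query `(x, w)`, runs `prove x w` if `(x, w)` is in the relation, and
answers `⊥` otherwise. -/
noncomputable def proofOracle (R : Data → Data → Prop) (prove : Data → Data → PMF Data) :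
    Unit → Data → PMF (Data × Unit) := fun _ q =>
  open Classical in
  if R (q.nth 0) (q.nth 1) then
    (prove (q.nth 0) (q.nth 1)).map fun π => (Data.opt (some π), ())
  else PMF.pure (Data.opt none, ())

/-- Did a run of a distinguisher end with output `1`? -/
def accepts (r : Option Data × Unit) : Bool := (r.1.map Data.toBool).getD false

/-- The distinguisher with an honest reference string and honest proofs. -/
noncomputable def realExp (R : ℕ → Data → Data → Prop) (A : Adversary) (n : ℕ) : PMF Bool := do
  let ρ ← P.setup n
  let r ← (A.run n ρ).play (proofOracle (R n) fun x w => P.createProof n ρ x w) ()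
  return accepts r

/-- The distinguisher with a simulated reference string and simulated proofs; `S₁` outputs a pair
`(ρ, τ)` and `S₂` gets `(ρ, τ, x)`. -/
noncomputable def simExp (S₁ S₂ : PPTAlgorithm) (R : ℕ → Data → Data → Prop) (A : Adversary)
    (n : ℕ) : PMF Bool := do
  let ρτ ← S₁.out n Data.nil
  let r ← (A.run n ρτ.hd).play
    (proofOracle (R n) fun x _ => S₂.out n (Data.tuple [ρτ.hd, ρτ.tl, x])) ()
  return accepts r

/-- Zero-knowledge for the relation `R` (which may depend on the security parameter). -/
def ZeroKnowledge (R : ℕ → Data → Data → Prop) : Prop :=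
  ∃ S₁ S₂ : PPTAlgorithm, ∀ A : Adversary,
    Negligible fun n => |Pr (P.realExp R A n) - Pr (simExp S₁ S₂ R A n)|

end ProofSystem

/-! ## Direct anonymous attestation (DAA) -/

/-- The algorithms of a DAA scheme with pseudonyms. Besides the inputs that are listed, all
algorithms receive `1ⁿ`, and those of users and verifiers receive the issuer's public key `pk`,
which contains the public parameters. -/
structure DAAScheme where
  /-- output `(pk, sk)`: the keys of the issuer -/
  setupAlg : PPTAlgorithm
  /-- input `pk`: samples a user's secret key -/
  keyAlg : PPTAlgorithm
  /-- number of coins of the user's `Join` algorithm -/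
  joinCoins : Polynomial ℕ
  /-- input `(pk, sk_S, r)` with coins `r`: the commitment `com` that the user sends -/
  joinAlg : PTAlgorithm
  /-- input `(pk, sk, com)`: the credential that the issuer sends back -/
  issueAlg : PPTAlgorithm
  /-- input `(pk, sk_S, cred)`: the user's check, at the end of `Join`, that the credential that was
  received is valid -/
  checkAlg : PTAlgorithm
  /-- input `(pk, sk_S, cred, dom, m)` -/
  signAlg : PPTAlgorithm
  /-- input `(pk, m, dom, σ, RL)` -/
  verifyAlg : PTAlgorithm
  /-- input `(pk, σ₀, σ₁)` -/
  linkAlg : PTAlgorithm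
  /-- input `(pk, sk_S, dom)` -/
  nymGenAlg : PTAlgorithm
  /-- input `(pk, σ)` -/
  nymExtractAlg : PTAlgorithm
  /-- input `(pk, σ, dom)` -/
  verifyBsnAlg : PTAlgorithm

namespace DAAScheme

variable (D : DAAScheme)

/-- The key pair `(pk, sk)` of the issuer. -/
noncomputable def setup (n : ℕ) : PMF (Data × Data) :=
  (D.setupAlg.out n Data.nil).map fun k => (k.hd, k.tl)

noncomputable def userKey (n : ℕ) (pk : Data) : PMF Data := D.keyAlg.out n pk

/-- `Join` with explicit coins. -/
noncomputable def join (n : ℕ) (pk skS : Data) (r : List Bool) : Data :=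
  D.joinAlg.out n (Data.tuple [pk, skS, Data.bits r])

noncomputable def issue (n : ℕ) (pk sk com : Data) : PMF Data :=
  D.issueAlg.out n (Data.tuple [pk, sk, com])

noncomputable def check (n : ℕ) (pk skS cred : Data) : Bool :=
  (D.checkAlg.out n (Data.tuple [pk, skS, cred])).toBool

/-- The basename is `⊥` (`none`) or a string. -/
noncomputable def sign (n : ℕ) (pk skS cred : Data) (dom : Option Data) (m : Data) : PMF Data :=
  D.signAlg.out n (Data.tuple [pk, skS, cred, Data.opt dom, m])

noncomputable def verify (n : ℕ) (pk m : Data) (dom : Option Data) (σ : Data) (RL : List Data) :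
    Bool :=
  (D.verifyAlg.out n (Data.tuple [pk, m, Data.opt dom, σ, Data.tuple RL])).toBool

/-- The answer is `1`, `0` or `⊥`. -/
noncomputable def link (n : ℕ) (pk σ₀ σ₁ : Data) : Option Bool :=
  (D.linkAlg.out n (Data.tuple [pk, σ₀, σ₁])).toOpt.map Data.toBool

noncomputable def nymGen (n : ℕ) (pk skS dom : Data) : Data :=
  D.nymGenAlg.out n (Data.tuple [pk, skS, dom])

noncomputable def nymExtract (n : ℕ) (pk σ : Data) : Data :=
  D.nymExtractAlg.out n (Data.tuple [pk, σ])

noncomputable def verifyBsn (n : ℕ) (pk σ dom : Data) : Bool :=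
  (D.verifyBsnAlg.out n (Data.tuple [pk, σ, dom])).toBool

/-- `NymGen(sk_S, dom) = NymExtract(Sign(sk_S, cred, dom, m))` for all keys, valid credentials,
basenames `dom ≠ ⊥` and messages: the pseudonym of a signer for a basename is contained in each of
the signer's signatures for this basename. -/
def NymsMatch : Prop :=
  ∀ (n : ℕ) (pk sk skS cred dom m σ : Data),
    (pk, sk) ∈ (D.setup n).support → skS ∈ (D.userKey n pk).support →
    D.check n pk skS cred = true → σ ∈ (D.sign n pk skS cred (some dom) m).support →
    D.nymGen n pk skS dom = D.nymExtract n pk σ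

/-- State of the challenger in the user-controlled-anonymity game. -/
structure GameState where
  /-- open runs of the `Join` protocol: identity `S` with its secret key -/
  sessions : Data → Option Data
  /-- the joined signers: identity `S` with `(sk_S, cred_S)` -/
  signers : Data → Option (Data × Data)
  /-- the identities for which the secret key was handed out -/
  corrupted : Finset Data
  /-- the pairs `(S, dom)` that occurred in a `Sign` query -/
  signed : Finset (Data × Option Data)
  /-- the challenge `(S₀, S₁, dom)`, once it was made -/
  challenge : Option (Data × Data × Option Data)

/-- Initial state. -/
def GameState.init : GameState := ⟨fun _ => none, fun _ => none, ∅, ∅, none⟩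

/-- `Sign` query. -/
noncomputable def signQuery (n : ℕ) (pk S : Data) (dom : Option Data) (m : Data) (st : GameState) :
    PMF (Data × GameState) :=
  match st.signers S with
  | none => return (Data.opt none, st)
  | some (skS, cred) => do
      let σ ← D.sign n pk skS cred dom m
      return (Data.opt (some σ), { st with signed := insert (S, dom) st.signed })

/-- First half of a `Join` query: the challenger, as the user `S`, samples a key and sends `com`. -/
noncomputable def joinQuery (n : ℕ) (pk S : Data) (st : GameState) : PMF (Data × GameState) :=
  if (st.signers S).isSome then return (Data.opt none, st)
  else do
    let skS ← D.userKey n pk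
    let r ← coins (D.joinCoins.eval n)
    return (Data.opt (some (D.join n pk skS r)),
      { st with sessions := Function.update st.sessions S (some skS) })

/-- Second half of a `Join` query: the adversary, as the issuer, sends a credential; the challenger
checks that it is valid. The answer is `1` or `⊥`. -/
noncomputable def credQuery (n : ℕ) (pk S cred : Data) (st : GameState) : PMF (Data × GameState) :=
  match st.sessions S with
  | none => return (Data.opt none, st)
  | some skS =>
      if (st.signers S).isNone ∧ D.check n pk skS cred = true then
        return (Data.opt (some (Data.bit true)),
          { st with
            sessions := Function.update st.sessions S none
            signers := Function.update st.signers S (some (skS, cred)) })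
      else
        return (Data.opt none, { st with sessions := Function.update st.sessions S none })

/-- `Corrupt` query. -/
noncomputable def corruptQuery (S : Data) (st : GameState) : PMF (Data × GameState) :=
  match st.signers S with
  | none => return (Data.opt none, st)
  | some (skS, _) =>
      return (Data.opt (some skS), { st with corrupted := insert S st.corrupted })

/-- The challenge: `S_b` signs `m` with respect to `dom`. There is only one challenge. -/
noncomputable def challengeQuery (n : ℕ) (pk : Data) (b : Bool) (S₀ S₁ : Data) (dom : Option Data)
    (m : Data) (st : GameState) : PMF (Data × GameState) :=
  match st.challenge, st.signers S₀, st.signers S₁ with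
  | none, some u₀, some u₁ => do
      let u := if b then u₁ else u₀
      let σ ← D.sign n pk u.1 u.2 dom m
      return (Data.opt (some σ), { st with challenge := some (S₀, S₁, dom) })
  | _, _, _ => return (Data.opt none, st)

/-- The challenger with bit `b`: a query is a tuple whose first entry selects the kind of query. -/
noncomputable def challenger (n : ℕ) (pk : Data) (b : Bool) (st : GameState) (q : Data) :
    PMF (Data × GameState) :=
  match (q.nth 0).len with
  | 0 => D.signQuery n pk (q.nth 1) (q.nth 2).toOpt (q.nth 3) st
  | 1 => D.joinQuery n pk (q.nth 1) st
  | 2 => D.credQuery n pk (q.nth 1) (q.nth 2) st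
  | 3 => corruptQuery (q.nth 1) st
  | 4 => D.challengeQuery n pk b (q.nth 1) (q.nth 2) (q.nth 3).toOpt (q.nth 4) st
  | _ => return (Data.opt none, st)

/-- The adversary wins if it made a challenge, obeyed the restrictions (before and after the
challenge), and output the bit `b`. -/
def Wins (b : Bool) (r : Option Data × GameState) : Prop :=
  r.1.map Data.toBool = some b ∧
    ∃ S₀ S₁ dom, r.2.challenge = some (S₀, S₁, dom) ∧
      S₀ ∉ r.2.corrupted ∧ S₁ ∉ r.2.corrupted ∧
      (dom ≠ none → (S₀, dom) ∉ r.2.signed ∧ (S₁, dom) ∉ r.2.signed)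

/-- The user-controlled-anonymity game. The adversary gets both keys of the issuer. -/
noncomputable def anonExp (A : Adversary) (n : ℕ) : PMF Bool := do
  let b ← PMF.uniformOfFintype Bool
  let k ← D.setup n
  let r ← (A.run n (Data.tuple [k.2, k.1])).play (D.challenger n k.1 b) GameState.init
  return (open Classical in decide (Wins b r))

/-- User-controlled anonymity: no adversary wins with probability non-negligibly above `1/2`. -/
def UserControlledAnonymity : Prop :=
  ∀ A : Adversary, ∃ ν : ℕ → ℝ, Negligible ν ∧ ∀ n, Pr (D.anonExp A n) ≤ 1 / 2 + ν n

end DAAScheme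

/-! ## The TrollThrottle protocol -/

/-- The building blocks: a DAA scheme with pseudonyms, a non-interactive proof system, and a hash
function. -/
structure TrollThrottle where
  daa : DAAScheme
  zk : ProofSystem
  hashAlg : PTAlgorithm

namespace TrollThrottle

variable (T : TrollThrottle)

noncomputable def hash (n : ℕ) (m : Data) : Data := T.hashAlg.out n m

/-- The relation `R_Join`: the statement `(com, pk)` has the witness `(sk_S, r)` if `Join` with key
`sk_S` and coins `r` outputs `com`. -/
def joinRelation (n : ℕ) (x w : Data) : Prop :=
  ∃ (com pk skS : Data) (r : List Bool), r.length = T.daa.joinCoins.eval n ∧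
    x = Data.tuple [com, pk] ∧ w = Data.tuple [skS, Data.bits r] ∧ com = T.daa.join n pk skS r

/-- `Setup`: `ρ = (1ⁿ, ρ_Join)`. -/
noncomputable def setup (n : ℕ) : PMF Data :=
  (T.zk.setup n).map fun ρJ => Data.tuple [Data.unary n, ρJ]

/-- `KeyGen`: the keys `pk_I = pk_DAA` and `sk_I = (pk_DAA, sk_DAA)`. -/
noncomputable def keyGen (n : ℕ) : PMF (Data × Data) :=
  (T.daa.setup n).map fun k => (k.1, Data.tuple [k.1, k.2])

/-- First message `(com, Π_Join)` of the user in `Join`. -/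
noncomputable def joinMessage (n : ℕ) (ρ pk skU : Data) : PMF (Data × Data) := do
  let r ← coins (T.daa.joinCoins.eval n)
  let com := T.daa.join n pk skU r
  let π ← T.zk.createProof n (ρ.nth 1) (Data.tuple [com, pk]) (Data.tuple [skU, Data.bits r])
  return (com, π)

/-- The end of `Join`: the user, on receiving `cred`, accepts it if it is valid. -/
noncomputable def joinAccepts (n : ℕ) (pk skU cred : Data) : Bool := T.daa.check n pk skU cred

/-- `Issue`: abort (`none`) if the proof is invalid, and issue a DAA credential otherwise. -/
noncomputable def issue (n : ℕ) (ρ skI com π : Data) : PMF (Option Data) := do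
  let ok ← T.zk.verifyProof n (ρ.nth 1) (Data.tuple [com, skI.nth 0]) π
  if ok then
    let cred ← T.daa.issue n (skI.nth 0) (skI.nth 1) com
    return some cred
  else return none

/-- An honest run of `Join`-`Issue` with a fresh secret key; the outcome is `(sk_U, cred_U)`, or
`none` if one of the parties aborts. -/
noncomputable def joinIssue (n : ℕ) (ρ pk skI : Data) : PMF (Option (Data × Data)) := do
  let skU ← T.daa.userKey n pk
  let msg ← T.joinMessage n ρ pk skU
  let cred ← T.issue n ρ skI msg.1 msg.2
  return (cred.filter fun c => T.joinAccepts n pk skU c).map fun c => (skU, c)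

/-- `Comment`: outputs `nym` and `γ = (σ, nym, dom, h(m))`. -/
noncomputable def comment (n : ℕ) (pk skU cred dom m : Data) : PMF (Data × Data) := do
  let σ ← T.daa.sign n pk skU cred (some dom) (T.hash n m)
  let nym := T.daa.nymGen n pk skU dom
  return (nym, Data.tuple [σ, nym, dom, T.hash n m])

/-- `Verify`. -/
noncomputable def verify (n : ℕ) (pk nym dom m γ : Data) : Bool :=
  decide (γ = Data.tuple [γ.nth 0, nym, dom, T.hash n m]) &&
    T.daa.verify n pk (γ.nth 3) (some dom) (γ.nth 0) [] &&
    decide (T.daa.nymExtract n pk (γ.nth 0) = nym) && T.daa.verifyBsn n pk (γ.nth 0) dom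

/-- `Claim`: the evidence is the comment itself. -/
def claim (_pk _skU _cred _dom _m γ : Data) : Data := γ

/-- `VerifyClaim`. -/
noncomputable def verifyClaim (n : ℕ) (pk dom m γ _evidence : Data) : Bool :=
  T.verify n pk (γ.nth 1) dom m γ

/-! ### The anonymity game -/

/-- An entry of `USK`: `(sk_U, cred_U, V)`. -/
structure UserRecord where
  key : Data
  cred : Data
  verifier : Data

/-- An entry of `COMM`: `(U, nym, dom, m, γ)`. -/
structure CommentRecord where
  user : Data
  nym : Data
  dom : Data
  msg : Data
  comment : Data

/-- The global sets of the game. No verifier is corrupted in this game (the set `VM` stays empty),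
and there is only one challenge. -/
structure GameState where
  /-- the pairs `(V, U)` with `ver[V, U] = 1` -/
  ver : Finset (Data × Data)
  /-- honest users -/
  HU : Finset Data
  /-- corrupted users -/
  CU : Finset Data
  USK : Data → Option UserRecord
  COMM : List CommentRecord
  /-- open runs of `Join` with the adversary: user `U` with `(sk_U, V)` -/
  sessions : Data → Option (Data × Data)
  /-- the pair `(U*, dom*)`, once the adversary has chosen it -/
  challenge : Option (Data × Data)

/-- Initial state. -/
def GameState.init : GameState := ⟨∅, ∅, ∅, fun _ => none, [], fun _ => none, none⟩

/-- `CorruptUser(U)`. -/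
noncomputable def corruptUser (U : Data) (st : GameState) : PMF (Data × GameState) :=
  return (Data.opt ((st.USK U).map fun u => Data.tuple [u.key, u.cred]),
    { st with CU := insert U st.CU, HU := st.HU.erase U })

/-- `CreateHonestUser(U, V)`: an honest run of `Join`-`Issue`. The answer is the credential. -/
noncomputable def createHonestUser (n : ℕ) (ρ pk skI U V : Data) (st : GameState) :
    PMF (Data × GameState) :=
  if U ∈ st.HU ∪ st.CU then return (Data.opt none, st)
  else do
    let st' := { st with ver := insert (V, U) st.ver }
    let u ← T.joinIssue n ρ pk skI
    match u with
    | none => return (Data.opt none, st')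
    | some (skU, cred) =>
        return (Data.opt (some cred),
          { st' with
            USK := Function.update st'.USK U (some ⟨skU, cred, V⟩)
            HU := insert U st'.HU })

/-- `HJoinSystem(U, V)`, first half: an honest user with a fresh secret key starts `Join` with the
adversary, who gets `(com, Π_Join)`. -/
noncomputable def hJoinStart (n : ℕ) (ρ pk U V : Data) (st : GameState) : PMF (Data × GameState) :=
  if U ∈ st.HU ∪ st.CU then return (Data.opt none, st)
  else do
    let skU ← T.daa.userKey n pk
    let msg ← T.joinMessage n ρ pk skU
    return (Data.opt (some (Data.tuple [msg.1, msg.2])),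
      { st with
        ver := insert (V, U) st.ver
        sessions := Function.update st.sessions U (some (skU, V)) })

/-- `HJoinSystem`, second half: the adversary sends a credential. If it is valid, then the user has
joined. The answer is `1` or `⊥`. -/
noncomputable def hJoinFinish (n : ℕ) (pk U cred : Data) (st : GameState) :
    PMF (Data × GameState) :=
  match st.sessions U with
  | none => return (Data.opt none, st)
  | some (skU, V) =>
      if U ∉ st.HU ∪ st.CU ∧ T.joinAccepts n pk skU cred = true then
        return (Data.opt (some (Data.bit true)),
          { st with
            sessions := Function.update st.sessions U none
            USK := Function.update st.USK U (some ⟨skU, cred, V⟩)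
            HU := insert U st.HU })
      else
        return (Data.opt none, { st with sessions := Function.update st.sessions U none })

/-- `CreateComment(U, dom, m)`: the answer is `(nym, γ)`. -/
noncomputable def createComment (n : ℕ) (pk U dom m : Data) (st : GameState) :
    PMF (Data × GameState) :=
  match (if U ∈ st.HU then st.USK U else none) with
  | none => return (Data.opt none, st)
  | some u => do
      let c ← T.comment n pk u.key u.cred dom m
      return (Data.opt (some (Data.tuple [c.1, c.2])),
        { st with COMM := ⟨U, c.1, dom, m, c.2⟩ :: st.COMM })

/-- `Chall_b(U, dom, m)`: a fresh user joins, and the answer is a comment by `U` if `b = 0` and by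
the fresh user if `b = 1`. The answer is `⊥` if `U` is not an honest user or if the run of
`Join`-`Issue` is aborted. -/
noncomputable def chall (n : ℕ) (ρ pk skI : Data) (b : Bool) (U dom m : Data) (st : GameState) :
    PMF Data :=
  match (if U ∈ st.HU then st.USK U else none) with
  | none => return Data.opt none
  | some u => do
      let fresh ← T.joinIssue n ρ pk skI
      match fresh with
      | none => return Data.opt none
      | some (sk', cred') =>
          let c ← if b then T.comment n pk sk' cred' dom m else T.comment n pk u.key u.cred dom m
          return Data.opt (some (Data.tuple [c.1, c.2]))

/-- The adversary's choice of `(U*, dom*, m*)`, answered by `Chall_b`. It is made only once. -/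
noncomputable def challengeQuery (n : ℕ) (ρ pk skI : Data) (b : Bool) (U dom m : Data)
    (st : GameState) : PMF (Data × GameState) :=
  if st.challenge.isSome then return (Data.opt none, st)
  else do
    let c ← T.chall n ρ pk skI b U dom m st
    return (c, { st with challenge := some (U, dom) })

/-- The oracles of the game with bit `b`: a query is a tuple whose first entry selects the oracle. -/
noncomputable def oracles (n : ℕ) (ρ pk skI : Data) (b : Bool) (st : GameState) (q : Data) :
    PMF (Data × GameState) :=
  match (q.nth 0).len with
  | 0 => corruptUser (q.nth 1) st
  | 1 => T.createHonestUser n ρ pk skI (q.nth 1) (q.nth 2) st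
  | 2 => T.hJoinStart n ρ pk (q.nth 1) (q.nth 2) st
  | 3 => T.hJoinFinish n pk (q.nth 1) (q.nth 2) st
  | 4 => T.createComment n pk (q.nth 1) (q.nth 2) (q.nth 3) st
  | 5 => T.challengeQuery n ρ pk skI b (q.nth 1) (q.nth 2) (q.nth 3) st
  | _ => return (Data.opt none, st)

/-- The experiment returns `1` if the adversary has made its choice `(U*, dom*, m*)`, `COMM` contains
no comment of `U*` for `dom*`, the output of the adversary is `b`, and `U*` is an honest user. -/
def Wins (b : Bool) (r : Option Data × GameState) : Prop :=
  r.1.map Data.toBool = some b ∧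
    ∃ U dom, r.2.challenge = some (U, dom) ∧ U ∈ r.2.HU ∧
      ∀ c ∈ r.2.COMM, ¬ (c.user = U ∧ c.dom = dom)

/-- The anonymity experiment. The two stages of the adversary (before and after the challenge) are
one program that keeps its state. -/
noncomputable def anonExp (A : Adversary) (n : ℕ) : PMF Bool := do
  let ρ ← T.setup n
  let k ← T.keyGen n
  let b ← PMF.uniformOfFintype Bool
  let r ← (A.run n (Data.tuple [ρ, k.2])).play (T.oracles n ρ k.1 k.2 b) GameState.init
  return (open Classical in decide (Wins b r))

/-- Anonymity: no adversary wins with probability non-negligibly above `1/2`. -/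
def Anonymity : Prop :=
  ∀ A : Adversary, ∃ ν : ℕ → ℝ, Negligible ν ∧ ∀ n, Pr (T.anonExp A n) ≤ 1 / 2 + ν n

end TrollThrottle

end Troll

/-! The proof compares games in three hops. Let `A` attack the anonymity of TrollThrottle. The
intermediate game is that of user-controlled anonymity, extended so that a join also returns a proof
for `R_Join` (`proofChallenger`); these proofs are honest or simulated.

First hop (`anonExp_le`): `userAdversary` plays the game of `A` on top of the extended challenger
with honest proofs. It knows the issuer's key, so it issues the credentials of honest joins itself,
while the users' keys stay with the challenger. A comment is one signature query. Its pseudonym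
depends on an unknown key, but by `NymsMatch` it can be extracted from the signature. For the
challenge a fresh user joins, and the two signers are `U*` and the fresh user, so both games share
the bit. If `A` wins, then `U*` is uncorrupted and never signed for `dom*`, and the fresh identity
was used for nothing else, so the other game is won too. If `A` received `⊥` for its choice, it may
still win while no challenge was made; a dummy challenge with `U*` in both roles and basename `⊥`
then repairs the count.

Second hop (`le_realExp`, `simExp_le`): `zkAdversary` plays the extended challenger itself. It knows
all witnesses, takes the proofs from its oracle, and reports whether `userAdversary` won.
Zero-knowledge bounds the change from honest to simulated proofs.

Third hop (`le_anonExp`): a simulated proof needs only the statement `(com, pk)`, so `anonAdversary`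
can add such proofs to the joins of the actual challenger. Its winning probability is at most `1/2`
plus a negligible amount, and the chain of inequalities gives the claim.

Adversaries are programs with a clock, so all reductions have to be actual programs; this is the
bulk of the proof. `W` is the weakest pre-expectation of a program, with the remaining time visible.
Reductions are written in the structured language `Prog`, whose compilation is bounded from below by
`Prog.wp_le_W`; `Cmd.wrap` runs an adversary with a handler in place of its oracle. It is enough to
bound handlers from below: the total mass of a program is at most one, so a lower bound for `1 - f`
is an upper bound for `f` (`W_le_of_le_W`). `Simulates.le_W` and `Simulates.W_le` thus give both
directions from one verification of each handler. The clocks are polynomial because answers have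
bounded size, tables grow by a bounded amount per query, and temporaries are cleared before each
call. -/

namespace Troll

open scoped ENNReal

/-! ## Expectations -/

/-- The expectation of a nonnegative function. -/
noncomputable def E {α : Type} (p : PMF α) (f : α → ℝ≥0∞) : ℝ≥0∞ := ∑' a, p a * f a

section Expectation

variable {α β : Type}

theorem E_pure (a : α) (f : α → ℝ≥0∞) : E (PMF.pure a) f = f a := by
  unfold E
  rw [tsum_eq_single a]
  · simp
  · intro b hb
    simp [PMF.pure_apply, hb]

theorem E_return (a : α) (f : α → ℝ≥0∞) : E (pure a : PMF α) f = f a := E_pure a f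

theorem E_bind (p : PMF α) (k : α → PMF β) (f : β → ℝ≥0∞) :
    E (p.bind k) f = E p fun a => E (k a) f := by
  unfold E
  simp only [PMF.bind_apply, ← ENNReal.tsum_mul_right, ← ENNReal.tsum_mul_left]
  rw [ENNReal.tsum_comm]
  simp only [mul_assoc]

theorem E_do (p : PMF α) (k : α → PMF β) (f : β → ℝ≥0∞) :
    E (p >>= k) f = E p fun a => E (k a) f := E_bind p k f

theorem E_map (p : PMF α) (h : α → β) (f : β → ℝ≥0∞) :
    E (p.map h) f = E p fun a => f (h a) := by
  rw [← PMF.bind_pure_comp, E_bind]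
  simp [E_pure]

theorem E_mono {p : PMF α} {f g : α → ℝ≥0∞} (h : ∀ a ∈ p.support, f a ≤ g a) : E p f ≤ E p g := by
  refine ENNReal.tsum_le_tsum fun a => ?_
  by_cases ha : a ∈ p.support
  · gcongr
    exact h a ha
  · simp [(PMF.apply_eq_zero_iff p a).2 ha]

theorem E_congr {p : PMF α} {f g : α → ℝ≥0∞} (h : ∀ a ∈ p.support, f a = g a) : E p f = E p g :=
  le_antisymm (E_mono fun a ha => (h a ha).le) (E_mono fun a ha => (h a ha).ge)

theorem E_const (p : PMF α) (c : ℝ≥0∞) : E p (fun _ => c) = c := by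
  simp [E, ENNReal.tsum_mul_right, p.tsum_coe]

theorem E_le_one {p : PMF α} {f : α → ℝ≥0∞} (h : ∀ a, f a ≤ 1) : E p f ≤ 1 :=
  (E_mono fun a _ => h a).trans (E_const p 1).le

theorem E_add (p : PMF α) (f g : α → ℝ≥0∞) : E p (fun a => f a + g a) = E p f + E p g := by
  simp [E, mul_add, ENNReal.tsum_add]

theorem E_comm (p : PMF α) (q : PMF β) (f : α → β → ℝ≥0∞) :
    E p (fun a => E q (f a)) = E q fun b => E p fun a => f a b := by
  unfold E
  simp only [← ENNReal.tsum_mul_left]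
  rw [ENNReal.tsum_comm]
  simp only [mul_left_comm]

/-- For `f ≤ 1` the expectations of `f` and `1 - f` add up to one. This half is what turns lower
bounds into upper bounds. -/
theorem one_sub_E_le {p : PMF α} {f : α → ℝ≥0∞} (h : ∀ a, f a ≤ 1) :
    1 - E p (fun a => 1 - f a) ≤ E p f := by
  rw [tsub_le_iff_left, ← E_add]
  simp [tsub_add_cancel_of_le (h _), E_const]

theorem E_indicator (p : PMF Bool) : E p (fun b => if b then 1 else 0) = p true := by
  simp [E]

theorem E_single [DecidableEq α] (p : PMF α) (a : α) :
    E p (fun b => if b = a then 1 else 0) = p a := by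
  simp [E]

end Expectation

/-! ## Weakest pre-expectations of interactions and programs -/

namespace Interaction

variable {α β σ : Type}

/-- The expectation of `f` over the runs that end with a result. -/
noncomputable def wp (O : σ → Data → PMF (Data × σ)) (f : α → σ → ℝ≥0∞) :
    Interaction α → σ → ℝ≥0∞
  | ret a, s => f a s
  | timeout, _ => 0
  | flip k, s => E (PMF.uniformOfFintype Bool) fun b => (k b).wp O f s
  | ask q k, s => E (O s q) fun r => (k r.1).wp O f r.2

/-- Timeouts count as zero in `wp`; by `hn` nothing is lost. -/
theorem E_play (O : σ → Data → PMF (Data × σ)) (h : Option α × σ → ℝ≥0∞)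
    (hn : ∀ s, h (none, s) = 0) (i : Interaction α) (s : σ) :
    E (i.play O s) h = i.wp O (fun a s => h (some a, s)) s := by
  induction i generalizing s with
  | ret a => simp [play, wp, E_pure]
  | timeout => simp [play, wp, E_pure, hn]
  | flip k ih => simp [play, wp, E_bind, ih]
  | ask q k ih => simp [play, wp, E_bind, ih]

theorem wp_map (O : σ → Data → PMF (Data × σ)) (h : α → β) (f : β → σ → ℝ≥0∞)
    (i : Interaction α) (s : σ) : (i.map h).wp O f s = i.wp O (fun a => f (h a)) s := by
  induction i generalizing s with
  | ret a => simp [map, wp]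
  | timeout => simp [map, wp]
  | flip k ih => simp [map, wp, ih]
  | ask q k ih => simp [map, wp, ih]

/-- A halting computation never consults its oracle. Its output law, defined with a dummy oracle,
therefore also describes it beside any other oracle `O`, whose state it leaves alone. -/
theorem wp_of_halts (O : σ → Data → PMF (Data × σ)) (f : α → σ → ℝ≥0∞) (d : α)
    (i : Interaction α) (hi : i.Halts) (s : σ) :
    E ((i.play (fun (_ : Unit) _ => PMF.pure (Data.nil, ())) ()).map fun r => r.1.getD d) (fun a => f a s) =
      i.wp O f s := by
  induction i generalizing s with
  | ret a => simp [play, wp, PMF.pure_map, E_pure]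
  | timeout => exact hi.elim
  | flip k ih => simp only [play, wp, PMF.map_bind, E_bind, fun b => ih b (hi b) s]
  | ask q k ih => exact hi.elim

end Interaction

section Programs

variable {σ : Type} (O : σ → Data → PMF (Data × σ))

/-- The expectation of `F` over the terminating runs of a stack of commands; `F` receives the
remaining time, the final store and the final state of the oracle. -/
noncomputable def W (n : ℕ) (p : List Cmd) (s : Store) (z : σ) (F : ℕ → Store → σ → ℝ≥0∞) :
    ℝ≥0∞ :=
  match n, p with
  | n, [] => F n s z
  | 0, _ :: _ => 0
  | n + 1, .assign x e :: p =>
      if e.cost s ≤ n then W (n - e.cost s) p (Function.update s x (e.eval s)) z F else 0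
  | n + 1, .flip x :: p =>
      E (PMF.uniformOfFintype Bool) fun b => W n p (Function.update s x (Data.bit b)) z F
  | n + 1, .call x e :: p =>
      if e.cost s ≤ n then
        E (O z (e.eval s)) fun r =>
          if e.cost s + r.1.size ≤ n then
            W (n - (e.cost s + r.1.size)) p (Function.update s x r.1) r.2 F
          else 0
      else 0
  | n + 1, .seq c d :: p => W n (c :: d :: p) s z F
  | n + 1, .cond e c d :: p =>
      if e.cost s ≤ n then
        W (n - e.cost s) ((if (e.eval s).toBool then c else d) :: p) s z F
      else 0
  | n + 1, .loop e c :: p =>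
      if e.cost s ≤ n then
        W (n - e.cost s) (if (e.eval s).toBool then c :: .loop e c :: p else p) s z F
      else 0
termination_by n
decreasing_by all_goals omega

variable (s : Store) (z : σ) (F : ℕ → Store → σ → ℝ≥0∞) (n x : ℕ) (e : Expr) (c d : Cmd)
  (p : List Cmd)

theorem W_nil : W O n [] s z F = F n s z := by unfold W; cases n <;> rfl

theorem W_zero : W O 0 (c :: p) s z F = 0 := by unfold W; rfl

theorem W_assign : W O (n + 1) (.assign x e :: p) s z F =
    if e.cost s ≤ n then W O (n - e.cost s) p (Function.update s x (e.eval s)) z F else 0 := by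
  rw [W]

theorem W_flip : W O (n + 1) (.flip x :: p) s z F =
    E (PMF.uniformOfFintype Bool) fun b => W O n p (Function.update s x (Data.bit b)) z F := by
  rw [W]

theorem W_call : W O (n + 1) (.call x e :: p) s z F =
    if e.cost s ≤ n then
      E (O z (e.eval s)) fun r =>
        if e.cost s + r.1.size ≤ n then
          W O (n - (e.cost s + r.1.size)) p (Function.update s x r.1) r.2 F
        else 0
    else 0 := by
  rw [W]

theorem W_seq : W O (n + 1) (.seq c d :: p) s z F = W O n (c :: d :: p) s z F := by
  rw [W]

theorem W_cond : W O (n + 1) (.cond e c d :: p) s z F =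
    if e.cost s ≤ n then W O (n - e.cost s) ((if (e.eval s).toBool then c else d) :: p) s z F
    else 0 := by
  rw [W]

theorem W_loop : W O (n + 1) (.loop e c :: p) s z F =
    if e.cost s ≤ n then
      W O (n - e.cost s) (if (e.eval s).toBool then c :: .loop e c :: p else p) s z F
    else 0 := by
  rw [W]

/-- `W` has the same clauses as `exec`, so programs can be analysed without interaction trees. The
remaining time, which `W` offers to the post-expectation, is ignored here. -/
theorem wp_exec (f : Store → σ → ℝ≥0∞) (n : ℕ) : ∀ (p : List Cmd) (s : Store) (z : σ),
    (exec n p s).wp O f z = W O n p s z fun _ => f := by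
  induction n using Nat.strong_induction_on with
  | _ n ih =>
    intro p s z
    rcases p with _ | ⟨c, p⟩
    · rw [W_nil]; unfold exec; cases n <;> simp [Interaction.wp]
    rcases n with _ | n
    · rw [W_zero]; unfold exec; simp [Interaction.wp]
    cases c with
    | assign x e =>
      rw [W_assign, exec]
      split_ifs
      · exact ih _ (by omega) _ _ _
      · rfl
    | flip x =>
      rw [W_flip, exec]
      simp only [Interaction.wp, ih n (by omega)]
    | call x e =>
      rw [W_call, exec]
      split_ifs
      · simp only [Interaction.wp]
        congr 1; ext r
        split_ifs
        · exact ih _ (by omega) _ _ _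
        · rfl
      · rfl
    | seq c d => rw [W_seq, exec]; exact ih _ (by omega) _ _ _
    | cond e c d =>
      rw [W_cond, exec]
      split_ifs
      · exact ih _ (by omega) _ _ _
      · exact ih _ (by omega) _ _ _
      · rfl
    | loop e c =>
      rw [W_loop, exec]
      split_ifs
      · exact ih _ (by omega) _ _ _
      · exact ih _ (by omega) _ _ _
      · rfl

/-- The second part runs with the time that the first one leaves; this is why post-expectations
receive the remaining time. -/
theorem W_append (n : ℕ) : ∀ (p q : List Cmd) (s : Store) (z : σ) (F : ℕ → Store → σ → ℝ≥0∞),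
    W O n (p ++ q) s z F = W O n p s z fun m s z => W O m q s z F := by
  induction n using Nat.strong_induction_on with
  | _ n ih =>
    intro p q s z F
    rcases p with _ | ⟨c, p⟩
    · rw [W_nil]; rfl
    rw [List.cons_append]
    rcases n with _ | n
    · rw [W_zero, W_zero]
    cases c with
    | assign x e =>
      rw [W_assign, W_assign]
      split_ifs
      · exact ih _ (by omega) _ _ _ _ _
      · rfl
    | flip x =>
      rw [W_flip, W_flip]
      simp only [ih n (by omega)]
    | call x e =>
      rw [W_call, W_call]
      split_ifs
      · congr 1; ext r
        split_ifs
        · exact ih _ (by omega) _ _ _ _ _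
        · rfl
      · rfl
    | seq c d => rw [W_seq, W_seq]; exact ih _ (by omega) (c :: d :: p) _ _ _ _
    | cond e c d =>
      rw [W_cond, W_cond]
      split_ifs
      · exact ih _ (by omega) (c :: p) _ _ _ _
      · exact ih _ (by omega) (d :: p) _ _ _ _
      · rfl
    | loop e c =>
      rw [W_loop, W_loop]
      split_ifs
      · exact ih _ (by omega) (c :: .loop e c :: p) _ _ _ _
      · exact ih _ (by omega) p _ _ _ _
      · rfl

theorem W_cons : W O n (c :: p) s z F = W O n [c] s z fun m s z => W O m p s z F :=
  W_append O n [c] p s z F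

theorem Expr.size_eval_le (s : Store) (e : Expr) : (e.eval s).size ≤ e.cost s := by
  induction e with
  | var i => simp [eval, cost]
  | nil => simp [eval, cost, Data.size]
  | cons e f he hf => simp [eval, cost, Data.size]; omega
  | hd e he =>
    simp only [eval, cost]
    cases h : e.eval s with
    | nil => simp [Data.hd, Data.size]
    | cons a b => rw [h] at he; simp [Data.hd, Data.size] at *; omega
  | tl e he =>
    simp only [eval, cost]
    cases h : e.eval s with
    | nil => simp [Data.tl, Data.size]
    | cons a b => rw [h] at he; simp [Data.tl, Data.size] at *; omega
  | eq e f he hf =>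
    have h (d : Data) : 1 ≤ d.size := by cases d <;> simp [Data.size]
    have h1 := h (e.eval s)
    have h2 := h (f.eval s)
    simp only [eval, cost]
    generalize decide (e.eval s = f.eval s) = b
    cases b
    · simp [Data.bit, Data.size]
    · simp [Data.bit, Data.size]; omega

theorem Data.one_le_size (d : Data) : 1 ≤ d.size := by cases d <;> simp [Data.size]

/-- Monotonicity in the budget `n ≤ n'` and in the post-expectation, which may use that the sizes of
the values grow slowly. -/
theorem W_mono_sizes (n : ℕ) : ∀ (n' : ℕ) (p : List Cmd) (s : Store) (z : σ) (b : ℕ → ℕ)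
    (F G : ℕ → Store → σ → ℝ≥0∞), n ≤ n' → (∀ i, (s i).size ≤ b i) →
    (∀ m s' z', m ≤ n → (∀ i, (s' i).size ≤ b i + 3 * n) → F m s' z' ≤ G (m + (n' - n)) s' z') →
    W O n p s z F ≤ W O n' p s z G := by
  induction n using Nat.strong_induction_on with
  | _ n ih =>
    intro n' p s z b F G hn hb hFG
    rcases p with _ | ⟨c, p⟩
    · rw [W_nil, W_nil]
      refine (hFG n s z le_rfl fun i => (hb i).trans (by omega)).trans_eq ?_
      congr 1; omega
    rcases n with _ | n
    · rw [W_zero]; exact zero_le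
    obtain ⟨n', rfl⟩ : ∃ m, n' = m + 1 := ⟨n' - 1, by omega⟩
    have key : ∀ (k : ℕ) (p : List Cmd) (s : Store) (z : σ), k ≤ n →
        (∀ i, (s i).size ≤ b i + 3 * (k + 1)) →
        W O (n - k) p s z F ≤ W O (n' - k) p s z G := by
      intro k p s z hk hs
      refine ih _ (by omega) _ p s z _ F G (by omega) hs fun m s' z' hm hs' => ?_
      have := hFG m s' z' (by omega) fun i => (hs' i).trans (by omega)
      rwa [show n' - k - (n - k) = n' + 1 - (n + 1) by omega]
    have keep (k : ℕ) : ∀ i, (s i).size ≤ b i + 3 * (k + 1) := fun i => (hb i).trans (by omega)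
    -- The factor `3` is due to coins: a flip costs one unit and may store `bit true`, of size `3`.
    -- Assignments and answers pay for the size of the stored value.
    have upd (k x : ℕ) (v : Data) (hv : v.size ≤ 3 * (k + 1)) :
        ∀ i, (Function.update s x v i).size ≤ b i + 3 * (k + 1) := by
      intro i
      by_cases h : i = x
      · subst h; simp; omega
      · simpa [h] using keep k i
    cases c with
    | assign x e =>
      rw [W_assign, W_assign]
      split_ifs
      · exact key _ _ _ _ (by omega) (upd _ _ _ (by have := e.size_eval_le s; omega))
      · omega
      · exact zero_le
      · exact zero_le
    | flip x =>
      rw [W_flip, W_flip]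
      refine E_mono fun b _ => key 0 _ _ _ (by omega) (upd _ _ _ ?_)
      cases b <;> simp [Data.bit, Data.size]
    | call x e =>
      rw [W_call, W_call]
      split_ifs
      · refine E_mono fun r _ => ?_
        split_ifs
        · exact key _ _ _ _ (by omega) (upd _ _ _ (by omega))
        · omega
        · exact zero_le
        · exact zero_le
      · omega
      · exact zero_le
      · exact zero_le
    | seq c d => rw [W_seq, W_seq]; exact key 0 _ _ _ (by omega) (keep _)
    | cond e c d =>
      rw [W_cond, W_cond]
      by_cases h : e.cost s ≤ n
      · rw [if_pos h, if_pos (show e.cost s ≤ n' by omega)]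
        exact key _ _ _ _ (by omega) (keep _)
      · rw [if_neg h]; exact zero_le
    | loop e c =>
      rw [W_loop, W_loop]
      by_cases h : e.cost s ≤ n
      · rw [if_pos h, if_pos (show e.cost s ≤ n' by omega)]
        exact key _ _ _ _ (by omega) (keep _)
      · rw [if_neg h]; exact zero_le

theorem W_mono {n n' : ℕ} (p : List Cmd) (s : Store) (z : σ) {F G : ℕ → Store → σ → ℝ≥0∞}
    (hn : n ≤ n') (h : ∀ m s z, m ≤ n → F m s z ≤ G (m + (n' - n)) s z) :
    W O n p s z F ≤ W O n' p s z G :=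
  W_mono_sizes O n n' p s z (fun i => (s i).size) F G hn (fun _ => le_rfl)
    fun m s z hm _ => h m s z hm

theorem W_le_one (n : ℕ) : ∀ (p : List Cmd) (s : Store) (z : σ) (F : ℕ → Store → σ → ℝ≥0∞),
    (∀ m s z, F m s z ≤ 1) → W O n p s z F ≤ 1 := by
  induction n using Nat.strong_induction_on with
  | _ n ih =>
    intro p s z F hF
    rcases p with _ | ⟨c, p⟩
    · rw [W_nil]; exact hF _ _ _
    rcases n with _ | n
    · rw [W_zero]; exact zero_le
    cases c with
    | assign x e =>
      rw [W_assign]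
      split_ifs
      · exact ih _ (by omega) _ _ _ _ hF
      · exact zero_le
    | flip x => rw [W_flip]; exact E_le_one fun b => ih _ (by omega) _ _ _ _ hF
    | call x e =>
      rw [W_call]
      split_ifs
      · refine E_le_one fun r => ?_
        split_ifs
        · exact ih _ (by omega) _ _ _ _ hF
        · exact zero_le
      · exact zero_le
    | seq c d => rw [W_seq]; exact ih _ (by omega) _ _ _ _ hF
    | cond e c d =>
      rw [W_cond]
      by_cases h : e.cost s ≤ n
      · rw [if_pos h]; exact ih _ (by omega) _ _ _ _ hF
      · rw [if_neg h]; exact zero_le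
    | loop e c =>
      rw [W_loop]
      by_cases h : e.cost s ≤ n
      · rw [if_pos h]; exact ih _ (by omega) _ _ _ _ hF
      · rw [if_neg h]; exact zero_le

/-- Linearity of the expectation along the execution. It is used for complementary
post-expectations, where this inequality suffices. -/
theorem W_add_le (n : ℕ) : ∀ (p : List Cmd) (s : Store) (z : σ) (F G : ℕ → Store → σ → ℝ≥0∞),
    W O n p s z F + W O n p s z G ≤ W O n p s z fun m s z => F m s z + G m s z := by
  induction n using Nat.strong_induction_on with
  | _ n ih =>
    intro p s z F G
    rcases p with _ | ⟨c, p⟩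
    · simp only [W_nil, le_rfl]
    rcases n with _ | n
    · simp [W_zero]
    cases c with
    | assign x e =>
      simp only [W_assign]
      split_ifs
      · exact ih _ (by omega) _ _ _ _ _
      · simp
    | flip x =>
      simp only [W_flip]
      rw [← E_add]
      exact E_mono fun b _ => ih _ (by omega) _ _ _ _ _
    | call x e =>
      simp only [W_call]
      split_ifs
      · rw [← E_add]
        refine E_mono fun r _ => ?_
        split_ifs
        · exact ih _ (by omega) _ _ _ _ _
        · simp
      · simp
    | seq c d => simp only [W_seq]; exact ih _ (by omega) _ _ _ _ _
    | cond e c d =>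
      simp only [W_cond]
      by_cases h : e.cost s ≤ n
      · simp only [if_pos h]; exact ih _ (by omega) _ _ _ _ _
      · simp [h]
    | loop e c =>
      simp only [W_loop]
      by_cases h : e.cost s ≤ n
      · simp only [if_pos h]; exact ih _ (by omega) _ _ _ _ _
      · simp [h]

/-- A lower bound for all post-expectations, valid for a large budget, yields an upper bound for
bounded post-expectations and any smaller budget. -/
theorem W_le_of_le_W {ι : Type} (q : PMF ι) {n C : ℕ} (hn : n ≤ C) (p : List Cmd) (s : Store) (z : σ)
    (R : ι → Store → σ → Prop)
    (h : ∀ (g : ι → ℝ≥0∞) (F : ℕ → Store → σ → ℝ≥0∞),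
      (∀ i m s' z', R i s' z' → g i ≤ F m s' z') → E q g ≤ W O C p s z F)
    (f : ι → ℝ≥0∞) (F : ℕ → Store → σ → ℝ≥0∞) (hf : ∀ i, f i ≤ 1) (hF : ∀ m s z, F m s z ≤ 1)
    (hR : ∀ i m s' z', m ≤ n → R i s' z' → F m s' z' ≤ f i) :
    W O n p s z F ≤ E q f := by
  -- `G` is `F` moved to the budget `C`, where every remaining time is larger by `C - n`. The
  -- cut-off ensures that the time passed to `F` is at most `n`, as `hR` requires.
  set G : ℕ → Store → σ → ℝ≥0∞ := fun m s z => if C - n ≤ m ∧ m ≤ C then F (m - (C - n)) s z else 0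
    with hG
  have hG1 : ∀ m s z, G m s z ≤ 1 := by
    intro m s z
    simp only [hG]
    split_ifs
    · exact hF _ _ _
    · exact zero_le
  have h1 : W O n p s z F ≤ W O C p s z G := by
    refine W_mono O p s z hn fun m s z hm => ?_
    simp only [hG]
    rw [if_pos (by omega)]
    simp
  have h2 : E q (fun i => 1 - f i) ≤ W O C p s z fun m s z => 1 - G m s z := by
    refine h _ _ fun i m s' z' hr => tsub_le_tsub_left ?_ 1
    simp only [hG]
    split_ifs with hm
    · exact hR _ _ _ _ (by omega) hr
    · exact zero_le
  -- `G` and `1 - G` share a total of at most one, so the lower bound for `1 - G` bounds `G` from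
  -- above.
  have h3 := W_add_le O C p s z G fun m s z => 1 - G m s z
  have h4 : W O C p s z (fun m s z => G m s z + (1 - G m s z)) ≤ 1 :=
    W_le_one O C p s z _ fun m s z => (add_tsub_cancel_of_le (hG1 m s z)).le
  calc W O n p s z F ≤ W O C p s z G := h1
    _ ≤ 1 - W O C p s z (fun m s z => 1 - G m s z) :=
        ENNReal.le_sub_of_add_le_right
          (((le_add_self).trans (h3.trans h4)).trans_lt ENNReal.one_lt_top).ne (h3.trans h4)
    _ ≤ 1 - E q (fun i => 1 - f i) := tsub_le_tsub_left h2 1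
    _ ≤ E q f := one_sub_E_le hf

end Programs

end Troll

namespace Troll

open scoped ENNReal

/-! ## Renaming of variables -/

namespace Expr

/-- Rename the variables of an expression. -/
def ren (ρ : ℕ → ℕ) : Expr → Expr
  | var i => var (ρ i)
  | nil => nil
  | cons e f => cons (e.ren ρ) (f.ren ρ)
  | hd e => hd (e.ren ρ)
  | tl e => tl (e.ren ρ)
  | eq e f => eq (e.ren ρ) (f.ren ρ)

/-- A strict upper bound for the variables of an expression. -/
def vars : Expr → ℕ
  | var i => i + 1
  | nil => 0
  | cons e f => max e.vars f.vars
  | hd e => e.vars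
  | tl e => e.vars
  | eq e f => max e.vars f.vars

theorem eval_ren_of_lt (ρ : ℕ → ℕ) {s S : Store} {v : ℕ} (h : ∀ i < v, S (ρ i) = s i) (e : Expr)
    (he : e.vars ≤ v) : (e.ren ρ).eval S = e.eval s ∧ (e.ren ρ).cost S = e.cost s := by
  induction e with
  | var i => simp [ren, eval, cost, h i he]
  | nil => simp [ren, eval, cost]
  | cons e f ihe ihf =>
    simp only [vars, max_le_iff] at he
    simp [ren, eval, cost, ihe he.1, ihf he.2]
  | hd e ih => simp [ren, eval, cost, ih he]
  | tl e ih => simp [ren, eval, cost, ih he]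
  | eq e f ihe ihf =>
    simp only [vars, max_le_iff] at he
    simp [ren, eval, cost, ihe he.1, ihf he.2]

theorem eval_ren (ρ : ℕ → ℕ) (S : Store) (e : Expr) : (e.ren ρ).eval S = e.eval fun i => S (ρ i) :=
  (eval_ren_of_lt ρ (fun _ _ => rfl) e le_rfl).1

theorem cost_ren (ρ : ℕ → ℕ) (S : Store) (e : Expr) : (e.ren ρ).cost S = e.cost fun i => S (ρ i) :=
  (eval_ren_of_lt ρ (fun _ _ => rfl) e le_rfl).2

end Expr

namespace Cmd

/-- Rename the variables of a program. -/
def ren (ρ : ℕ → ℕ) : Cmd → Cmd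
  | assign x e => assign (ρ x) (e.ren ρ)
  | flip x => flip (ρ x)
  | call x e => call (ρ x) (e.ren ρ)
  | seq c d => seq (c.ren ρ) (d.ren ρ)
  | cond e c d => cond (e.ren ρ) (c.ren ρ) (d.ren ρ)
  | loop e c => loop (e.ren ρ) (c.ren ρ)

/-- A strict upper bound for the variables of a command. -/
def vars : Cmd → ℕ
  | assign x e => max (x + 1) e.vars
  | flip x => x + 1
  | call x e => max (x + 1) e.vars
  | seq c d => max c.vars d.vars
  | cond e c d => max e.vars (max c.vars d.vars)
  | loop e c => max e.vars c.vars

end Cmd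

variable {σ : Type} (O : σ → Data → PMF (Data × σ))

/-- The renamed copy makes the same steps at the same cost; injectivity of `ρ` keeps its variables
apart, and variables outside the range of `ρ` survive. With `ρ i = 3 * i + 2` this embeds an
algorithm as a subroutine. -/
theorem W_le_W_ren (ρ : ℕ → ℕ) (hρ : Function.Injective ρ) (v : ℕ) (n : ℕ) :
    ∀ (p : List Cmd) (s S : Store) (z : σ) (f F : ℕ → Store → σ → ℝ≥0∞),
    (∀ c ∈ p, c.vars ≤ v) → (∀ i < v, S (ρ i) = s i) →
    (∀ m s' S' z', (∀ i < v, S' (ρ i) = s' i) → (∀ j, (∀ i, j ≠ ρ i) → S' j = S j) →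
      f m s' z' ≤ F m S' z') →
    W O n p s z f ≤ W O n (p.map (Cmd.ren ρ)) S z F := by
  induction n using Nat.strong_induction_on with
  | _ n ih =>
    intro p s S z f F hp hs hfF
    rcases p with _ | ⟨c, p⟩
    · rw [List.map_nil, W_nil, W_nil]
      exact hfF _ _ _ _ hs fun _ _ => rfl
    rcases n with _ | n
    · rw [W_zero]; exact zero_le
    have hc : c.vars ≤ v := hp c List.mem_cons_self
    have hp' : ∀ c ∈ p, c.vars ≤ v := fun c h => hp c (List.mem_cons_of_mem _ h)
    have upd (k x : ℕ) (y : Data) (z : σ) : W O (n - k) p (Function.update s x y) z f ≤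
        W O (n - k) (p.map (Cmd.ren ρ)) (Function.update S (ρ x) y) z F := by
      refine ih _ (by omega) _ _ _ _ _ _ hp' ?_ ?_
      · intro i hi
        by_cases h : i = x
        · simp [h]
        · simp [h, hρ.ne h, hs i hi]
      · intro m s' S' z' h1 h2
        refine hfF m s' S' z' h1 fun j hj => ?_
        rw [h2 j hj, Function.update_of_ne (hj x)]
    cases c with
    | assign x e =>
      simp only [Cmd.vars, max_le_iff] at hc
      simp only [List.map_cons, Cmd.ren]
      rw [W_assign, W_assign]
      obtain ⟨h1, h2⟩ := e.eval_ren_of_lt ρ hs hc.2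
      rw [h1, h2]
      split_ifs
      · exact upd _ _ _ _
      · exact zero_le
    | flip x =>
      simp only [List.map_cons, Cmd.ren]
      rw [W_flip, W_flip]
      exact E_mono fun b _ => upd 0 _ _ _
    | call x e =>
      simp only [Cmd.vars, max_le_iff] at hc
      simp only [List.map_cons, Cmd.ren]
      rw [W_call, W_call]
      obtain ⟨h1, h2⟩ := e.eval_ren_of_lt ρ hs hc.2
      rw [h1, h2]
      split_ifs
      · refine E_mono fun r _ => ?_
        split_ifs
        · exact upd _ _ _ _
        · exact zero_le
      · exact zero_le
    | seq c d =>
      simp only [Cmd.vars, max_le_iff] at hc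
      simp only [List.map_cons, Cmd.ren]
      rw [W_seq, W_seq]
      refine ih n (by omega) (c :: d :: p) _ _ _ _ _ ?_ hs hfF
      simpa using ⟨hc.1, hc.2, hp'⟩
    | cond e c d =>
      simp only [Cmd.vars, max_le_iff] at hc
      simp only [List.map_cons, Cmd.ren]
      rw [W_cond, W_cond]
      obtain ⟨h1, h2⟩ := e.eval_ren_of_lt ρ hs hc.1
      rw [h1, h2]
      by_cases h : e.cost s ≤ n
      · rw [if_pos h, if_pos h]
        have := ih (n - e.cost s) (by omega) ((if (e.eval s).toBool = true then c else d) :: p) _ _ z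
          _ _ ?_ hs hfF
        · convert this using 2
          split_ifs <;> rfl
        · simp only [List.mem_cons, forall_eq_or_imp]
          refine ⟨?_, hp'⟩
          split_ifs
          · exact hc.2.1
          · exact hc.2.2
      · rw [if_neg h]; exact zero_le
    | loop e c =>
      have hc0 := hc
      simp only [Cmd.vars, max_le_iff] at hc
      simp only [List.map_cons, Cmd.ren]
      rw [W_loop, W_loop]
      obtain ⟨h1, h2⟩ := e.eval_ren_of_lt ρ hs hc.1
      rw [h1, h2]
      by_cases h : e.cost s ≤ n
      · rw [if_pos h, if_pos h]
        have := ih (n - e.cost s) (by omega)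
          (if (e.eval s).toBool = true then c :: Cmd.loop e c :: p else p) _ _ z _ _ ?_ hs hfF
        · convert this using 2
          split_ifs <;> rfl
        · split_ifs
          · simpa using ⟨hc.2, hc0, hp'⟩
          · exact hp'
      · rw [if_neg h]; exact zero_le

/-! ## Algorithms as subroutines -/

/-- The store at the start of a program with input `x`. -/
def start (x : Data) : Store := Function.update (fun _ => Data.nil) 0 x

theorem size_start_le (x : Data) (i : ℕ) : (start x i).size ≤ x.size := by
  by_cases h : i = 0
  · simp [start, h]
  · simpa [start, h, Data.size] using x.one_le_size

theorem size_unary (n : ℕ) : (Data.unary n).size = 2 * n + 1 := by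
  induction n with
  | zero => rfl
  | succ n ih => simp [Data.unary, Data.size, ih]; omega

theorem size_withParam (n : ℕ) (x : Data) : (withParam n x).size = 2 * n + x.size + 2 := by
  simp [withParam, Data.size, size_unary]; omega

namespace PPTAlgorithm

variable (A : PPTAlgorithm)

/-- Since an algorithm makes no oracle calls, `O` and `z` may be those of a surrounding program. -/
theorem E_out (n : ℕ) (x : Data) (f : Data → σ → ℝ≥0∞) (z : σ) :
    E (A.out n x) (fun y => f y z) = W O (A.time.eval (withParam n x).size) [A.code] (start (withParam n x)) z
      fun _ s z => f (s 0) z := by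
  unfold out
  rw [Interaction.wp_of_halts O f _ _ (A.halts n x) z]
  unfold Cmd.run
  rw [Interaction.wp_map, wp_exec]
  rfl

/-- A bound for the sizes of outputs, in terms of `n + x.size`. -/
noncomputable def outBound : Polynomial ℕ :=
  (2 * Polynomial.X + 2) + 3 * A.time.comp (2 * Polynomial.X + 2)

theorem eval_mono (p : Polynomial ℕ) {a b : ℕ} (h : a ≤ b) : p.eval a ≤ p.eval b := by
  rw [Polynomial.eval_eq_sum_range, Polynomial.eval_eq_sum_range]
  gcongr

/-- Sizes grow by at most `3` per unit of time (`W_mono_sizes`), so the runs that end with a larger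
output contribute nothing. -/
theorem size_out_le {n : ℕ} {x y : Data} (h : y ∈ (A.out n x).support) :
    y.size ≤ A.outBound.eval (n + x.size) := by
  by_contra hy
  have h1 : E (A.out n x) (fun b => if b = y then 1 else 0) ≤ 0 := by
    rw [A.E_out (fun (_ : Unit) _ => PMF.pure (Data.nil, ())) n x
      (fun b _ => if b = y then 1 else 0) ()]
    refine (W_mono_sizes _ _ _ _ _ _ (fun _ => (withParam n x).size) _ (fun _ _ _ => 0) le_rfl
      (size_start_le _) ?_).trans_eq ?_
    · intro m s z _ hs
      rw [if_neg]
      rintro rfl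
      refine hy ((hs 0).trans ?_)
      have := eval_mono A.time (show (withParam n x).size ≤ 2 * (n + x.size) + 2 by
        rw [size_withParam]; omega)
      simp [outBound]
      have := size_withParam n x
      omega
    -- The zero post-expectation has the value zero: this value is at most one and satisfies `a + a
    -- ≤ a`.
    · have := W_add_le (fun (_ : Unit) _ => PMF.pure (Data.nil, ()))
        (A.time.eval (withParam n x).size) [A.code] (start (withParam n x)) ()
        (fun _ _ _ => 0) (fun _ _ _ => 0)
      have h1 := W_le_one (fun (_ : Unit) _ => PMF.pure (Data.nil, ()))
        (A.time.eval (withParam n x).size) [A.code] (start (withParam n x)) ()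
        (fun _ _ _ => 0) (fun _ _ _ => zero_le_one)
      simp only [add_zero] at this
      set a := W (fun (_ : Unit) _ => PMF.pure (Data.nil, ()))
        (A.time.eval (withParam n x).size) [A.code] (start (withParam n x)) () (fun _ _ _ => 0)
      have ha : a ≠ ⊤ := (h1.trans_lt ENNReal.one_lt_top).ne
      by_contra h0
      exact absurd this (not_le.2 (ENNReal.lt_add_right ha h0))
  rw [E_single] at h1
  exact h (le_antisymm h1 zero_le)

end PPTAlgorithm

/-- A deterministic algorithm as a probabilistic algorithm. -/
noncomputable def PTAlgorithm.toPPT (A : PTAlgorithm) : PPTAlgorithm where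
  code := A.code
  time := A.time
  halts n x := by
    obtain ⟨y, hy⟩ := A.halts n x
    rw [hy]
    trivial

theorem PTAlgorithm.out_toPPT (A : PTAlgorithm) (n : ℕ) (x : Data) :
    A.toPPT.out n x = PMF.pure (A.out n x) := by
  have h : A.code.run (A.time.eval (withParam n x).size) (withParam n x) = .ret (A.out n x) :=
    (A.halts n x).choose_spec
  simp [PPTAlgorithm.out, toPPT, h, Interaction.play, PMF.pure_map]

end Troll

namespace Troll

open scoped ENNReal

@[simp] theorem Data.hd_nil : Data.hd .nil = .nil := rfl
@[simp] theorem Data.hd_cons (a b : Data) : (Data.cons a b).hd = a := rfl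
@[simp] theorem Data.tl_nil : Data.tl .nil = .nil := rfl
@[simp] theorem Data.tl_cons (a b : Data) : (Data.cons a b).tl = b := rfl
@[simp] theorem Data.toBool_nil : Data.toBool .nil = false := rfl
@[simp] theorem Data.toBool_cons (a b : Data) : (Data.cons a b).toBool = true := rfl
@[simp] theorem Data.toBool_bit (b : Bool) : (Data.bit b).toBool = b := by cases b <;> rfl

/-! ## Deterministic pieces of programs -/

/-- From the store `S`, the command `c` runs deterministically, within `C` units of time, to a
store that satisfies `P`. -/
def Det (c : Cmd) (C : ℕ) (S : Store) (P : Store → Prop) : Prop :=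
  ∀ (σ : Type) (O : σ → Data → PMF (Data × σ)) (n : ℕ) (z : σ) (F : ℕ → Store → σ → ℝ≥0∞), C ≤ n →
    ∃ m S', n ≤ m + C ∧ P S' ∧ W O n [c] S z F = F m S' z

namespace Det

variable {c d : Cmd} {C C' : ℕ} {S : Store} {P Q : Store → Prop} {e : Expr}

theorem mono (h : Det c C S P) (hC : C ≤ C') (hPQ : ∀ S', P S' → Q S') : Det c C' S Q := by
  intro σ O n z F hn
  obtain ⟨m, S', h1, h2, h3⟩ := h _ O n z F (by omega)
  exact ⟨m, S', by omega, hPQ _ h2, h3⟩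

theorem le_W (h : Det c C S P) {σ : Type} {O : σ → Data → PMF (Data × σ)} {n : ℕ} {z : σ}
    {F : ℕ → Store → σ → ℝ≥0∞} {p : List Cmd} {r : ℝ≥0∞} (hn : C ≤ n)
    (hr : ∀ m S', n ≤ m + C → P S' → r ≤ W O m p S' z F) : r ≤ W O n (c :: p) S z F := by
  rw [W_cons]
  obtain ⟨m, S', h1, h2, h3⟩ := h _ O n z (fun m s z => W O m p s z F) hn
  rw [h3]
  exact hr m S' h1 h2

theorem seq (h : Det c C S P) (h' : ∀ S', P S' → Det d C' S' Q) :
    Det (.seq c d) (C + C' + 1) S Q := by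
  intro σ O n z F hn
  obtain ⟨n, rfl⟩ : ∃ k, n = k + 1 := ⟨n - 1, by omega⟩
  rw [W_seq, W_cons]
  obtain ⟨m, S', h1, h2, h3⟩ := h _ O n z (fun m s z => W O m [d] s z F) (by omega)
  rw [h3]
  obtain ⟨m', S'', h1', h2', h3'⟩ := h' S' h2 _ O m z F (by omega)
  exact ⟨m', S'', by omega, h2', h3'⟩

theorem assign (x : ℕ) (e : Expr) (S : Store) :
    Det (.assign x e) (e.cost S + 1) S (· = Function.update S x (e.eval S)) := by
  intro σ O n z F hn
  obtain ⟨n, rfl⟩ : ∃ k, n = k + 1 := ⟨n - 1, by omega⟩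
  rw [W_assign, if_pos (by omega), W_nil]
  exact ⟨_, _, by omega, rfl, rfl⟩

theorem cond_true (he : (e.eval S).toBool = true) (h : Det c C S P) :
    Det (.cond e c d) (e.cost S + 1 + C) S P := by
  intro σ O n z F hn
  obtain ⟨n, rfl⟩ : ∃ k, n = k + 1 := ⟨n - 1, by omega⟩
  rw [W_cond, if_pos (by omega), if_pos he]
  obtain ⟨m, S', h1, h2, h3⟩ := h _ O (n - e.cost S) z F (by omega)
  exact ⟨m, S', by omega, h2, h3⟩

theorem cond_false (he : (e.eval S).toBool = false) (h : Det d C S P) :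
    Det (.cond e c d) (e.cost S + 1 + C) S P := by
  intro σ O n z F hn
  obtain ⟨n, rfl⟩ : ∃ k, n = k + 1 := ⟨n - 1, by omega⟩
  rw [W_cond, if_pos (by omega), if_neg (by simp [he])]
  obtain ⟨m, S', h1, h2, h3⟩ := h _ O (n - e.cost S) z F (by omega)
  exact ⟨m, S', by omega, h2, h3⟩

theorem loop_false (he : (e.eval S).toBool = false) :
    Det (.loop e c) (e.cost S + 1) S (· = S) := by
  intro σ O n z F hn
  obtain ⟨n, rfl⟩ : ∃ k, n = k + 1 := ⟨n - 1, by omega⟩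
  rw [W_loop, if_pos (by omega), if_neg (by simp [he]), W_nil]
  exact ⟨_, _, by omega, rfl, rfl⟩

theorem loop_true (he : (e.eval S).toBool = true) (h : Det c C S P)
    (h' : ∀ S', P S' → Det (.loop e c) C' S' Q) :
    Det (.loop e c) (e.cost S + 1 + C + C') S Q := by
  intro σ O n z F hn
  obtain ⟨n, rfl⟩ : ∃ k, n = k + 1 := ⟨n - 1, by omega⟩
  rw [W_loop, if_pos (by omega), if_pos he, W_cons]
  obtain ⟨m, S', h1, h2, h3⟩ := h _ O (n - e.cost S) z (fun m s z => W O m [.loop e c] s z F)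
    (by omega)
  rw [h3]
  obtain ⟨m', S'', h1', h2', h3'⟩ := h' S' h2 _ O m z F (by omega)
  exact ⟨m', S'', by omega, h2', h3'⟩

end Det

/-- The command that does nothing. -/
def Cmd.skip : Cmd := .loop .nil (.flip 0)

theorem Det.skip (S : Store) : Det Cmd.skip 2 S (· = S) := Det.loop_false rfl

/-- Set variables to `nil`. -/
def Cmd.clear : List ℕ → Cmd
  | [] => Cmd.skip
  | i :: l => .seq (.assign i .nil) (Cmd.clear l)

theorem Det.clear (l : List ℕ) : ∀ S : Store, Det (Cmd.clear l) (3 * l.length + 2) S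
    fun S' => (∀ i ∈ l, S' i = Data.nil) ∧ ∀ i ∉ l, S' i = S i := by
  induction l with
  | nil => exact fun S => (Det.skip S).mono (by simp) (by rintro _ rfl; simp)
  | cons i l ih =>
    intro S
    refine (Det.seq (Det.assign i .nil S) fun S' hS' => by subst hS'; exact ih _).mono ?_ ?_
    · simp [Expr.cost]; omega
    · rintro S' ⟨h1, h2⟩
      refine ⟨fun j hj => ?_, fun j hj => ?_⟩
      · by_cases hjl : j ∈ l
        · exact h1 j hjl
        · obtain rfl : j = i := by simpa [hjl] using hj
          rw [h2 j hjl]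
          simp [Expr.eval]
      · simp only [List.mem_cons, not_or] at hj
        rw [h2 j hj.2, Function.update_of_ne hj.1]

/-! ## Association lists -/

/-- The value that belongs to the key `k` in an association list (`nil` if there is none). -/
def assoc : Data → Data → Data
  | .nil, _ => .nil
  | .cons p l, k => if p.hd = k then p.tl else assoc l k

/-- The loop of `lookupCmd`. -/
def lookupLoop : Cmd :=
  .loop (.var 2)
    (.cond (.eq (.hd (.hd (.var 2))) (.var 5))
      (.seq (.assign 8 (.tl (.hd (.var 2)))) (.assign 2 .nil))
      (.assign 2 (.tl (.var 2))))

/-- A round costs at most `4 * l.size + (S 5).size + 20` and shortens the list, so `l.size` such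
charges suffice. A hit empties variable `2`, which ends the loop. -/
theorem Det.lookupLoop (l : Data) : ∀ S : Store, S 2 = l → S 8 = .nil →
    Det lookupLoop (l.size * (4 * l.size + (S 5).size + 20)) S
      fun S' => S' 8 = assoc l (S 5) ∧ ∀ j, j ≠ 2 → j ≠ 5 → j ≠ 8 → S' j = S j := by
  induction l with
  | nil =>
    intro S h2 h8
    refine (Det.loop_false ?_).mono ?_ ?_
    · simp [Expr.eval, h2]
    · simp [Expr.cost, h2, Data.size]
    · rintro _ rfl
      exact ⟨by simp [h8, assoc], fun _ _ _ _ => rfl⟩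
  | cons a l iha ihl =>
    intro S h2 h8
    have hcost : l.size * (4 * l.size + (S 5).size + 20) + (4 * (a.cons l).size + (S 5).size + 20) ≤
        (a.cons l).size * (4 * (a.cons l).size + (S 5).size + 20) := by
      have h : l.size + 1 ≤ (a.cons l).size := by simp [Data.size]
      nlinarith
    by_cases hk : a.hd = S 5
    · have h1 := Det.seq (Det.assign 8 (.tl (.hd (.var 2))) S)
        (fun S' hS' => by subst hS'; exact Det.assign 2 .nil _)
      have h2' := Det.cond_true (e := .eq (.hd (.hd (.var 2))) (.var 5))
        (d := .assign 2 (.tl (.var 2))) (by simp [Expr.eval, h2, hk]) h1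
      refine (Det.loop_true ?_ h2' fun S' hS' => by
        subst hS'; exact Det.loop_false (by simp [Expr.eval])).mono ?_ ?_
      · simp [Expr.eval, h2]
      · simp [Expr.cost, h2, Data.size, Expr.eval] at hcost ⊢
        omega
      · rintro _ rfl
        refine ⟨by simp [Expr.eval, h2, assoc, hk], fun j hj2 hj5 hj8 => ?_⟩
        simp [hj2, hj8]
    · have h2' := Det.cond_false (e := .eq (.hd (.hd (.var 2))) (.var 5))
        (c := .seq (.assign 8 (.tl (.hd (.var 2)))) (.assign 2 .nil))
        (by simp [Expr.eval, h2, hk]) (Det.assign 2 (.tl (.var 2)) S)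
      refine (Det.loop_true ?_ h2' fun S' hS' => by
        subst hS'; exact ihl _ (by simp [Expr.eval, h2]) (by simp [h8])).mono ?_ ?_
      · simp [Expr.eval, h2]
      · simp [Expr.cost, h2, Data.size] at hcost ⊢
        omega
      · rintro S' ⟨h3, h4⟩
        refine ⟨by simpa [assoc, hk] using h3, fun j hj2 hj5 hj8 => ?_⟩
        simpa [hj2] using h4 j hj2 hj5 hj8

/-- Look up a key in an association list. -/
def Cmd.lookup (x : ℕ) (l k : Expr) : Cmd :=
  .seq (.assign 2 l) (.seq (.assign 5 k) (.seq (.assign 8 .nil) (.seq lookupLoop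
    (.assign x (.var 8)))))

theorem size_assoc_le (l k : Data) : (assoc l k).size ≤ l.size := by
  induction l with
  | nil => simp [assoc]
  | cons a l iha ihl =>
    simp only [assoc, Data.size]
    split_ifs
    · cases a with
      | nil => simp [Data.tl, Data.size]
      | cons a b => simp [Data.tl, Data.size]; omega
    · omega

/-- The key expression is evaluated after variable `2` has been overwritten, hence the hypothesis
`hk`. Compiled code satisfies it because there `k` reads only variables of the form `3 * i`. -/
theorem Det.lookup (x : ℕ) (l k : Expr) (S : Store) (hk : ∀ v, k.eval (Function.update S 2 v) =
    k.eval S ∧ k.cost (Function.update S 2 v) = k.cost S) :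
    Det (Cmd.lookup x l k) (l.cost S + k.cost S + (l.eval S).size *
        (4 * (l.eval S).size + (k.eval S).size + 20) + (l.eval S).size + 10) S
      fun S' => S' x = assoc (l.eval S) (k.eval S) ∧ ∀ j, j % 3 ≠ 2 → j ≠ x → S' j = S j := by
  have h := Det.seq (Det.assign 2 l S) fun S' hS' => by
    subst hS'
    exact Det.seq (Det.assign 5 k _) fun S' hS' => by
      subst hS'
      exact Det.seq (Det.assign 8 .nil _) fun S' hS' => by
        subst hS'
        exact Det.seq (d := .assign x (.var 8))
          (C' := (l.eval S).size + 1) (Q := fun S' => S' x = assoc (l.eval S) (k.eval S) ∧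
            ∀ j, j % 3 ≠ 2 → j ≠ x → S' j = S j)
          (Det.lookupLoop (l.eval S) _ (by simp) (by simp [Expr.eval])) fun S' hS' => by
            refine (Det.assign x (.var 8) S').mono ?_ ?_
            · simp [Expr.cost, hS'.1, hk, size_assoc_le]
            · rintro _ rfl
              refine ⟨by simp [Expr.eval, hS'.1, hk], fun j hj hjx => ?_⟩
              have h2 : j ≠ 2 := by rintro rfl; simp at hj
              have h5 : j ≠ 5 := by rintro rfl; simp at hj
              have h8 : j ≠ 8 := by rintro rfl; simp at hj
              rw [Function.update_of_ne hjx, hS'.2 j h2 h5 h8]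
              simp [h2, h5, h8]
  refine h.mono ?_ fun S' h => h
  simp [Expr.cost, hk]
  omega

/-! ## Strings of coins -/

section Coins

theorem E_coins_zero (g : List Bool → ℝ≥0∞) : E (coins 0) g = g [] := by simp [coins, E_pure]

theorem E_coins_succ (k : ℕ) (g : List Bool → ℝ≥0∞) : E (coins (k + 1)) g =
    E (PMF.uniformOfFintype Bool) fun b => E (coins k) fun r => g (b :: r) := by
  simp [coins, E_bind, E_map]

/-- Coins are pushed in front, so the later block `r'` precedes the earlier block `r`; `Flips`
builds its string in this order. -/
theorem E_coins_add (j k : ℕ) (g : List Bool → ℝ≥0∞) : E (coins (j + k)) g =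
    E (coins j) fun r => E (coins k) fun r' => g (r' ++ r) := by
  induction k generalizing g with
  | zero => simp [E_coins_zero]
  | succ k ih =>
    rw [← add_assoc, E_coins_succ]
    simp only [ih]
    rw [E_comm]
    simp only [E_coins_succ, List.cons_append]

theorem length_of_mem_coins {k : ℕ} {r : List Bool} (h : r ∈ (coins k).support) : r.length = k := by
  induction k generalizing r with
  | zero => simp [coins] at h; simp [h]
  | succ k ih =>
    rw [coins, PMF.mem_support_bind_iff] at h
    obtain ⟨b, -, h⟩ := h
    rw [PMF.mem_support_map_iff] at h
    obtain ⟨r', h', rfl⟩ := h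
    simp [ih h']

theorem size_bits_le (r : List Bool) : (Data.bits r).size ≤ 4 * r.length + 1 := by
  induction r with
  | nil => simp [Data.bits, Data.size]
  | cons b r ih => cases b <;> simp [Data.bits, Data.size, Data.bit] <;> omega

variable {σ : Type} (O : σ → Data → PMF (Data × σ))

/-- The command `c` flips `k` coins and puts them in front of the string in variable `5`, as long as
this string has at most `M` bits; `3` holds `1ᴺ`, and only the variables `2`, `5` and
`3 * i + 8` with `d ≤ i` are changed. -/
def Flips (N M d : ℕ) (c : Cmd) (k C : ℕ) : Prop :=
  ∀ (S : Store) (z : σ) (n : ℕ) (w : List Bool) (g : List Bool → ℝ≥0∞)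
    (F : ℕ → Store → σ → ℝ≥0∞), S 3 = Data.unary N → S 5 = Data.bits w → w.length + k ≤ M → C ≤ n →
    (∀ r m S', r.length = k → n ≤ m + C → S' 5 = Data.bits (r ++ w) →
      (∀ j, j ≠ 2 → j ≠ 5 → (∀ i ≥ d, j ≠ 3 * i + 8) → S' j = S j) → g r ≤ F m S' z) →
    E (coins k) g ≤ W O n [c] S z F

variable {O} {N M d k k' C C' : ℕ} {c c' : Cmd}

theorem Flips.mono (h : Flips O N M d c k C) {d' : ℕ} (hC : C ≤ C') (hd : d' ≤ d) :
    Flips O N M d' c k C' := by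
  intro S z n w g F h3 h5 hM hn hF
  refine h S z n w g F h3 h5 hM (by omega) fun r m S' hr hm h5' hS' => ?_
  exact hF r m S' hr (by omega) h5' fun j h2 h5 hj => hS' j h2 h5 fun i hi => hj i (by omega)

theorem Flips.of_det (h : ∀ S, S 3 = Data.unary N → Det c C S fun S' => S' 5 = S 5 ∧
    ∀ j, j ≠ 2 → j ≠ 5 → (∀ i ≥ d, j ≠ 3 * i + 8) → S' j = S j) : Flips O N M d c 0 C := by
  intro S z n w g F h3 h5 hM hn hF
  rw [E_coins_zero]
  refine (h S h3).le_W hn fun m S' hm hS' => ?_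
  rw [W_nil]
  exact hF [] m S' rfl hm (by rw [hS'.1, h5]; rfl) hS'.2

theorem Flips.seq (h : Flips O N M d c k C) (h' : Flips O N M d c' k' C') :
    Flips O N M d (.seq c c') (k + k') (C + C' + 1) := by
  intro S z n w g F h3 h5 hM hn hF
  obtain ⟨n, rfl⟩ : ∃ k, n = k + 1 := ⟨n - 1, by omega⟩
  rw [W_seq, W_cons, E_coins_add]
  refine h S z n w _ _ h3 h5 (by omega) (by omega) fun r m S' hr hm h5' hS' => ?_
  have h3' : S' 3 = Data.unary N := by
    rw [hS' 3 (by omega) (by omega) (by omega), h3]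
  refine h' S' z m (r ++ w) _ _ h3' h5' (by simp; omega) (by omega) fun r' m' S'' hr' hm' h5'' hS'' => ?_
  refine hF _ _ _ (by simp; omega) (by omega) (by simpa using h5'') fun j h2 h5 hj => ?_
  rw [hS'' j h2 h5 hj, hS' j h2 h5 hj]

/-- One coin. -/
def Cmd.coin : Cmd := .seq (.flip 2) (.assign 5 (.cons (.var 2) (.var 5)))

theorem Flips.coin : Flips O N M d Cmd.coin 1 (4 * M + 10) := by
  intro S z n w g F h3 h5 hM hn hF
  obtain ⟨n, rfl⟩ : ∃ k, n = k + 2 := ⟨n - 2, by omega⟩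
  rw [Cmd.coin, W_seq, W_flip, E_coins_succ]
  refine E_mono fun b _ => ?_
  have hb : (Data.bit b).size ≤ 3 := by cases b <;> simp [Data.bit, Data.size]
  have hw := size_bits_le w
  rw [E_coins_zero]
  refine (Det.assign _ _ _).le_W ?_ fun m S' hm hS' => ?_
  · simp [Expr.cost, h5]; omega
  · subst hS'
    simp [Expr.cost, h5] at hm
    rw [W_nil]
    refine hF _ _ _ rfl (by omega) (by simp [Expr.eval, h5, Data.bits]) fun j h2 h5 _ => ?_
    simp [h2, h5]

/-- A fixed number of coins. -/
def Cmd.coins : ℕ → Cmd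
  | 0 => .skip
  | a + 1 => .seq (Cmd.coins a) Cmd.coin

theorem Flips.coins (a : ℕ) : Flips O N M d (Cmd.coins a) a (a * (4 * M + 11) + 2) := by
  induction a with
  | zero => exact Flips.of_det fun S _ => (Det.skip S).mono (by simp) (by rintro _ rfl; simp)
  | succ a ih => exact (ih.seq Flips.coin).mono (by ring_nf; omega) le_rfl

/-- Repeat `c` as often as variable `x` says. -/
def Cmd.countdown (x : ℕ) (c : Cmd) : Cmd := .loop (.var x) (.seq (.assign x (.tl (.var x))) c)

/-- Induction on the unary counter in variable `3 * d + 8`. The body changes only counters of index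
above `d`, so nested loops do not disturb each other. -/
theorem Flips.countdown (h : Flips O N M (d + 1) c k C) : ∀ (j : ℕ) (S : Store) (z : σ) (n : ℕ)
    (w : List Bool) (g : List Bool → ℝ≥0∞) (F : ℕ → Store → σ → ℝ≥0∞), S 3 = Data.unary N →
    S (3 * d + 8) = Data.unary j → S 5 = Data.bits w → w.length + j * k ≤ M →
    j * (4 * j + C + 8) + 2 ≤ n →
    (∀ r m S', r.length = j * k → n ≤ m + (j * (4 * j + C + 8) + 2) → S' 5 = Data.bits (r ++ w) →
      (∀ j, j ≠ 2 → j ≠ 5 → (∀ i ≥ d, j ≠ 3 * i + 8) → S' j = S j) → g r ≤ F m S' z) →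
    E (Troll.coins (j * k)) g ≤ W O n [Cmd.countdown (3 * d + 8) c] S z F := by
  intro j
  induction j with
  | zero =>
    intro S z n w g F h3 hj h5 hM hn hF
    rw [zero_mul, E_coins_zero]
    refine (Det.loop_false ?_).le_W ?_ fun m S' hm hS' => ?_
    · simp [Expr.eval, hj, Data.unary]
    · simp [Expr.cost, hj, Data.unary, Data.size]; omega
    · subst hS'
      rw [W_nil]
      refine hF [] m S' (by simp) ?_ h5 fun _ _ _ _ => rfl
      simp [Expr.cost, hj, Data.unary, Data.size] at hm
      omega
  | succ j ih =>
    intro S z n w g F h3 hj h5 hM hn hF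
    have hsz := size_unary (j + 1)
    have hcost : j * (4 * j + C + 8) + 2 + (4 * (j + 1) + C + 8) ≤
      (j + 1) * (4 * (j + 1) + C + 8) + 2 := by nlinarith
    have hjk : (j + 1) * k = k + j * k := by ring
    obtain ⟨n, rfl⟩ : ∃ k, n = k + 1 := ⟨n - 1, by omega⟩
    rw [Cmd.countdown, W_loop]
    simp only [Expr.cost, Expr.eval, hj, hsz]
    rw [if_pos (by omega), if_pos (by simp [Data.unary])]
    obtain ⟨n, rfl⟩ : ∃ k, n = k + (2 * (j + 1) + 1) + 1 :=
      ⟨n - (2 * (j + 1) + 1) - 1, by omega⟩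
    rw [show n + (2 * (j + 1) + 1) + 1 - (2 * (j + 1) + 1) = n + 1 by omega, W_seq]
    refine (Det.assign _ _ _).le_W ?_ fun m S' hm hS' => ?_
    · simp only [Expr.cost, hj, hsz]; omega
    · simp only [Expr.cost, hj, hsz] at hm
      have hS3 : S' 3 = Data.unary N := by subst hS'; simp [h3]
      have hS5 : S' 5 = Data.bits w := by subst hS'; simp [h5]
      have hSd : S' (3 * d + 8) = Data.unary j := by
        subst hS'; simp [Expr.eval, hj, Data.unary, Data.tl]
      have hS : ∀ i, i ≠ 3 * d + 8 → S' i = S i := by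
        intro i hi; subst hS'; simp [hi]
      clear hS'
      rw [W_cons, hjk, E_coins_add]
      refine h S' z m w _ _ hS3 hS5 (by omega) (by omega) fun r m' S'' hr hm' h5' hS'' => ?_
      refine ih S'' z m' (r ++ w) _ _ ?_ ?_ h5' (by simp; omega) (by omega)
        fun r' m'' T hr' hm'' h5'' hT => ?_
      · rw [hS'' 3 (by omega) (by omega) (by omega), hS3]
      · rw [hS'' _ (by omega) (by omega) (by omega), hSd]
      · refine hF _ _ _ (by simp; omega) (by omega) (by simpa using h5'') fun i h2 h5 hi => ?_
        rw [hT i h2 h5 hi, hS'' i h2 h5 fun i' hi' => hi i' (by omega), hS i (hi d le_rfl)]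

/-- Horner evaluation of a list of coefficients. -/
def horner (N : ℕ) : List ℕ → ℕ
  | [] => 0
  | a :: l => a + N * horner N l

theorem horner_map_range (N m : ℕ) (c : ℕ → ℕ) :
    horner N ((List.range m).map c) = ∑ i ∈ Finset.range m, c i * N ^ i := by
  induction m generalizing c with
  | zero => simp [horner]
  | succ m ih =>
    rw [List.range_succ_eq_map, List.map_cons, List.map_map, horner, ih, Finset.sum_range_succ',
      Finset.mul_sum, add_comm]
    simp only [Function.comp, Nat.succ_eq_add_one, pow_zero, mul_one, pow_succ]
    congr 1
    exact Finset.sum_congr rfl fun i _ => by ring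

/-- As many coins as Horner evaluation says. -/
def Cmd.hornerCoins : ℕ → List ℕ → Cmd
  | _, [] => .skip
  | d, a :: l => .seq (Cmd.coins a) (.seq (.assign (3 * d + 8) (.var 3))
      (Cmd.countdown (3 * d + 8) (Cmd.hornerCoins (d + 1) l)))

/-- Running time of `hornerCoins`. -/
def hornerCost {R : Type} [CommSemiring R] (N M : R) : List ℕ → R
  | [] => 2
  | a :: l => a * (4 * M + 11) + N * (4 * N + hornerCost N M l + 8) + 2 * N + 8

/-- Programs have no arithmetic, so polynomially many coins are flipped by nested loops that follow
Horner's scheme, with one counter per level. The bound `M` for the length of the string controls the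
cost of each push. -/
theorem Flips.hornerCoins (l : List ℕ) : ∀ d,
    Flips O N M d (Cmd.hornerCoins d l) (horner N l) (hornerCost N M l) := by
  induction l with
  | nil =>
    exact fun d => Flips.of_det fun S _ => (Det.skip S).mono le_rfl (by rintro _ rfl; simp)
  | cons a l ih =>
    intro d
    refine (Flips.seq (Flips.coins a) (C' := N * (4 * N + hornerCost N M l + 8) + 2 * N + 5)
      ?_).mono (by simp [hornerCost]; omega) le_rfl
    intro S z n w g F h3 h5 hM hn hF
    obtain ⟨n, rfl⟩ : ∃ k, n = k + 1 := ⟨n - 1, by omega⟩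
    rw [W_seq]
    have hsz := size_unary N
    refine (Det.assign _ _ _).le_W ?_ fun m S' hm hS' => ?_
    · simp only [Expr.cost, h3, hsz]; omega
    · simp only [Expr.cost, h3, hsz] at hm
      subst hS'
      refine (ih (d + 1)).countdown N _ z m w _ _ ?_ ?_ ?_ hM (by omega)
        fun r m' S' hr hm' h5' hS' => ?_
      · simp [h3]
      · simp [Expr.eval, h3]
      · simp [h5]
      · refine hF r m' S' hr (by omega) h5' fun j h2 h5 hj => ?_
        rw [hS' j h2 h5 hj, Function.update_of_ne (hj d le_rfl)]

/-- The list of coefficients. -/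
noncomputable def coeffs (p : Polynomial ℕ) : List ℕ := (List.range (p.natDegree + 1)).map p.coeff

theorem horner_coeffs (p : Polynomial ℕ) (N : ℕ) : horner N (coeffs p) = p.eval N := by
  rw [coeffs, horner_map_range, Polynomial.eval_eq_sum_range]

/-- `hornerCost` is defined over every commutative semiring so that one formula serves as a number
and as a polynomial clock. -/
theorem eval_hornerCost (N M : Polynomial ℕ) (l : List ℕ) (B : ℕ) :
    (hornerCost N M l).eval B = hornerCost (N.eval B) (M.eval B) l := by
  induction l with
  | nil => simp [hornerCost]
  | cons a l ih => simp [hornerCost, ih]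

theorem hornerCost_mono {N N' M M' : ℕ} (hN : N ≤ N') (hM : M ≤ M') (l : List ℕ) :
    hornerCost N M l ≤ hornerCost N' M' l := by
  induction l with
  | nil => simp [hornerCost]
  | cons a l ih => simp only [hornerCost]; gcongr

end Coins

end Troll

namespace Troll

open scoped ENNReal

/-! ## A structured language for the code of reductions

The variables of a compiled program are divided into three regions: variable `i` of the structured
program becomes `3 * i`, variable `i` of a program that is run under its supervision becomes
`3 * i + 1`, and the variables `3 * i + 2` are scratch space of subroutines. -/

/-- Structured programs. -/
inductive Prog : Type
  | assign : ℕ → Expr → Prog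
  | flip : ℕ → Prog
  | call : ℕ → Expr → Prog
  | alg : PPTAlgorithm → ℕ → Expr → Prog
  | lookup : ℕ → Expr → Expr → Prog
  | coins : ℕ → Polynomial ℕ → Prog
  | seq : Prog → Prog → Prog
  | cond : Expr → Prog → Prog → Prog

/-- The variables of a structured program. -/
def ctrl (S : Store) : Store := fun i => S (3 * i)

/-- The variables of the supervised program. -/
def inner (S : Store) : Store := fun i => S (3 * i + 1)

theorem ctrl_update (S : Store) (x : ℕ) (v : Data) :
    ctrl (Function.update S (3 * x) v) = Function.update (ctrl S) x v := by
  funext i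
  by_cases h : i = x
  · simp [ctrl, h]
  · simp [ctrl, h]

theorem inner_update (S : Store) (x : ℕ) (v : Data) :
    inner (Function.update S (3 * x + 1) v) = Function.update (inner S) x v := by
  funext i
  by_cases h : i = x
  · simp [inner, h]
  · simp [inner, h]

theorem ctrl_congr {S S' : Store} (h : ∀ j, j % 3 ≠ 2 → S' j = S j) : ctrl S' = ctrl S :=
  funext fun i => h _ (by omega)

theorem ctrl_eq_update {S S' : Store} {x : ℕ} {v : Data} (hx : S' (3 * x) = v)
    (h : ∀ j, j % 3 ≠ 2 → j ≠ 3 * x → S' j = S j) : ctrl S' = Function.update (ctrl S) x v := by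
  funext i
  by_cases hi : i = x
  · simp [ctrl, hi, hx]
  · simp only [ctrl, ne_eq, hi, not_false_eq_true, Function.update_of_ne]
    exact h _ (by omega) (by omega)

theorem inner_eq_of_ne {S S' : Store} {x : ℕ}
    (h : ∀ j, j % 3 ≠ 2 → j ≠ 3 * x → S' j = S j) : inner S' = inner S :=
  funext fun i => h _ (by omega) (by omega)

/-- A bound for the cost of an expression in terms of the sizes of its variables. -/
noncomputable def Expr.bound : Expr → Polynomial ℕ
  | var _ => .X
  | nil => 1
  | cons e f => e.bound + f.bound + 1
  | hd e => e.bound + 1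
  | tl e => e.bound + 1
  | eq e f => e.bound + f.bound + 1

theorem Expr.cost_le_bound {s : Store} {B v : ℕ} (h : ∀ i < v, (s i).size ≤ B) (e : Expr)
    (he : e.vars ≤ v) : e.cost s ≤ e.bound.eval B := by
  induction e with
  | var i => simpa [cost, bound] using h i he
  | nil => simp [cost, bound]
  | cons e f ihe ihf =>
    simp only [vars, max_le_iff] at he
    simpa [cost, bound] using add_le_add (ihe he.1) (ihf he.2)
  | hd e ih => simpa [cost, bound] using ih he
  | tl e ih => simpa [cost, bound] using ih he
  | eq e f ihe ihf =>
    simp only [vars, max_le_iff] at he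
    simpa [cost, bound] using add_le_add (ihe he.1) (ihf he.2)

namespace Prog

/-- A strict upper bound for the variables of a program; `1`, which holds the security parameter,
is always counted. -/
def vars : Prog → ℕ
  | assign x e => max (x + 1) e.vars
  | flip x => x + 1
  | call x e => max (x + 1) e.vars
  | alg _ x e => max 2 (max (x + 1) e.vars)
  | lookup x l k => max (x + 1) (max l.vars k.vars)
  | coins x _ => max 2 (x + 1)
  | seq P Q => max P.vars Q.vars
  | cond e P Q => max e.vars (max P.vars Q.vars)

/-- The variables of the subroutine `F`, in the scratch region. -/
def scratch (F : PPTAlgorithm) : List ℕ := (List.range F.code.vars).map fun i => 3 * i + 2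

/-- Translation into a command. -/
noncomputable def compile : Prog → Cmd
  | assign x e => .assign (3 * x) (e.ren (3 * ·))
  | flip x => .flip (3 * x)
  | call x e => .call (3 * x) (e.ren (3 * ·))
  | alg F x e => .seq (.clear (scratch F)) (.seq (.assign 2 (.cons (.var 3) (e.ren (3 * ·))))
      (.seq (F.code.ren (3 * · + 2)) (.assign (3 * x) (.var 2))))
  | lookup x l k => .lookup (3 * x) (l.ren (3 * ·)) (k.ren (3 * ·))
  | coins x p => .seq (.assign 5 .nil) (.seq (.hornerCoins 0 (coeffs p)) (.assign (3 * x) (.var 5)))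
  | seq P Q => .seq P.compile Q.compile
  | cond e P Q => .cond (e.ren (3 * ·)) P.compile Q.compile

/-- A bound for the running time, and for the sizes of the variables afterwards, in terms of a bound
for the sizes of the variables and of the answers of the oracle. -/
noncomputable def cost : Prog → Polynomial ℕ
  | assign _ e => .X + e.bound + 1
  | flip _ => .X + 3
  | call _ e => 2 * .X + e.bound + 1
  | alg F _ e => 6 * (.X + e.bound + 1) + (3 * Polynomial.C F.code.vars + 11)
      + 4 * F.time.comp (.X + e.bound + 1)
  | lookup _ l k => l.bound + k.bound + l.bound * (4 * l.bound + k.bound + 20) + l.bound + .X + 10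
  | coins _ p => hornerCost .X p (coeffs p) + 4 * p + .X + 10
  | seq P Q => P.cost + Q.cost.comp P.cost + 1
  | cond e P Q => e.bound + P.cost + Q.cost + 1

/-- The expectation of `g` over the runs of a structured program, where runs in which the oracle gives
an answer of size above `cap` do not count. -/
noncomputable def wp {σ : Type} (N cap : ℕ) (O : σ → Data → PMF (Data × σ)) :
    Prog → (Store → σ → ℝ≥0∞) → Store → σ → ℝ≥0∞
  | assign x e, g, s, z => g (Function.update s x (e.eval s)) z
  | flip x, g, s, z =>
      E (PMF.uniformOfFintype Bool) fun b => g (Function.update s x (Data.bit b)) z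
  | call x e, g, s, z =>
      E (O z (e.eval s)) fun r => if r.1.size ≤ cap then g (Function.update s x r.1) r.2 else 0
  | alg F x e, g, s, z =>
      if s 1 = Data.unary N then E (F.out N (e.eval s)) fun y => g (Function.update s x y) z else 0
  | lookup x l k, g, s, z => g (Function.update s x (assoc (l.eval s) (k.eval s))) z
  | coins x p, g, s, z =>
      if s 1 = Data.unary N then
        E (Troll.coins (p.eval N)) fun r => g (Function.update s x (Data.bits r)) z
      else 0
  | seq P Q, g, s, z => P.wp N cap O (Q.wp N cap O g) s z
  | cond e P Q, g, s, z => if (e.eval s).toBool then P.wp N cap O g s z else Q.wp N cap O g s z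

/-- `cost` bounds the final sizes as well as the time, so it has to dominate the initial bound. This
makes bounds compose along sequences. -/
theorem le_cost (P : Prog) (B : ℕ) : B ≤ P.cost.eval B := by
  induction P generalizing B with
  | assign x e => simp [cost]; omega
  | flip x => simp [cost]
  | call x e => simp [cost]; omega
  | alg F x e => simp [cost]; omega
  | lookup x l k => simp [cost]; omega
  | coins x p => simp [cost]; omega
  | seq P Q ihP ihQ => simp [cost]; have := ihP B; omega
  | cond e P Q ihP ihQ => simp [cost]; have := ihP B; omega

theorem sizes_update {s : Store} {v x B C : ℕ} {y : Data} (hs : ∀ i < v, (s i).size ≤ B)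
    (hBC : B ≤ C) (hy : y.size ≤ C) : ∀ i < v, (Function.update s x y i).size ≤ C := by
  intro i hi
  by_cases h : i = x
  · simpa [h] using hy
  · simpa [h] using (hs i hi).trans hBC

variable {σ : Type} (O : σ → Data → PMF (Data × σ))

/-- After clearing the scratch region the copy of `A` sees the store `start`. Its input is placed in
variable `2`, the image of its variable `0`, and its output is fetched from there. -/
theorem wp_alg_le_W (N v : ℕ) (A : PPTAlgorithm) (x : ℕ) (e : Expr)
    (hv : (alg A x e).vars ≤ v) (B : ℕ) (S : Store) (z : σ) (n : ℕ)
    (g : Store → σ → ℝ≥0∞) (F : ℕ → Store → σ → ℝ≥0∞)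
    (hS : ∀ i < v, (S (3 * i)).size ≤ B) (hn : (alg A x e).cost.eval B ≤ n)
    (hF : ∀ m S' z', n ≤ m + (alg A x e).cost.eval B → inner S' = inner S →
      (∀ i < v, (S' (3 * i)).size ≤ (alg A x e).cost.eval B) → g (ctrl S') z' ≤ F m S' z')
    (h1 : S 3 = Data.unary N) :
    E (A.out N (e.eval (ctrl S))) (fun y => g (Function.update (ctrl S) x y) z) ≤
      W O n [(alg A x e).compile] S z F := by
  simp only [vars, max_le_iff] at hv
  have he := e.cost_le_bound (s := ctrl S) hS hv.2.2
  have hes := e.size_eval_le (ctrl S)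
  have hS3 : (S 3).size ≤ B := hS 1 (by omega)
  set y := e.eval (ctrl S) with hy
  have hin : (withParam N y).size = (S 3).size + y.size + 1 := by
    simp [withParam, Data.size, h1]
  set b := B + e.bound.eval B + 1 with hb
  have hinb : (withParam N y).size ≤ b := by omega
  have htime := PPTAlgorithm.eval_mono A.time hinb
  have hcost : (alg A x e).cost.eval B = 6 * b + (3 * A.code.vars + 11) + 4 * A.time.eval b := by
    simp [cost, hb]
  rw [hcost] at hn hF
  rw [compile]
  obtain ⟨n, rfl⟩ : ∃ k, n = k + 1 := ⟨n - 1, by omega⟩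
  rw [W_seq]
  refine (Det.clear (scratch A) S).le_W ?_ fun m₁ S₁ hm₁ hS₁ => ?_
  · simp [scratch]; omega
  have hlen : (scratch A).length = A.code.vars := by simp [scratch]
  rw [hlen] at hm₁
  have hS₁' : ∀ j, j % 3 ≠ 2 → S₁ j = S j := by
    intro j hj
    refine hS₁.2 j fun h => hj ?_
    simp only [scratch, List.mem_map] at h
    obtain ⟨i, -, rfl⟩ := h
    omega
  have hc₁ := ctrl_congr hS₁'
  obtain ⟨m₁, rfl⟩ : ∃ k, m₁ = k + 1 := ⟨m₁ - 1, by omega⟩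
  rw [W_seq]
  have hcst : (Expr.cons (.var 3) (e.ren (3 * ·))).cost S₁ = (S 3).size + e.cost (ctrl S) + 1 := by
    rw [Expr.cost, Expr.cost_ren, show (fun i => S₁ (3 * i)) = ctrl S from hc₁, Expr.cost,
      hS₁' 3 (by omega)]
  have hval : (Expr.cons (.var 3) (e.ren (3 * ·))).eval S₁ = withParam N y := by
    rw [Expr.eval, Expr.eval_ren, show (fun i => S₁ (3 * i)) = ctrl S from hc₁, Expr.eval,
      hS₁' 3 (by omega), h1]
    rfl
  refine (Det.assign _ _ _).le_W (by rw [hcst]; omega) fun m₂ S₂ hm₂ hS₂ => ?_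
  rw [hcst] at hm₂
  rw [hval] at hS₂
  have hS₂' : ∀ j, j % 3 ≠ 2 → S₂ j = S j := by
    intro j hj
    rw [hS₂, Function.update_of_ne (by rintro rfl; simp at hj), hS₁' j hj]
  obtain ⟨m₂, rfl⟩ : ∃ k, m₂ = k + 1 := ⟨m₂ - 1, by omega⟩
  rw [W_seq, W_cons, A.E_out O N y (fun y z => g (Function.update (ctrl S) x y) z) z]
  -- Before the code is renamed, two facts on the end of its run are recorded in the
  -- post-expectation: the size of the output and the time that is left.
  refine (W_mono_sizes O _ m₂ _ _ z (fun _ => (withParam N y).size) _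
    (fun m s' z' => if (s' 0).size ≤ b + 3 * A.time.eval b ∧
      m₂ ≤ m + A.time.eval (withParam N y).size then
      g (Function.update (ctrl S) x (s' 0)) z' else 0) (by omega)
    (size_start_le _) fun m s' z' hm hs' => ?_).trans ?_
  · rw [if_pos ⟨(hs' 0).trans (by omega), by omega⟩]
  -- The maximum with `1` is needed because variable `0` carries input and output even if the code
  -- does not mention it.
  refine W_le_W_ren O (3 * · + 2) (fun a b h => by simpa using h) (max 1 A.code.vars) _
    [A.code] _ _ _ _ _ (by simp) ?_ ?_
  · intro i hi
    by_cases h0 : i = 0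
    · subst h0
      simp [hS₂, start]
    · have hi' : i < A.code.vars := by
        rcases lt_max_iff.1 hi with h | h
        · omega
        · exact h
      have hmem : 3 * i + 2 ∈ scratch A := by simpa [scratch] using hi'
      show S₂ (3 * i + 2) = _
      rw [hS₂, Function.update_of_ne (by omega), hS₁.1 _ hmem, start, Function.update_of_ne h0]
  · intro m s' S₃ z' hs hS₃
    split_ifs with hm
    · have h30 : S₃ 2 = s' 0 := hs 0 (by simp)
      have hS₃' : ∀ j, j % 3 ≠ 2 → S₃ j = S j := by
        intro j hj
        rw [hS₃ j fun i => by omega, hS₂' j hj]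
      refine (Det.assign (3 * x) (.var 2) S₃).le_W (by simp only [Expr.cost, h30]; omega)
        fun m₄ S₄ hm₄ hS₄ => ?_
      simp only [Expr.cost, Expr.eval, h30] at hm₄ hS₄
      have hx : S₄ (3 * x) = s' 0 := by simp [hS₄]
      have hS₄' : ∀ j, j % 3 ≠ 2 → j ≠ 3 * x → S₄ j = S j := fun j hj hjx => by
        rw [hS₄, Function.update_of_ne hjx, hS₃' j hj]
      rw [W_nil, ← ctrl_eq_update hx hS₄']
      refine hF _ _ _ (by omega) (inner_eq_of_ne hS₄') fun i hi => ?_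
      rw [show S₄ (3 * i) = _ from congrFun (ctrl_eq_update hx hS₄') i]
      exact sizes_update (v := v) (B := B) (s := ctrl S) hS (by omega) (by omega) i hi
    · exact zero_le

/-- Soundness of the compilation, as a lower bound: `Prog.wp` drops runs with oversized answers, and
for the others the clock `P.cost` is enough. The supervised program's variables are untouched, and
the new size bound is what the next command starts from. -/
theorem wp_le_W (N cap v : ℕ) (P : Prog) (hv : P.vars ≤ v) : ∀ (B : ℕ) (S : Store) (z : σ) (n : ℕ)
    (g : Store → σ → ℝ≥0∞) (F : ℕ → Store → σ → ℝ≥0∞), cap ≤ B →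
    (∀ i < v, (S (3 * i)).size ≤ B) → P.cost.eval B ≤ n →
    (∀ m S' z', n ≤ m + P.cost.eval B → inner S' = inner S →
      (∀ i < v, (S' (3 * i)).size ≤ P.cost.eval B) → g (ctrl S') z' ≤ F m S' z') →
    P.wp N cap O g (ctrl S) z ≤ W O n [P.compile] S z F := by
  induction P with
  | assign x e =>
    intro B S z n g F hB hS hn hF
    simp only [vars, max_le_iff] at hv
    have he := e.cost_le_bound (s := ctrl S) hS hv.2
    have hs := e.size_eval_le (ctrl S)
    have hc : (assign x e).cost.eval B = B + e.bound.eval B + 1 := by simp [cost]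
    rw [hc] at hn hF
    have hcst : (e.ren (3 * ·)).cost S = e.cost (ctrl S) := Expr.cost_ren _ _ _
    have hval : (e.ren (3 * ·)).eval S = e.eval (ctrl S) := Expr.eval_ren _ _ _
    refine (Det.assign _ _ _).le_W (by omega) fun m S' hm hS' => ?_
    rw [hval] at hS'
    subst hS'
    rw [W_nil, wp, ← ctrl_update]
    refine hF _ _ _ (by omega) (funext fun i => ?_) ?_
    · simp [inner, show 3 * i + 1 ≠ 3 * x by omega]
    · intro i hi
      rw [show Function.update S (3 * x) (e.eval (ctrl S)) (3 * i) = _ from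
        congrFun (ctrl_update S x _) i]
      exact sizes_update (v := v) (B := B) (s := ctrl S) hS (by omega) (by omega) i hi
  | flip x =>
    intro B S z n g F hB hS hn hF
    have hc : (flip x).cost.eval B = B + 3 := by simp [cost]
    rw [hc] at hn hF
    obtain ⟨n, rfl⟩ : ∃ k, n = k + 1 := ⟨n - 1, by omega⟩
    rw [compile, W_flip, wp]
    refine E_mono fun b _ => ?_
    rw [W_nil, ← ctrl_update]
    refine hF _ _ _ (by omega) (funext fun i => ?_) ?_
    · simp [inner, show 3 * i + 1 ≠ 3 * x by omega]
    · intro i hi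
      rw [show Function.update S (3 * x) (Data.bit b) (3 * i) = _ from
        congrFun (ctrl_update S x _) i]
      exact sizes_update (v := v) (B := B) (s := ctrl S) hS (by omega)
        (by cases b <;> simp [Data.bit, Data.size]) i hi
  | call x e =>
    intro B S z n g F hB hS hn hF
    simp only [vars, max_le_iff] at hv
    have he := e.cost_le_bound (s := ctrl S) hS hv.2
    have hc : (call x e).cost.eval B = 2 * B + e.bound.eval B + 1 := by simp [cost]
    rw [hc] at hn hF
    have hcst : (e.ren (3 * ·)).cost S = e.cost (ctrl S) := Expr.cost_ren _ _ _
    have hval : (e.ren (3 * ·)).eval S = e.eval (ctrl S) := Expr.eval_ren _ _ _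
    obtain ⟨n, rfl⟩ : ∃ k, n = k + 1 := ⟨n - 1, by omega⟩
    rw [compile, W_call, if_pos (by omega), wp, hval, hcst]
    refine E_mono fun r _ => ?_
    split_ifs with h1 h2
    · rw [W_nil, ← ctrl_update]
      refine hF _ _ _ (by omega) (funext fun i => ?_) ?_
      · simp [inner, show 3 * i + 1 ≠ 3 * x by omega]
      · intro i hi
        rw [show Function.update S (3 * x) r.1 (3 * i) = _ from
          congrFun (ctrl_update S x _) i]
        exact sizes_update (v := v) (B := B) (s := ctrl S) hS (by omega) (by omega) i hi
    · omega
    · exact zero_le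
    · exact zero_le
  | alg A x e =>
    intro B S z n g F hB hS hn hF
    rw [wp]
    split_ifs with h1
    · exact wp_alg_le_W O N v A x e hv B S z n g F hS hn hF h1
    · exact zero_le
  | lookup x l k =>
    intro B S z n g F hB hS hn hF
    simp only [vars, max_le_iff] at hv
    have hl := l.cost_le_bound (s := ctrl S) hS hv.2.1
    have hk := k.cost_le_bound (s := ctrl S) hS hv.2.2
    have hl' := l.size_eval_le (ctrl S)
    have hk' := k.size_eval_le (ctrl S)
    have hc : (lookup x l k).cost.eval B = l.bound.eval B + k.bound.eval B +
      l.bound.eval B * (4 * l.bound.eval B + k.bound.eval B + 20) + l.bound.eval B + B + 10 := by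
      simp [cost]
    rw [hc] at hn hF
    have hlc : (l.ren (3 * ·)).cost S = l.cost (ctrl S) := Expr.cost_ren _ _ _
    have hlv : (l.ren (3 * ·)).eval S = l.eval (ctrl S) := Expr.eval_ren _ _ _
    have hkc : (k.ren (3 * ·)).cost S = k.cost (ctrl S) := Expr.cost_ren _ _ _
    have hkv : (k.ren (3 * ·)).eval S = k.eval (ctrl S) := Expr.eval_ren _ _ _
    have hcl : (l.eval (ctrl S)).size * (4 * (l.eval (ctrl S)).size + (k.eval (ctrl S)).size + 20) ≤
        l.bound.eval B * (4 * l.bound.eval B + k.bound.eval B + 20) := by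
      gcongr <;> omega
    rw [compile]
    refine (Det.lookup (3 * x) (l.ren (3 * ·)) (k.ren (3 * ·)) S fun v => ?_).le_W ?_ fun m S' hm hS' => ?_
    · have : (fun i => Function.update S 2 v (3 * i)) = fun i => S (3 * i) :=
        funext fun i => by rw [Function.update_of_ne (by omega)]
      rw [Expr.eval_ren, Expr.cost_ren, Expr.eval_ren, Expr.cost_ren, this]
      exact ⟨rfl, rfl⟩
    · rw [hlc, hkc, hlv, hkv]; omega
    · rw [hlc, hkc, hlv, hkv] at hm
      rw [hlv, hkv] at hS'
      rw [W_nil, wp, ← ctrl_eq_update hS'.1 hS'.2]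
      refine hF _ _ _ (by omega) (inner_eq_of_ne hS'.2) fun i hi => ?_
      rw [show S' (3 * i) = _ from congrFun (ctrl_eq_update hS'.1 hS'.2) i]
      refine sizes_update (v := v) (B := B) (s := ctrl S) hS (by omega) ?_ i hi
      exact (size_assoc_le _ _).trans (by omega)
  | coins x p =>
    intro B S z n g F hB hS hn hF
    rw [wp]
    split_ifs with h1
    · simp only [vars, max_le_iff] at hv
      have hN : N ≤ B := by
        have : (S (3 * 1)).size ≤ B := hS 1 (by omega)
        have h1' : S (3 * 1) = Data.unary N := h1
        rw [h1', size_unary] at this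
        omega
      have hpN := PPTAlgorithm.eval_mono p hN
      have hc : (coins x p).cost.eval B = hornerCost B (p.eval B) (coeffs p) + 4 * p.eval B + B + 10 := by
        simp [cost, eval_hornerCost]
      have hh := hornerCost_mono hN hpN (coeffs p)
      rw [hc] at hn hF
      obtain ⟨n, rfl⟩ : ∃ k, n = k + 1 := ⟨n - 1, by omega⟩
      rw [compile, W_seq]
      refine (Det.assign _ _ _).le_W (by simp [Expr.cost]; omega) fun m S₁ hm hS₁ => ?_
      simp only [Expr.cost] at hm
      have hS₁' : ∀ j, j % 3 ≠ 2 → S₁ j = S j := fun j hj => by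
        rw [hS₁, Function.update_of_ne (by rintro rfl; simp at hj)]
      obtain ⟨m, rfl⟩ : ∃ k, m = k + 1 := ⟨m - 1, by omega⟩
      rw [W_seq, W_cons, ← horner_coeffs]
      refine Flips.hornerCoins (O := O) (N := N) (M := p.eval N) (coeffs p) 0 S₁ z m [] _ _ ?_ ?_ ?_
        (by omega) fun r m' S₂ hr hm' h5 hS₂ => ?_
      · rw [hS₁' 3 (by omega)]; exact h1
      · simp [hS₁, Expr.eval, Data.bits]
      · simp [horner_coeffs]
      · rw [horner_coeffs] at hr
        have hrs := size_bits_le r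
        rw [List.append_nil] at h5
        refine (Det.assign _ _ _).le_W (by simp [Expr.cost, h5]; omega) fun m₃ S₃ hm₃ hS₃ => ?_
        simp only [Expr.cost, h5] at hm₃
        have hx : S₃ (3 * x) = Data.bits r := by simp [hS₃, Expr.eval, h5]
        have hS₃' : ∀ j, j % 3 ≠ 2 → j ≠ 3 * x → S₃ j = S j := by
          intro j hj hjx
          rw [hS₃, Function.update_of_ne hjx, hS₂ j (by rintro rfl; simp at hj)
            (by rintro rfl; simp at hj) (fun i _ h => by omega), hS₁' j hj]
        rw [W_nil, ← ctrl_eq_update hx hS₃']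
        refine hF _ _ _ (by omega) (inner_eq_of_ne hS₃') fun i hi => ?_
        rw [show S₃ (3 * i) = _ from congrFun (ctrl_eq_update hx hS₃') i]
        exact sizes_update (v := v) (B := B) (s := ctrl S) hS (by omega) (by omega) i hi
    · exact zero_le
  -- The clock of `Q` is evaluated at the sizes that `P` may leave behind, whence the composition of
  -- polynomials.
  | seq P Q ihP ihQ =>
    intro B S z n g F hB hS hn hF
    simp only [vars, max_le_iff] at hv
    have hc : (seq P Q).cost.eval B = P.cost.eval B + Q.cost.eval (P.cost.eval B) + 1 := by
      simp [cost]
    rw [hc] at hn hF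
    have hP := P.le_cost B
    have hQ := Q.le_cost (P.cost.eval B)
    obtain ⟨n, rfl⟩ : ∃ k, n = k + 1 := ⟨n - 1, by omega⟩
    rw [compile, W_seq, W_cons, wp]
    refine ihP hv.1 B S z n _ _ hB hS (by omega) fun m S' z' hm hi hS' => ?_
    refine ihQ hv.2 _ S' z' m _ _ (by omega) hS' (by omega) fun m' S'' z'' hm' hi' hS'' => ?_
    exact hF _ _ _ (by omega) (hi'.trans hi) fun i hi => (hS'' i hi).trans (by omega)
  | cond e P Q ihP ihQ =>
    intro B S z n g F hB hS hn hF
    simp only [vars, max_le_iff] at hv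
    have he := e.cost_le_bound (s := ctrl S) hS hv.1
    have hc : (cond e P Q).cost.eval B = e.bound.eval B + P.cost.eval B + Q.cost.eval B + 1 := by
      simp [cost]
    rw [hc] at hn hF
    have hcst : (e.ren (3 * ·)).cost S = e.cost (ctrl S) := Expr.cost_ren _ _ _
    have hval : (e.ren (3 * ·)).eval S = e.eval (ctrl S) := Expr.eval_ren _ _ _
    obtain ⟨n, rfl⟩ : ∃ k, n = k + 1 := ⟨n - 1, by omega⟩
    rw [compile, W_cond, hcst, hval, if_pos (by omega), wp]
    split_ifs
    · exact ihP hv.2.1 B S z _ _ _ hB hS (by omega) fun m S' z' hm hi hS' =>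
        hF _ _ _ (by omega) hi fun i hi => (hS' i hi).trans (by omega)
    · exact ihQ hv.2.2 B S z _ _ _ hB hS (by omega) fun m S' z' hm hi hS' =>
        hF _ _ _ (by omega) hi fun i hi => (hS' i hi).trans (by omega)

end Prog

end Troll

namespace Troll

open scoped ENNReal

/-! ## Running a program with simulated oracles -/

/-- Run a program with its variables renamed, and with the command `K` in the place of oracle calls.
Queries and answers are passed in variable `6`, which is variable `2` of structured programs. -/
def Cmd.wrap (K : Cmd) : Cmd → Cmd
  | assign x e => assign (3 * x + 1) (e.ren (3 * · + 1))
  | flip x => flip (3 * x + 1)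
  | call x e => seq (assign 6 (e.ren (3 * · + 1))) (seq K (assign (3 * x + 1) (.var 6)))
  | seq c d => seq (wrap K c) (wrap K d)
  | cond e c d => cond (e.ren (3 * · + 1)) (wrap K c) (wrap K d)
  | loop e c => loop (e.ren (3 * · + 1)) (wrap K c)

section Wrap

variable {τ σ : Type} (Oi : τ → Data → PMF (Data × τ)) (O : σ → Data → PMF (Data × σ))
  (Rel : ℕ → τ → Store → σ → Prop) (t C : ℕ) (K : Cmd)

/-- The command `K` implements the oracle `Oi` with the oracle `O`: it keeps the relation `Rel`
between the number of queries, the state of `Oi`, the variables, and the state of `O`. -/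
def Implements : Prop :=
  ∀ (k : ℕ) (st : τ) (S : Store) (z : σ) (n : ℕ), Rel k st (ctrl S) z → k < t →
    (S 6).size ≤ t → C ≤ n → ∀ (g : Data × τ → ℝ≥0∞) (F : ℕ → Store → σ → ℝ≥0∞),
    (∀ a st' m S' z', n ≤ m + C → inner S' = inner S → Rel (k + 1) st' (ctrl S') z' → S' 6 = a →
      g (a, st') ≤ F m S' z') → E (Oi st (S 6)) g ≤ W O n [K] S z F

/-- The relation does not depend on variable `2`. -/
def Insensitive (v₀ : ℕ) : Prop :=
  ∀ k st s s' z, (∀ i < v₀, i ≠ 2 → s' i = s i) → Rel k st s z → Rel k st s' z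

variable {Oi O Rel t C K}

theorem ctrl_update_inner (S : Store) (x : ℕ) (v : Data) :
    ctrl (Function.update S (3 * x + 1) v) = ctrl S := by
  funext i
  simp [ctrl, show 3 * i ≠ 3 * x + 1 by omega]

theorem inner_update_ctrl (S : Store) (x : ℕ) (v : Data) :
    inner (Function.update S (3 * x) v) = inner S := by
  funext i
  simp [inner, show 3 * i + 1 ≠ 3 * x by omega]

theorem Insensitive.update {v₀ : ℕ} (h : Insensitive Rel v₀) {k : ℕ} {st : τ} {S : Store} {z : σ}
    (hR : Rel k st (ctrl S) z) (v : Data) : Rel k st (ctrl (Function.update S 6 v)) z := by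
  refine h k st (ctrl S) _ z (fun i _ hi => ?_) hR
  simp only [ctrl]
  rw [Function.update_of_ne (by omega)]

/-- A step of cost `a + 1` of the supervised program pays for `(a + 1) * (C + 10)` units of the
wrapped one: `C` for a handler call and the rest for copying. The supervised clock also bounds the
number of queries, through `k + n ≤ t`. -/
theorem W_le_W_wrap {v₀ : ℕ} (hK : Implements Oi O Rel t C K) (hRel : Insensitive Rel v₀) (n : ℕ) :
    ∀ (p : List Cmd) (st : τ) (k : ℕ) (S : Store) (z : σ) (n' R : ℕ) (f : Store → τ → ℝ≥0∞)
      (F : ℕ → Store → σ → ℝ≥0∞), Rel k st (ctrl S) z → k + n ≤ t → n * (C + 10) + R ≤ n' →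
      (∀ st' k' m S' z', Rel k' st' (ctrl S') z' → k' ≤ t → R ≤ m → f (inner S') st' ≤ F m S' z') →
      W Oi n p (inner S) st (fun _ s st => f s st) ≤ W O n' (p.map (Cmd.wrap K)) S z F := by
  induction n using Nat.strong_induction_on with
  | _ n ih =>
    intro p st k S z n' R f F hR hk hn' hF
    rcases p with _ | ⟨c, p⟩
    · rw [List.map_nil, W_nil, W_nil]
      exact hF _ _ _ _ _ hR (by omega) (by omega)
    rcases n with _ | n
    · rw [W_zero]; exact zero_le
    have hmul (a : ℕ) (ha : a ≤ n) : (n - a) * (C + 10) + a * (C + 10) + (C + 10) =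
        (n + 1) * (C + 10) := by
      rw [← add_mul, ← Nat.succ_mul]; congr 1; omega
    have hle (a : ℕ) : a ≤ a * (C + 10) := Nat.le_mul_of_pos_right _ (by omega)
    obtain ⟨n', rfl⟩ : ∃ m, n' = m + 1 := ⟨n' - 1, by have := hmul 0 (by omega); omega⟩
    have hc (e : Expr) : (e.ren (3 * · + 1)).cost S = e.cost (inner S) := Expr.cost_ren _ _ _
    have hv (e : Expr) : (e.ren (3 * · + 1)).eval S = e.eval (inner S) := Expr.eval_ren _ _ _
    cases c with
    | assign x e =>
      simp only [List.map_cons, Cmd.wrap]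
      rw [W_assign, W_assign, hc, hv]
      split_ifs with h1 h2
      · rw [← inner_update]
        have := hmul _ h1
        have := hle (e.cost (inner S))
        exact ih _ (by omega) p st k _ z _ R f F (by rwa [ctrl_update_inner]) (by omega)
          (by omega) hF
      · have := hmul _ h1
        have := hle (e.cost (inner S))
        omega
      · exact zero_le
      · exact zero_le
    | flip x =>
      simp only [List.map_cons, Cmd.wrap]
      rw [W_flip, W_flip]
      refine E_mono fun b _ => ?_
      rw [← inner_update]
      have := hmul 0 (by omega)
      rw [Nat.sub_zero] at this
      exact ih _ (by omega) p st k _ z _ R f F (by rwa [ctrl_update_inner]) (by omega)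
        (by omega) hF
    | call x e =>
      simp only [List.map_cons, Cmd.wrap]
      rw [W_call, W_seq]
      split_ifs with h1
      · have h2 := hmul _ h1
        have h3 := hle (e.cost (inner S))
        refine (Det.assign _ _ _).le_W (by rw [hc]; omega) fun m S₁ hm hS₁ => ?_
        rw [hc] at hm
        rw [hv] at hS₁
        subst hS₁
        obtain ⟨m, rfl⟩ : ∃ m', m = m' + 1 := ⟨m - 1, by omega⟩
        rw [W_seq, W_cons]
        set S₁ := Function.update S 6 (e.eval (inner S)) with hS₁
        have h6 : S₁ 6 = e.eval (inner S) := by simp [hS₁]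
        have hes := e.size_eval_le (inner S)
        rw [← h6]
        -- The query was computed within the supervised clock, so its size is at most `t`, as
        -- handlers may assume.
        refine hK k st S₁ z m (hRel.update hR _) (by omega) (by rw [h6]; omega) (by omega) _ _ ?_
        intro a st' m' S' z' hm' hi hR' ha
        dsimp only
        split_ifs with h4
        · have h5 := hmul _ h4
          have h6 := hle a.size
          have h8 : (e.cost (inner S) + a.size) * (C + 10) =
            e.cost (inner S) * (C + 10) + a.size * (C + 10) := by ring
          refine (Det.assign _ _ _).le_W (by rw [Expr.cost, ha]; omega) fun m₂ S₂ hm₂ hS₂ => ?_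
          rw [Expr.cost, ha] at hm₂
          rw [Expr.eval, ha] at hS₂
          subst hS₂
          have hi' : inner S₁ = inner S := inner_update_ctrl S 2 _
          rw [← hi', ← hi, ← inner_update]
          rw [hi, hi']
          exact ih _ (by omega) p st' (k + 1) _ z' _ R f F (by rwa [ctrl_update_inner]) (by omega)
            (by omega) hF
        · exact zero_le
      · exact zero_le
    | seq c d =>
      simp only [List.map_cons, Cmd.wrap]
      rw [W_seq, W_seq]
      have := hmul 0 (by omega)
      rw [Nat.sub_zero] at this
      exact ih _ (by omega) (c :: d :: p) st k S z _ R f F hR (by omega) (by omega) hF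
    | cond e c d =>
      simp only [List.map_cons, Cmd.wrap]
      rw [W_cond, W_cond, hc, hv]
      by_cases h1 : e.cost (inner S) ≤ n
      · have := hmul _ h1
        have := hle (e.cost (inner S))
        rw [if_pos h1, if_pos (show e.cost (inner S) ≤ n' by omega)]
        have := ih (n - e.cost (inner S)) (by omega)
          ((if (e.eval (inner S)).toBool = true then c else d) :: p) st k S z
          (n' - e.cost (inner S)) R f F hR (by omega) (by omega) hF
        convert this using 2
        split_ifs <;> rfl
      · rw [if_neg h1]; exact zero_le
    | loop e c =>
      simp only [List.map_cons, Cmd.wrap]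
      rw [W_loop, W_loop, hc, hv]
      by_cases h1 : e.cost (inner S) ≤ n
      · have := hmul _ h1
        have := hle (e.cost (inner S))
        rw [if_pos h1, if_pos (show e.cost (inner S) ≤ n' by omega)]
        have := ih (n - e.cost (inner S)) (by omega)
          (if (e.eval (inner S)).toBool = true then c :: .loop e c :: p else p) st k S z
          (n' - e.cost (inner S)) R f F hR (by omega) (by omega) hF
        convert this using 2
        split_ifs <;> rfl
      · rw [if_neg h1]; exact zero_le

/-- `Implements` is only a lower bound for large budgets. Complementation yields an upper bound for
every budget, at the price of post-expectations bounded by one. -/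
theorem Implements.W_le (hK : Implements Oi O Rel t C K) {k : ℕ} {st : τ} {S : Store} {z : σ}
    (hR : Rel k st (ctrl S) z) (hk : k < t) (hq : (S 6).size ≤ t) (n : ℕ) (g : Data × τ → ℝ≥0∞)
    (F : ℕ → Store → σ → ℝ≥0∞) (hg : ∀ r, g r ≤ 1) (hF1 : ∀ m s z, F m s z ≤ 1)
    (hF : ∀ a st' m S' z', m ≤ n → inner S' = inner S → Rel (k + 1) st' (ctrl S') z' → S' 6 = a →
      F m S' z' ≤ g (a, st')) : W O n [K] S z F ≤ E (Oi st (S 6)) g := by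
  refine W_le_of_le_W O (Oi st (S 6)) (le_max_left n C) [K] S z
    (fun r S' z' => inner S' = inner S ∧ Rel (k + 1) r.2 (ctrl S') z' ∧ S' 6 = r.1) ?_ g F hg hF1
    fun r m S' z' hm h => hF r.1 r.2 m S' z' hm h.1 h.2.1 h.2.2
  intro g' F' hF'
  exact hK k st S z _ hR hk hq (le_max_right _ _) g' F' fun a st' m S' z' _ h1 h2 h3 =>
    hF' (a, st') m S' z' ⟨h1, h2, h3⟩

/-- The wrapped program is never faster than the original, so with the same budget it achieves no
more; where it runs out of time earlier, the left side is zero. -/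
theorem W_wrap_le_W {v₀ : ℕ} (hK : Implements Oi O Rel t C K) (hRel : Insensitive Rel v₀) (n : ℕ) :
    ∀ (p : List Cmd) (st : τ) (k : ℕ) (S : Store) (z : σ) (f : Store → τ → ℝ≥0∞)
      (F : ℕ → Store → σ → ℝ≥0∞), (∀ s st, f s st ≤ 1) → (∀ m s z, F m s z ≤ 1) →
      Rel k st (ctrl S) z → k + n ≤ t →
      (∀ st' k' m S' z', Rel k' st' (ctrl S') z' → k' ≤ t → F m S' z' ≤ f (inner S') st') →
      W O n (p.map (Cmd.wrap K)) S z F ≤ W Oi n p (inner S) st (fun _ s st => f s st) := by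
  induction n using Nat.strong_induction_on with
  | _ n ih =>
    intro p st k S z f F hf hF1 hR hk hF
    rcases p with _ | ⟨c, p⟩
    · rw [List.map_nil, W_nil, W_nil]
      exact hF _ _ _ _ _ hR (by omega)
    rcases n with _ | n
    · rw [List.map_cons, W_zero]; exact zero_le
    have hc (e : Expr) : (e.ren (3 * · + 1)).cost S = e.cost (inner S) := Expr.cost_ren _ _ _
    have hv (e : Expr) : (e.ren (3 * · + 1)).eval S = e.eval (inner S) := Expr.eval_ren _ _ _
    cases c with
    | assign x e =>
      simp only [List.map_cons, Cmd.wrap]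
      rw [W_assign, W_assign, hc, hv]
      split_ifs with h1
      · rw [← inner_update]
        exact ih _ (by omega) p st k _ z f F hf hF1 (by rwa [ctrl_update_inner]) (by omega) hF
      · exact zero_le
    | flip x =>
      simp only [List.map_cons, Cmd.wrap]
      rw [W_flip, W_flip]
      refine E_mono fun b _ => ?_
      rw [← inner_update]
      exact ih _ (by omega) p st k _ z f F hf hF1 (by rwa [ctrl_update_inner]) (by omega) hF
    | call x e =>
      simp only [List.map_cons, Cmd.wrap]
      rw [W_call, W_seq]
      rcases n with _ | n
      · rw [W_zero]; exact zero_le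
      rw [W_assign, hc, hv]
      by_cases h1 : e.cost (inner S) ≤ n
      swap
      · rw [if_neg h1]; exact zero_le
      rw [if_pos h1, if_pos (by omega)]
      set S₁ := Function.update S 6 (e.eval (inner S)) with hS₁
      have h6 : S₁ 6 = e.eval (inner S) := by simp [hS₁]
      have hes := e.size_eval_le (inner S)
      rcases h2 : n - e.cost (inner S) with _ | m
      · rw [W_zero]; exact zero_le
      rw [W_seq, W_cons, ← h6]
      have hW1 : ∀ (m : ℕ) (p : List Cmd) (s : Store) (st : τ),
        W Oi m p s st (fun _ s st => f s st) ≤ 1 := fun m p s st =>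
          W_le_one _ _ _ _ _ _ fun _ s st => hf s st
      refine hK.W_le (S := S₁) (hRel.update hR _) (by omega) (by rw [h6]; omega) m _ _ (fun r => ?_)
        (fun m s z => W_le_one _ _ _ _ _ _ hF1) ?_
      · split_ifs
        · exact hW1 _ _ _ _
        · exact zero_le
      intro a st' m' S' z' hm' hi hR' ha
      rcases m' with _ | m'
      · rw [W_zero]; exact zero_le
      rw [W_assign, Expr.cost, Expr.eval, ha]
      dsimp only
      split_ifs with h4 h5
      · have hi' : inner S₁ = inner S := inner_update_ctrl S 2 _
        rw [← hi', ← hi, ← inner_update]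
        refine (ih _ (by omega) p st' (k + 1) _ z' f F hf hF1 (by rwa [ctrl_update_inner])
          (by omega) hF).trans ?_
        rw [hi, hi']
        -- Less time is left on the wrapped side, since copying and the handler used some of it.
        exact W_mono _ _ _ _ (by omega) fun _ _ _ _ => le_rfl
      · omega
      · exact zero_le
      · exact zero_le
    | seq c d =>
      simp only [List.map_cons, Cmd.wrap]
      rw [W_seq, W_seq]
      exact ih _ (by omega) (c :: d :: p) st k S z f F hf hF1 hR (by omega) hF
    | cond e c d =>
      simp only [List.map_cons, Cmd.wrap]
      rw [W_cond, W_cond, hc, hv]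
      by_cases h1 : e.cost (inner S) ≤ n
      · rw [if_pos h1, if_pos h1]
        have := ih (n - e.cost (inner S)) (by omega)
          ((if (e.eval (inner S)).toBool = true then c else d) :: p) st k S z f F hf hF1 hR
          (by omega) hF
        convert this using 2
        split_ifs <;> rfl
      · rw [if_neg h1]; exact zero_le
    | loop e c =>
      simp only [List.map_cons, Cmd.wrap]
      rw [W_loop, W_loop, hc, hv]
      by_cases h1 : e.cost (inner S) ≤ n
      · rw [if_pos h1, if_pos h1]
        have := ih (n - e.cost (inner S)) (by omega)
          (if (e.eval (inner S)).toBool = true then c :: .loop e c :: p else p) st k S z f F hf hF1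
          hR (by omega) hF
        convert this using 2
        split_ifs <;> rfl
      · rw [if_neg h1]; exact zero_le

end Wrap

/-! ## Handlers given by structured programs -/

/-- Run a structured program with cleared temporary variables `v₀ ≤ i < v`. -/
noncomputable def Prog.fresh (v₀ v : ℕ) (P : Prog) : Cmd :=
  .seq (.clear ((List.range' v₀ (v - v₀)).map (3 * ·))) P.compile

section Handler

variable {τ σ : Type}

/-- The structured program `H` implements the oracle `Oi` with the oracle `O`. -/
def Handles (N cap t : ℕ) (Oi : τ → Data → PMF (Data × τ)) (O : σ → Data → PMF (Data × σ))
    (Rel : ℕ → τ → Store → σ → Prop) (H : Prog) : Prop :=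
  ∀ (k : ℕ) (st : τ) (s : Store) (z : σ), Rel k st s z → k < t → (s 2).size ≤ t →
    ∀ (g : Data × τ → ℝ≥0∞) (g' : Store → σ → ℝ≥0∞),
    (∀ st' s' z', Rel (k + 1) st' s' z' → g (s' 2, st') ≤ g' s' z') →
    E (Oi st (s 2)) g ≤ H.wp N cap O g' s z

/-- The sizes of the permanent variables other than `2` are bounded. -/
def Bounded (v₀ t B : ℕ) (Rel : ℕ → τ → Store → σ → Prop) : Prop :=
  ∀ k st s z, Rel k st s z → k ≤ t → ∀ i < v₀, i ≠ 2 → (s i).size ≤ B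

variable {N cap t v₀ v B : ℕ} {Oi : τ → Data → PMF (Data × τ)} {O : σ → Data → PMF (Data × σ)}
  {Rel : ℕ → τ → Store → σ → Prop} {H : Prog}

/-- Permanent variables other than `2` are bounded through `Rel`, the query by hypothesis, and the
temporaries start as `nil`, so each call has the same cost bound. Without clearing, the size bound
would be sent through `H.cost` once per query, and the iterate need not be polynomial. -/
theorem Prog.wp_le_W_fresh (hRel : Insensitive Rel v₀) (hB : Bounded v₀ t B Rel) (hv : H.vars ≤ v)
    (hcap : cap ≤ B) {k : ℕ} {st : τ} {S : Store} {z : σ} {n : ℕ} (h2 : 2 < v₀)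
    (hR : Rel k st (ctrl S) z) (hk : k ≤ t) (hq : (S 6).size ≤ B)
    (hn : H.cost.eval B + 3 * v + 3 ≤ n) (r : ℝ≥0∞) (g : Store → σ → ℝ≥0∞)
    (F : ℕ → Store → σ → ℝ≥0∞)
    (hr : ∀ s, Rel k st s z → s 2 = S 6 → r ≤ H.wp N cap O g s z)
    (hF : ∀ m S' z', n ≤ m + (H.cost.eval B + 3 * v + 3) → inner S' = inner S →
      g (ctrl S') z' ≤ F m S' z') :
    r ≤ W O n [H.fresh v₀ v] S z F := by
  obtain ⟨n, rfl⟩ : ∃ m, n = m + 1 := ⟨n - 1, by omega⟩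
  rw [Prog.fresh, W_seq]
  refine (Det.clear _ S).le_W (by simp; omega) fun m S₁ hm hS₁ => ?_
  have hlen : ((List.range' v₀ (v - v₀)).map (3 * ·)).length ≤ v := by simp
  have hmem (i : ℕ) : 3 * i ∈ (List.range' v₀ (v - v₀)).map (3 * ·) ↔ v₀ ≤ i ∧ i < v := by
    simp only [List.mem_map, List.mem_range'_1]
    constructor
    · rintro ⟨j, hj, h⟩; omega
    · intro h; exact ⟨i, by omega, rfl⟩
  have hlow (i : ℕ) (hi : i < v₀) : S₁ (3 * i) = S (3 * i) :=
    hS₁.2 _ fun h => by rw [hmem] at h; omega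
  have hR₁ : Rel k st (ctrl S₁) z := hRel k st (ctrl S) _ z (fun i hi _ => hlow i hi) hR
  have hi₁ : inner S₁ = inner S := by
    funext i
    refine hS₁.2 _ fun h => ?_
    simp only [List.mem_map] at h
    obtain ⟨j, -, hj⟩ := h
    omega
  refine (hr (ctrl S₁) hR₁ (hlow 2 h2)).trans ?_
  refine Prog.wp_le_W O N cap v H hv B S₁ z m g F hcap (fun i hi => ?_) (by omega)
    fun m' S' z' hm' hi' _ => hF _ _ _ (by omega) (hi'.trans hi₁)
  by_cases h : i < v₀
  · by_cases h' : i = 2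
    · subst h'; rw [hlow 2 h]; exact hq
    · exact hB k st _ z hR₁ hk i h h'
  · rw [hS₁.1 _ ((hmem i).2 ⟨by omega, hi⟩)]
    have : (Data.nil).size ≤ (S 6).size := (S 6).one_le_size
    omega

theorem Handles.implements (hH : Handles N cap t Oi O Rel H) (hRel : Insensitive Rel v₀)
    (hB : Bounded v₀ t B Rel) (hv : H.vars ≤ v) (hcap : cap ≤ B) (ht : t ≤ B) (h2 : 2 < v₀) :
    Implements Oi O Rel t (H.cost.eval B + 3 * v + 3)
      (H.fresh v₀ v) := by
  intro k st S z n hR hk hq hn g F hF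
  -- `Handles` speaks of the control variables only. The infimum over all full stores and times that
  -- are compatible with given control variables turns `F` into a post-expectation on them.
  refine Prog.wp_le_W_fresh (N := N) hRel hB hv hcap h2 hR (by omega) (hq.trans ht) hn _
    (fun s z => ⨅ (S' : Store) (m : ℕ) (_ : ctrl S' = s ∧ inner S' = inner S ∧
      n ≤ m + (H.cost.eval B + 3 * v + 3)), F m S' z) F ?_ ?_
  · intro s hs h6
    rw [← h6]
    refine hH k st s z hs hk (by rwa [h6]) g _ fun st' s' z' hR' => ?_
    refine le_iInf fun S' => le_iInf fun m => le_iInf fun h => ?_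
    obtain ⟨rfl, h1, h2⟩ := h
    exact hF _ st' m S' z' h2 h1 hR' rfl
  · intro m S' z' hm hi
    exact (iInf_le _ S').trans ((iInf_le _ m).trans (iInf_le _ ⟨rfl, hi, hm⟩))

end Handler

end Troll

namespace Troll

open scoped ENNReal

/-! ## Reductions -/

/-- A reduction: a structured program that prepares the input of the supervised program, one that
answers its queries, and one that computes the output. The variables below `perm` are permanent. -/
structure Reduction where
  init : Prog
  handler : Prog
  final : Prog
  perm : ℕ
  width : ℕ
  two_lt : 2 < perm
  init_vars : init.vars ≤ width
  handler_vars : handler.vars ≤ width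
  final_vars : final.vars ≤ width
  two_lt_width : 2 < width

namespace Reduction

variable (R : Reduction)

/-- The reduction applied to a program. -/
noncomputable def code (c : Cmd) : Cmd :=
  .seq R.init.compile (.seq (.assign 1 (.var 6)) (.seq (Cmd.wrap (R.handler.fresh R.perm R.width) c)
    (.seq (.assign 6 (.var 1)) (R.final.fresh R.perm R.width))))

/-- The running time in terms of a bound `B` for the sizes of values and of the running time `t` of
the supervised program. -/
noncomputable def time (B t : ℕ) : ℕ :=
  R.init.cost.eval B + R.final.cost.eval B + t * (R.handler.cost.eval B + 3 * R.width + 13) +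
    2 * B + 3 * R.width + 20

/-- The polynomial form of `Reduction.time`. -/
noncomputable def timePoly (B t : Polynomial ℕ) : Polynomial ℕ :=
  R.init.cost.comp B + R.final.cost.comp B +
    t * (R.handler.cost.comp B + 3 * Polynomial.C R.width + 13) +
    2 * B + 3 * Polynomial.C R.width + 20

theorem eval_timePoly (B t : Polynomial ℕ) (n : ℕ) :
    (R.timePoly B t).eval n = R.time (B.eval n) (t.eval n) := by
  simp [timePoly, time]

/-- The reduction simulates the oracles `Oi i`, where `i` is distributed according to `p`, for
programs with input `y i` that run for `t` steps. -/
structure Simulates {ι τ σ : Type} (N cap t B : ℕ) (p : PMF ι) (Oi : ι → τ → Data → PMF (Data × τ))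
    (Rel : ι → ℕ → τ → Store → σ → Prop) (y : ι → Data) (st₀ : τ)
    (O : σ → Data → PMF (Data × σ)) (X : Data) (z₀ : σ) : Prop where
  init : ∀ (g : ι → ℝ≥0∞) (g' : Store → σ → ℝ≥0∞),
    (∀ i ∈ p.support, ∀ s z, Rel i 0 st₀ s z → s 2 = y i → g i ≤ g' s z) →
    E p g ≤ R.init.wp N cap O g' (start X) z₀
  handles : ∀ i ∈ p.support, Handles N cap t (Oi i) O (Rel i) R.handler
  insensitive : ∀ i, Insensitive (Rel i) R.perm
  bounded : ∀ i ∈ p.support, Bounded R.perm t B (Rel i)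
  cap_le : cap ≤ B
  le_bound : t ≤ B
  size_le : X.size ≤ B

variable {R} {ι τ σ : Type} {N cap t B : ℕ} {p : PMF ι} {Oi : ι → τ → Data → PMF (Data × τ)}
    {Rel : ι → ℕ → τ → Store → σ → Prop} {y : ι → Data} {st₀ : τ}
    {O : σ → Data → PMF (Data × σ)} {X : Data} {z₀ : σ}

theorem ctrl_start (X : Data) : ctrl (start X) = start X := by
  funext i
  by_cases h : i = 0
  · simp [ctrl, start, h]
  · simp [ctrl, start, h]

theorem inner_start (X : Data) : inner (start X) = fun _ => Data.nil := by
  funext i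
  simp [inner, start]

theorem Simulates.init_le_W (h : R.Simulates N cap t B p Oi Rel y st₀ O X z₀) {n : ℕ}
    (hn : R.init.cost.eval B ≤ n) (g : ι → ℝ≥0∞) (F : ℕ → Store → σ → ℝ≥0∞)
    (hF : ∀ i ∈ p.support, ∀ m S z, n ≤ m + R.init.cost.eval B → inner S = (fun _ => Data.nil) →
      Rel i 0 st₀ (ctrl S) z → S 6 = y i → (y i).size ≤ R.init.cost.eval B → g i ≤ F m S z) :
    E p g ≤ W O n [R.init.compile] (start X) z₀ F := by
  have := Prog.wp_le_W O N cap R.width R.init R.init_vars B (start X) z₀ n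
    (fun s z => ⨅ (S : Store) (m : ℕ) (_ : ctrl S = s ∧ inner S = (fun _ => Data.nil) ∧
      n ≤ m + R.init.cost.eval B ∧ (S 6).size ≤ R.init.cost.eval B), F m S z) F h.cap_le
    (fun i _ => (size_start_le X _).trans h.size_le) hn ?_
  · rw [ctrl_start] at this
    refine (h.init g _ fun i hi s z hR hs => ?_).trans this
    refine le_iInf fun S => le_iInf fun m => le_iInf fun hS => ?_
    obtain ⟨rfl, h1, h2, h3⟩ := hS
    have hs' : S 6 = y i := hs
    exact hF i hi m S z h2 h1 hR hs' (hs' ▸ h3)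
  · intro m S z hm hi hS
    refine (iInf_le _ S).trans ((iInf_le _ m).trans (iInf_le _ ⟨rfl, ?_, hm, ?_⟩))
    · rw [hi, inner_start]
    · exact hS 2 R.two_lt_width

theorem start_eq {S : Store} (h : inner S = fun _ => Data.nil) (v : Data) :
    inner (Function.update S 1 v) = start v := by
  have := inner_update S 0 v
  rw [h] at this
  exact this

/-- The lower direction: on the clock `R.time B t` the reduction completes whatever the supervised
program does in `t` steps. Sizes grow by at most `3` per step, so `hy` bounds the output by `B`, and
the final program is affordable. -/
theorem Simulates.le_W (h : R.Simulates N cap t B p Oi Rel y st₀ O X z₀) {n : ℕ} (c : Cmd)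
    (hn : R.time B t ≤ n) (hy : ∀ i ∈ p.support, (y i).size + 3 * t ≤ B)
    (f : ι → Data → τ → ℝ≥0∞) (φ : Data → σ → ℝ≥0∞)
    (hf : ∀ i ∈ p.support, ∀ k st s z, Rel i k st s z → k ≤ t → (s 2).size ≤ B →
      f i (s 2) st ≤ R.final.wp N cap O (fun s z => φ (s 0) z) s z) :
    E p (fun i => W (Oi i) t [c] (start (y i)) st₀ fun _ s st => f i (s 0) st) ≤
      W O n [R.code c] (start X) z₀ fun _ s z => φ (s 0) z := by
  rw [time] at hn
  rw [code]
  obtain ⟨n, rfl⟩ : ∃ m, n = m + 1 := ⟨n - 1, by omega⟩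
  rw [W_seq, W_cons]
  refine h.init_le_W (by omega) _ _ fun i hi m S z hm hin hR h6 hys => ?_
  have hyB := hy i hi
  set C := R.handler.cost.eval B + 3 * R.width + 3 with hC
  have hC' : t * (C + 10) = t * (R.handler.cost.eval B + 3 * R.width + 13) := by rw [hC]
  obtain ⟨m, rfl⟩ : ∃ k, m = k + 1 := ⟨m - 1, by omega⟩
  rw [W_seq]
  refine (Det.assign _ _ _).le_W (by rw [Expr.cost, h6]; omega) fun m₁ S₁ hm₁ hS₁ => ?_
  rw [Expr.cost, h6] at hm₁
  rw [Expr.eval, h6] at hS₁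
  obtain ⟨m₁, rfl⟩ : ∃ k, m₁ = k + 1 := ⟨m₁ - 1, by omega⟩
  rw [W_seq, W_cons (O := O) (n := m₁)]
  have hin₁ : inner S₁ = start (y i) := by rw [hS₁]; exact start_eq hin _
  have hR₁ : Rel i 0 st₀ (ctrl S₁) z := by
    rw [hS₁]
    have := ctrl_update_inner S 0 (y i)
    rw [show 3 * 0 + 1 = 1 from rfl] at this
    rwa [this]
  have hK : Implements _ _ _ _ C _ := (h.handles i hi).implements (h.insensitive i) (h.bounded i hi) R.handler_vars
    h.cap_le h.le_bound R.two_lt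
  refine le_trans ?_ (W_le_W_wrap hK (h.insensitive i) t [c] st₀ 0 S₁ z m₁
    (B + R.final.cost.eval B + 3 * R.width + 10)
    (fun s st => if (s 0).size ≤ B then f i (s 0) st else 0) _ hR₁ (by omega) (by omega) ?_)
  · rw [hin₁]
    refine W_mono_sizes _ _ _ _ _ _ (fun _ => (y i).size) _ _ le_rfl (size_start_le _)
      fun m' s' st' _ hs' => ?_
    rw [if_pos ((hs' 0).trans hyB)]
  · intro st' k' m' S' z' hR' hk' hm'
    split_ifs with hsz
    · obtain ⟨m', rfl⟩ : ∃ k, m' = k + 1 := ⟨m' - 1, by omega⟩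
      have hsz' : (S' 1).size ≤ B := hsz
      rw [W_seq]
      refine (Det.assign _ _ _).le_W (by rw [Expr.cost]; omega) fun m₂ S₂ hm₂ hS₂ => ?_
      rw [Expr.cost] at hm₂
      rw [Expr.eval] at hS₂
      have hR₂ : Rel i k' st' (ctrl S₂) z' := by
        rw [hS₂]
        exact (h.insensitive i).update hR' _
      have h6₂ : S₂ 6 = S' 1 := by simp [hS₂]
      refine Prog.wp_le_W_fresh (N := N) (h.insensitive i) (h.bounded i hi) R.final_vars h.cap_le
        R.two_lt hR₂ hk' (by rw [h6₂]; exact hsz) (by omega) _ (fun s z => φ (s 0) z) _ ?_ fun m S z _ _ => le_rfl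
      intro s hs hs2
      have := hf i hi k' st' s z' hs hk' (by rw [hs2, h6₂]; exact hsz')
      rw [hs2, h6₂] at this
      exact this
    · exact zero_le

/-- The upper direction, by complementation for the initialisation, each handler call and the final
program. No lower bound on the clock of the reduction is needed, as the supervised program is
granted the whole budget `n`. -/
theorem Simulates.W_le {n : ℕ} (h : R.Simulates N cap n B p Oi Rel y st₀ O X z₀) (c : Cmd)
    (f : ι → Data → τ → Data) (φ : Data → ℝ≥0∞) (hφ : ∀ d, φ d ≤ 1)
    (hf : ∀ i ∈ p.support, ∀ k st s z, Rel i k st s z → ∀ ψ : Data → ℝ≥0∞,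
      ψ (f i (s 2) st) ≤ R.final.wp N cap O (fun s _ => ψ (s 0)) s z) :
    W O n [R.code c] (start X) z₀ (fun _ s _ => φ (s 0)) ≤
      E p (fun i => W (Oi i) n [c] (start (y i)) st₀ fun _ s st => φ (f i (s 0) st)) := by
  rw [code]
  rcases n with _ | n
  · rw [W_zero]; exact zero_le
  rw [W_seq, W_cons]
  have hφ' (m : ℕ) (q : List Cmd) (s : Store) (z : σ) : W O m q s z (fun _ s _ => φ (s 0)) ≤ 1 :=
    W_le_one _ _ _ _ _ _ fun _ _ _ => hφ _
  refine W_le_of_le_W O p (le_max_left n (R.init.cost.eval B)) _ _ _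
    (fun i S z => i ∈ p.support ∧ Rel i 0 st₀ (ctrl S) z ∧ S 6 = y i ∧
      inner S = fun _ => Data.nil) ?_ _ _ (fun i => W_le_one _ _ _ _ _ _ fun _ _ _ => hφ _)
    (fun m s z => hφ' _ _ _ _) ?_
  · exact fun g F hgF => h.init_le_W (le_max_right _ _) g F fun i hi m S z _ hin hR h6 _ =>
      hgF i m S z ⟨hi, hR, h6, hin⟩
  rintro i m S z hm ⟨hi, hR, h6, hin⟩
  rcases m with _ | m
  · rw [W_zero]; exact zero_le
  rw [W_seq]
  rcases m with _ | m
  · rw [W_zero]; exact zero_le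
  rw [W_assign]
  split_ifs with h1
  swap
  · exact zero_le
  rw [Expr.cost] at h1 ⊢
  rw [Expr.eval, h6]
  rcases h2 : m - (y i).size with _ | m'
  · rw [W_zero]; exact zero_le
  rw [W_seq, W_cons]
  have hin₁ : inner (Function.update S 1 (y i)) = start (y i) := start_eq hin _
  have hR₁ : Rel i 0 st₀ (ctrl (Function.update S 1 (y i))) z := by
    have := ctrl_update_inner S 0 (y i)
    rw [show 3 * 0 + 1 = 1 from rfl] at this
    rwa [this]
  have hK := (h.handles i hi).implements (h.insensitive i) (h.bounded i hi) R.handler_vars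
    h.cap_le h.le_bound R.two_lt
  refine (W_wrap_le_W hK (h.insensitive i) m' [c] st₀ 0 _ z (fun s st => φ (f i (s 0) st)) _
    (fun _ _ => hφ _) (fun m s z => hφ' _ _ _ _) hR₁ (by omega) ?_).trans ?_
  swap
  · rw [hin₁]
    exact W_mono _ _ _ _ (by omega) fun _ _ _ _ => le_rfl
  intro st' k' m₁ S' z' hR' hk'
  rcases m₁ with _ | m₁
  · rw [W_zero]; exact zero_le
  rw [W_seq]
  rcases m₁ with _ | m₁
  · rw [W_zero]; exact zero_le
  rw [W_assign]
  split_ifs with h3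
  swap
  · exact zero_le
  rw [Expr.eval]
  set S₂ := Function.update S' 6 (S' 1) with hS₂
  have hR₂ : Rel i k' st' (ctrl S₂) z' := (h.insensitive i).update hR' _
  have h6₂ : S₂ 6 = S' 1 := by simp [hS₂]
  -- Only one final value matters, so the index is trivial. The output `S' 1` has no bound fixed in
  -- advance here; `max B (S' 1).size` may depend on it because the larger budget occurs only inside
  -- the complementation.
  refine (W_le_of_le_W O (PMF.pure ()) (le_max_left _
    (R.final.cost.eval (max B (S' 1).size) + 3 * R.width + 3)) _ _ _
    (fun _ S z => S 0 = f i (S' 1) st') ?_ (fun _ => φ (f i (S' 1) st')) _ (fun _ => hφ _)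
    (fun m s z => hφ _) ?_).trans (E_pure _ _).le
  · intro g F hgF
    rw [E_pure]
    refine Prog.wp_le_W_fresh (N := N) (h.insensitive i) (B := max B (S' 1).size) ?_
      R.final_vars (h.cap_le.trans (le_max_left _ _)) R.two_lt hR₂ hk'
      (by rw [h6₂]; exact le_max_right _ _) (le_max_right _ _) _
      (fun s _ => if s 0 = f i (S' 1) st' then g () else 0) _ ?_ ?_
    · exact fun k st s z hR hk i' h1 h2 =>
        (h.bounded i hi k st s z hR hk i' h1 h2).trans (le_max_left _ _)
    · intro s hs hs2
      have := hf i hi k' st' s z' hs (fun d => if d = f i (S' 1) st' then g () else 0)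
      rw [hs2, h6₂, if_pos rfl] at this
      exact this
    · intro m S z _ _
      split_ifs with h0
      · exact hgF () m S z h0
      · exact zero_le
  · rintro - m S z - hS
    exact (congrArg φ hS).le

end Reduction

end Troll

namespace Troll

open scoped ENNReal

/-! ## Bounds for the sizes of values -/

section Sizes

/-- A polynomial that bounds the sizes of the outputs of some algorithms, and of strings of coins. -/
noncomputable def growth (l : List PPTAlgorithm) (p : Polynomial ℕ) : Polynomial ℕ :=
  .X + (l.map PPTAlgorithm.outBound).sum + 4 * p + 1

variable {l : List PPTAlgorithm} {p : Polynomial ℕ}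

theorem le_growth (x : ℕ) : x ≤ (growth l p).eval x := by
  simp [growth]; omega

theorem size_out_le_growth {A : PPTAlgorithm} (hA : A ∈ l) {n m : ℕ} {x y : Data}
    (hy : y ∈ (A.out n x).support) (h : n + x.size ≤ m) : y.size ≤ (growth l p).eval m := by
  have h1 := (A.size_out_le hy).trans (PPTAlgorithm.eval_mono _ h)
  have h2 : A.outBound.eval m ≤ ((l.map PPTAlgorithm.outBound).sum).eval m := by
    induction l with
    | nil => simp at hA
    | cons B l ih =>
      rcases List.mem_cons.1 hA with rfl | hA
      · simp
      · have := ih hA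
        simp
        omega
  simp [growth]
  omega

theorem size_bits_le_growth {n m : ℕ} {r : List Bool} (hr : r ∈ (coins (p.eval n)).support)
    (h : n ≤ m) : (Data.bits r).size ≤ (growth l p).eval m := by
  have h1 := size_bits_le r
  rw [length_of_mem_coins hr] at h1
  have h2 := PPTAlgorithm.eval_mono p h
  simp [growth]
  omega

/-- Bounds for the sizes of values that are computed in several steps. -/
noncomputable def level (G : Polynomial ℕ) (a : ℕ) : ℕ → ℕ
  | 0 => a
  | i + 1 => G.eval (20 * level G a i + 20)

/-- The polynomial form of `level`. -/
noncomputable def levelPoly (G a : Polynomial ℕ) : ℕ → Polynomial ℕ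
  | 0 => a
  | i + 1 => G.comp (20 * levelPoly G a i + 20)

theorem eval_levelPoly (G a : Polynomial ℕ) (n i : ℕ) :
    (levelPoly G a i).eval n = level G (a.eval n) i := by
  induction i with
  | zero => rfl
  | succ i ih => simp [levelPoly, level, ih]

theorem level_succ_ge (a i : ℕ) :
    20 * level (growth l p) a i + 20 ≤ level (growth l p) a (i + 1) :=
  le_growth _

/-- One level per stage of the games: `1` for issuer keys and reference strings, `2` for user keys,
`3` for commitments, `4` for credentials issued honestly, `5` for queries and stored credentials,
`6` for signatures and proofs, `7` for answers. The number `20` leaves room for tuples. -/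
theorem levels (a : ℕ) :
    20 * level (growth l p) a 0 + 20 ≤ level (growth l p) a 1 ∧
    20 * level (growth l p) a 1 + 20 ≤ level (growth l p) a 2 ∧
    20 * level (growth l p) a 2 + 20 ≤ level (growth l p) a 3 ∧
    20 * level (growth l p) a 3 + 20 ≤ level (growth l p) a 4 ∧
    20 * level (growth l p) a 4 + 20 ≤ level (growth l p) a 5 ∧
    20 * level (growth l p) a 5 + 20 ≤ level (growth l p) a 6 ∧
    20 * level (growth l p) a 6 + 20 ≤ level (growth l p) a 7 :=
  ⟨level_succ_ge a 0, level_succ_ge a 1, level_succ_ge a 2, level_succ_ge a 3, level_succ_ge a 4,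
    level_succ_ge a 5, level_succ_ge a 6⟩

theorem size_out_le_level {A : PPTAlgorithm} (hA : A ∈ l) {n a i : ℕ} {x y : Data}
    (hy : y ∈ (A.out n x).support) (h : n + x.size ≤ 20 * level (growth l p) a i + 20) :
    y.size ≤ level (growth l p) a (i + 1) :=
  size_out_le_growth hA hy h

end Sizes

theorem mem_support_do {α β : Type} {p : PMF α} {f : α → PMF β} {b : β} :
    b ∈ (p >>= f).support ↔ ∃ a ∈ p.support, b ∈ (f a).support :=
  PMF.mem_support_bind_iff _ _ _

theorem mem_support_return {α : Type} {a b : α} : b ∈ (pure a : PMF α).support ↔ b = a :=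
  PMF.mem_support_pure_iff _ _

@[simp] theorem Data.opt_none : Data.opt none = .nil := rfl
@[simp] theorem Data.opt_some (d : Data) : Data.opt (some d) = .cons .nil d := rfl
@[simp] theorem Data.size_nil : Data.size .nil = 1 := rfl
@[simp] theorem Data.size_cons (a b : Data) : (Data.cons a b).size = a.size + b.size + 1 := rfl
@[simp] theorem Data.tuple_nil : Data.tuple [] = .nil := rfl
@[simp] theorem Data.tuple_cons (a : Data) (l : List Data) :
    Data.tuple (a :: l) = .cons a (Data.tuple l) := rfl
@[simp] theorem Data.nth_zero (d : Data) : d.nth 0 = d.hd := by cases d <;> rfl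
@[simp] theorem Data.nth_succ (d : Data) (i : ℕ) : d.nth (i + 1) = d.tl.nth i := by cases d <;> rfl

theorem Data.size_hd_le (d : Data) : d.hd.size ≤ d.size := by
  cases d <;> simp; omega

theorem Data.size_tl_le (d : Data) : d.tl.size ≤ d.size := by
  cases d <;> simp; omega

theorem Data.size_nth_le (d : Data) (i : ℕ) : (d.nth i).size ≤ d.size := by
  induction i generalizing d with
  | zero => simpa using d.size_hd_le
  | succ i ih => simpa using (ih d.tl).trans d.size_tl_le

theorem Data.size_opt_toOpt_le (d : Data) : (Data.opt d.toOpt).size ≤ d.size := by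
  cases d with
  | nil => simp [Data.toOpt]
  | cons a b => have := a.one_le_size; simp [Data.toOpt]; omega

theorem Data.size_bit_le (b : Bool) : (Data.bit b).size ≤ 3 := by cases b <;> simp [Data.bit]

/-! ## The challenger with proofs -/

namespace DAAScheme

variable (D : DAAScheme)

/-- First half of a join: as `joinQuery`, but the answer contains a proof made by `prove`. -/
noncomputable def proofJoin (n : ℕ) (pk : Data) (prove : Data → Data → PMF Data) (S : Data)
    (st : GameState) : PMF (Data × GameState) :=
  if (st.signers S).isSome then return (Data.opt none, st)
  else do
    let skS ← D.userKey n pk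
    let r ← coins (D.joinCoins.eval n)
    let π ← prove (Data.tuple [D.join n pk skS r, pk]) (Data.tuple [skS, Data.bits r])
    return (Data.opt (some (Data.tuple [D.join n pk skS r, π])),
      { st with sessions := Function.update st.sessions S (some skS) })

/-- The challenger of user-controlled anonymity, extended by proofs in joins. -/
noncomputable def proofChallenger (n : ℕ) (pk : Data) (b : Bool) (prove : Data → Data → PMF Data)
    (st : GameState) (q : Data) : PMF (Data × GameState) :=
  if (q.nth 0).len = 1 then D.proofJoin n pk prove (q.nth 1) st else D.challenger n pk b st q

/-- The keys of users come from the key generation, and the credentials are valid and have size at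
most `Q`. -/
structure GoodState (n : ℕ) (pk : Data) (Q : ℕ) (st : GameState) : Prop where
  session : ∀ S sk, st.sessions S = some sk → sk ∈ (D.userKey n pk).support
  signer : ∀ S u, st.signers S = some u →
    u.1 ∈ (D.userKey n pk).support ∧ D.check n pk u.1 u.2 = true ∧ u.2.size ≤ Q

theorem GoodState.init (n : ℕ) (pk : Data) (Q : ℕ) : D.GoodState n pk Q GameState.init :=
  ⟨by simp [GameState.init], by simp [GameState.init]⟩

variable {D} {n : ℕ} {pk : Data} {Q : ℕ} {st : GameState}

theorem GoodState.join (h : D.GoodState n pk Q st) {S sk : Data}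
    (hsk : sk ∈ (D.userKey n pk).support) :
    D.GoodState n pk Q { st with sessions := Function.update st.sessions S (some sk) } := by
  refine ⟨fun S' sk' h' => ?_, h.signer⟩
  by_cases hS : S' = S
  · subst hS
    simp only [Function.update_self, Option.some.injEq] at h'
    exact h' ▸ hsk
  · simp only [ne_eq, hS, not_false_eq_true, Function.update_of_ne] at h'
    exact h.session S' sk' h'

theorem GoodState.leave (h : D.GoodState n pk Q st) {S : Data} :
    D.GoodState n pk Q { st with sessions := Function.update st.sessions S none } := by
  refine ⟨fun S' sk' h' => ?_, h.signer⟩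
  by_cases hS : S' = S
  · subst hS
    simp at h'
  · simp only [ne_eq, hS, not_false_eq_true, Function.update_of_ne] at h'
    exact h.session S' sk' h'

theorem GoodState.accept (h : D.GoodState n pk Q st) {S sk cred : Data}
    (hsk : sk ∈ (D.userKey n pk).support) (hc : D.check n pk sk cred = true) (hQ : cred.size ≤ Q) :
    D.GoodState n pk Q { st with
      sessions := Function.update st.sessions S none
      signers := Function.update st.signers S (some (sk, cred)) } := by
  refine ⟨h.leave.session, fun S' u h' => ?_⟩
  by_cases hS : S' = S
  · subst hS
    simp only [Function.update_self, Option.some.injEq] at h'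
    subst h'
    exact ⟨hsk, hc, hQ⟩
  · simp only [ne_eq, hS, not_false_eq_true, Function.update_of_ne] at h'
    exact h.signer S' u h'

/-! ### Sizes of answers and the invariant of the challenger -/

variable {l : List PPTAlgorithm} {a : ℕ}

/-- Shorthand for the bounds that are used for the scheme `D`. -/
local notation "L" => level (growth l (DAAScheme.joinCoins D)) a

theorem size_key_le (hkey : D.keyAlg ∈ l) (ha : n + 1 ≤ a) (hpk : pk.size ≤ L 1)
    {sk : Data} (hsk : sk ∈ (D.userKey n pk).support) : sk.size ≤ L 2 := by
  refine size_out_le_level hkey hsk ?_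
  have h : L 0 = a := rfl
  obtain ⟨h0, h1, h2, h3, h4, h5, h6⟩ := levels (l := l) (p := D.joinCoins) a
  omega

theorem size_join_le (hkey : D.keyAlg ∈ l) (hjoin : D.joinAlg.toPPT ∈ l) (ha : n + 1 ≤ a)
    (hpk : pk.size ≤ L 1) {sk : Data} (hsk : sk ∈ (D.userKey n pk).support) {r : List Bool}
    (hr : r ∈ (coins (D.joinCoins.eval n)).support) :
    (Data.bits r).size ≤ L 1 ∧ (D.join n pk sk r).size ≤ L 3 := by
  have h : L 0 = a := rfl
  obtain ⟨h0, h1, h2, h3, h4, h5, h6⟩ := levels (l := l) (p := D.joinCoins) a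
  have hb : (Data.bits r).size ≤ L 1 :=
    size_bits_le_growth (m := 20 * L 0 + 20) hr (by omega)
  have hs := size_key_le hkey ha hpk hsk
  refine ⟨hb, size_out_le_level (i := 2) hjoin (n := n)
    (x := Data.tuple [pk, sk, Data.bits r]) ?_ ?_⟩
  · rw [PTAlgorithm.out_toPPT]
    exact (PMF.mem_support_pure_iff _ _).2 rfl
  · simp
    omega

theorem size_sign_le (hkey : D.keyAlg ∈ l) (hsign : D.signAlg ∈ l) (ha : n + 1 ≤ a)
    (hpk : pk.size ≤ L 1) {sk cred m σ : Data} {dom : Option Data}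
    (hsk : sk ∈ (D.userKey n pk).support) (hcred : cred.size ≤ L 5)
    (hdom : (Data.opt dom).size ≤ L 5) (hm : m.size ≤ L 5)
    (hσ : σ ∈ (D.sign n pk sk cred dom m).support) : σ.size ≤ L 6 := by
  have h : L 0 = a := rfl
  have hs := size_key_le hkey ha hpk hsk
  obtain ⟨h0, h1, h2, h3, h4, h5, h6⟩ := levels (l := l) (p := D.joinCoins) a
  refine size_out_le_level (i := 5) hsign hσ ?_
  simp
  omega

/-- `Prog.wp` discards answers above the cap, so the cap has to be one that the challenger never
exceeds. The invariant on keys and credentials is what `NymsMatch` asks for later. -/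
theorem challenger_support {b : Bool} (hkey : D.keyAlg ∈ l) (hjoin : D.joinAlg.toPPT ∈ l)
    (hsign : D.signAlg ∈ l) (ha : n + 1 ≤ a) (hpk : pk.size ≤ L 1) (hst : D.GoodState n pk (L 5) st)
    {q : Data} (hq : q.size ≤ L 5) {r : Data × GameState}
    (hr : r ∈ (D.challenger n pk b st q).support) :
    r.1.size ≤ L 7 ∧ D.GoodState n pk (L 5) r.2 := by
  obtain ⟨h0, h1, h2, h3, h4, h5, h6⟩ := levels (l := l) (p := D.joinCoins) a
  have hnone : (Data.opt none).size ≤ L 7 := by simp; omega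
  have hbot : ∀ st', D.GoodState n pk (L 5) st' → r ∈ (pure (Data.opt none, st') : PMF _).support →
      r.1.size ≤ L 7 ∧ D.GoodState n pk (L 5) r.2 := by
    intro st' h hr
    rw [mem_support_return] at hr
    subst hr
    exact ⟨hnone, h⟩
  have hnth (i : ℕ) : (q.nth i).size ≤ L 5 := (q.size_nth_le i).trans hq
  unfold challenger at hr
  split at hr
  · unfold signQuery at hr
    split at hr
    · exact hbot _ hst hr
    · rename_i skS cred hs
      obtain ⟨σ, hσ, hr⟩ := mem_support_do.1 hr
      rw [mem_support_return] at hr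
      subst hr
      have := size_sign_le hkey hsign ha hpk (hst.signer _ _ hs).1 (hst.signer _ _ hs).2.2
        ((Data.size_opt_toOpt_le _).trans (hnth 2)) (hnth 3) hσ
      exact ⟨by simp; omega, ⟨hst.session, hst.signer⟩⟩
  · unfold joinQuery at hr
    split_ifs at hr
    · exact hbot _ hst hr
    · obtain ⟨sk, hsk, hr⟩ := mem_support_do.1 hr
      obtain ⟨c, hc, hr⟩ := mem_support_do.1 hr
      rw [mem_support_return] at hr
      subst hr
      have := size_join_le hkey hjoin ha hpk hsk hc
      exact ⟨by simp; omega, hst.join hsk⟩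
  · unfold credQuery at hr
    split at hr
    · exact hbot _ hst hr
    · rename_i sk hs
      split_ifs at hr with hc
      · rw [mem_support_return] at hr
        subst hr
        exact ⟨by simp [Data.bit]; omega, hst.accept (hst.session _ _ hs) hc.2 (hnth 2)⟩
      · exact hbot _ hst.leave hr
  · unfold corruptQuery at hr
    split at hr
    · exact hbot _ hst hr
    · rename_i sk cred hs
      rw [mem_support_return] at hr
      subst hr
      have := size_key_le hkey ha hpk (hst.signer _ _ hs).1
      exact ⟨by simp at this ⊢; omega, ⟨hst.session, hst.signer⟩⟩
  · unfold challengeQuery at hr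
    split at hr
    · rename_i u₀ u₁ _ hu₀ hu₁
      obtain ⟨σ, hσ, hr⟩ := mem_support_do.1 hr
      rw [mem_support_return] at hr
      subst hr
      have hu : (if b = true then u₁ else u₀).1 ∈ (D.userKey n pk).support ∧
          (if b = true then u₁ else u₀).2.size ≤ L 5 := by
        split_ifs
        · exact ⟨(hst.signer _ _ hu₁).1, (hst.signer _ _ hu₁).2.2⟩
        · exact ⟨(hst.signer _ _ hu₀).1, (hst.signer _ _ hu₀).2.2⟩
      have := size_sign_le hkey hsign ha hpk hu.1 hu.2
        ((Data.size_opt_toOpt_le _).trans (hnth 3)) (hnth 4) hσ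
      exact ⟨by simp; omega, ⟨hst.session, hst.signer⟩⟩
    · exact hbot _ hst hr
  · exact hbot _ hst hr

theorem proofChallenger_support {b : Bool} {prove : Data → Data → PMF Data} (hkey : D.keyAlg ∈ l)
    (hjoin : D.joinAlg.toPPT ∈ l) (hsign : D.signAlg ∈ l) (ha : n + 1 ≤ a) (hpk : pk.size ≤ L 1)
    (hprove : ∀ x w π, x.size + w.size ≤ 10 * L 3 + 10 → π ∈ (prove x w).support → π.size ≤ L 6)
    (hst : D.GoodState n pk (L 5) st) {q : Data} (hq : q.size ≤ L 5) {r : Data × GameState}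
    (hr : r ∈ (D.proofChallenger n pk b prove st q).support) :
    r.1.size ≤ L 7 ∧ D.GoodState n pk (L 5) r.2 := by
  unfold proofChallenger at hr
  split_ifs at hr
  swap
  · exact challenger_support hkey hjoin hsign ha hpk hst hq hr
  obtain ⟨h0, h1, h2, h3, h4, h5, h6⟩ := levels (l := l) (p := D.joinCoins) a
  unfold proofJoin at hr
  split_ifs at hr
  · rw [mem_support_return] at hr
    subst hr
    exact ⟨by simp; omega, hst⟩
  · obtain ⟨sk, hsk, hr⟩ := mem_support_do.1 hr
    obtain ⟨c, hc, hr⟩ := mem_support_do.1 hr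
    obtain ⟨π, hπ, hr⟩ := mem_support_do.1 hr
    rw [mem_support_return] at hr
    subst hr
    have hj := size_join_le hkey hjoin ha hpk hsk hc
    have hk := size_key_le hkey ha hpk hsk
    have := hprove _ _ _ (by simp; omega) hπ
    exact ⟨by simp; omega, hst.join hsk⟩

end DAAScheme

end Troll

namespace Troll

open scoped ENNReal

/-! ## Tools for handlers -/

infixr:60 " ;; " => Prog.seq

/-- A tuple of expressions. -/
def Expr.tuple : List Expr → Expr
  | [] => .nil
  | e :: l => .cons e (Expr.tuple l)

/-- Entry number `i` of the value of an expression. -/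
def Expr.nth : Expr → ℕ → Expr
  | e, 0 => .hd e
  | e, i + 1 => .nth (.tl e) i

theorem Expr.eval_nth (s : Store) (e : Expr) (i : ℕ) : (e.nth i).eval s = (e.eval s).nth i := by
  induction i generalizing e with
  | zero => simp [nth, eval]
  | succ i ih => simp [nth, eval, ih]

/-- Choose a program by the length of the value of an expression. -/
def Prog.dispatch (d : Prog) : List Prog → Expr → Prog
  | [], _ => d
  | P :: l, e => .cond e (Prog.dispatch d l (.tl e)) P

theorem Prog.wp_dispatch {σ : Type} (N cap : ℕ) (O : σ → Data → PMF (Data × σ)) (d : Prog)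
    (l : List Prog) (e : Expr) (g : Store → σ → ℝ≥0∞) (s : Store) (z : σ) :
    (dispatch d l e).wp N cap O g s z = (l.getD (e.eval s).len d).wp N cap O g s z := by
  induction l generalizing e with
  | nil => simp [dispatch]
  | cons P l ih =>
    rw [dispatch, wp, ih, Expr.eval]
    cases e.eval s with
    | nil => simp [Data.len]
    | cons a b => simp [Data.len]

/-- An invariant of the simulated oracle may be used in the relation of a handler. -/
theorem Handles.of_invariant {τ σ : Type} {N cap t : ℕ} {Oi : τ → Data → PMF (Data × τ)}
    {O : σ → Data → PMF (Data × σ)} {Rel : ℕ → τ → Store → σ → Prop} {H : Prog} {J : τ → Prop}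
    (hJ : ∀ st q, J st → q.size ≤ t → ∀ r ∈ (Oi st q).support, J r.2)
    (h : ∀ (k : ℕ) (st : τ) (s : Store) (z : σ), Rel k st s z → J st → k < t → (s 2).size ≤ t →
      ∀ (g : Data × τ → ℝ≥0∞) (g' : Store → σ → ℝ≥0∞),
      (∀ st' s' z', Rel (k + 1) st' s' z' → g (s' 2, st') ≤ g' s' z') →
      E (Oi st (s 2)) g ≤ H.wp N cap O g' s z) :
    Handles N cap t Oi O (fun k st s z => J st ∧ Rel k st s z) H := by
  classical
  intro k st s z hR hk hq g g' hg
  have h1 : E (Oi st (s 2)) g = E (Oi st (s 2)) fun r => if J r.2 then g r else 0 :=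
    E_congr fun r hr => by rw [if_pos (hJ st _ hR.1 hq r hr)]
  rw [h1]
  refine h k st s z hR.2 hR.1 hk hq _ _ fun st' s' z' hR' => ?_
  split_ifs with hJ'
  · exact hg st' s' z' ⟨hJ', hR'⟩
  · exact zero_le

/-- In a call, facts on the possible answers may be used. -/
theorem Prog.le_wp_call {σ : Type} {N cap : ℕ} {O : σ → Data → PMF (Data × σ)} {J : σ → Prop}
    {x : ℕ} {e : Expr} {g : Store → σ → ℝ≥0∞} {s : Store} {z : σ} {c : ℝ≥0∞}
    (hJ : ∀ r ∈ (O z (e.eval s)).support, r.1.size ≤ cap ∧ J r.2)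
    (h : c ≤ E (O z (e.eval s)) fun r => ⨅ _ : J r.2, g (Function.update s x r.1) r.2) :
    c ≤ (call x e).wp N cap O g s z := by
  refine h.trans (E_mono fun r hr => ?_)
  rw [if_pos (hJ r hr).1]
  exact iInf_le _ (hJ r hr).2

theorem E_ite {α : Type} (c : Prop) [Decidable c] (p q : PMF α) (f : α → ℝ≥0∞) :
    E (if c then p else q) f = if c then E p f else E q f := by
  split_ifs <;> rfl

/-! ## The reduction to user-controlled anonymity with simulated proofs -/

/-- The handler that adds simulated proofs to the challenger of user-controlled anonymity. The
variables `3`, `4`, `5` contain the reference string, the trapdoor, and the key of the issuer. -/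
def simHandler (S₂ : PPTAlgorithm) : Prog :=
  .cond (.hd (.var 2))
    (.cond (.tl (.hd (.var 2)))
      (.call 2 (.var 2))
      (.call 6 (.var 2) ;;
        .cond (.var 6)
          (.alg S₂ 7 (.tuple [.var 3, .var 4, .tuple [.tl (.var 6), .var 5]]) ;;
            .assign 2 (.cons .nil (.tuple [.tl (.var 6), .var 7])))
          (.assign 2 .nil)))
    (.call 2 (.var 2))

/-- The reduction that simulates the reference string and the proofs. -/
def simReduction (S₁ S₂ : PPTAlgorithm) : Reduction where
  init := .assign 1 (.hd (.var 0)) ;; .assign 6 (.tl (.var 0)) ;; .alg S₁ 7 .nil ;;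
    .assign 3 (.hd (.var 7)) ;; .assign 4 (.tl (.var 7)) ;; .assign 5 (.nth (.var 6) 1) ;;
    .assign 2 (.cons (.var 1) (.tuple [.var 3, .var 5, .nth (.var 6) 0])) ;; .assign 0 .nil
  handler := simHandler S₂
  final := .assign 0 (.var 2)
  perm := 6
  width := 8
  two_lt := by norm_num
  init_vars := by simp [Prog.vars, Expr.vars, Expr.tuple, Expr.nth]
  handler_vars := by simp [simHandler, Prog.vars, Expr.vars, Expr.tuple]
  final_vars := by simp [Prog.vars, Expr.vars]
  two_lt_width := by norm_num

/-- The relation between the variables and the keys for `simReduction`. -/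
def SimRel (D : DAAScheme) (n : ℕ) (pk : Data) (Q : ℕ) (crs : Data) (_ : ℕ) (st : DAAScheme.GameState)
    (s : Store) (z : DAAScheme.GameState) : Prop :=
  (s 0 = .nil ∧ s 1 = Data.unary n ∧ s 3 = crs.hd ∧ s 4 = crs.tl ∧ s 5 = pk) ∧
    st = z ∧ D.GoodState n pk Q z

/-- Only joins need work: the simulator `S₂` needs the statement `(com, pk)`, which the challenger's
answer supplies, and no witness. Hence both games have the same state throughout. -/
theorem simHandler_handles {D : DAAScheme} {l : List PPTAlgorithm} (hkey : D.keyAlg ∈ l)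
    (hjoin : D.joinAlg.toPPT ∈ l) (hsign : D.signAlg ∈ l) {n t a : ℕ} (ha : n + t + 1 ≤ a)
    {pk : Data} (hpk : pk.size ≤ level (growth l D.joinCoins) a 1) (b : Bool)
    (S₂ : PPTAlgorithm) (crs : Data) :
    Handles n (level (growth l D.joinCoins) a 7) t
      (D.proofChallenger n pk b fun x _ => S₂.out n (Data.tuple [crs.hd, crs.tl, x]))
      (D.challenger n pk b) (SimRel D n pk (level (growth l D.joinCoins) a 5) crs)
      (simHandler S₂) := by
  rintro k st s z ⟨⟨h0, h1, h3, h4, h5⟩, rfl, hgood⟩ hk hq g g' hg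
  obtain ⟨hl0, hl1, hl2, hl3, hl4, hl5, hl6⟩ := levels (l := l) (p := D.joinCoins) a
  have hl : level (growth l D.joinCoins) a 0 = a := rfl
  have hsupp : ∀ r ∈ (D.challenger n pk b st (s 2)).support,
      r.1.size ≤ level (growth l D.joinCoins) a 7 ∧
      D.GoodState n pk (level (growth l D.joinCoins) a 5) r.2 := fun r hr =>
    DAAScheme.challenger_support hkey hjoin hsign (by omega) hpk hgood (by omega) hr
  have hpass : (s 2).hd.len ≠ 1 → E (D.proofChallenger n pk b
      (fun x _ => S₂.out n (Data.tuple [crs.hd, crs.tl, x])) st (s 2)) g ≤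
      (Prog.call 2 (.var 2)).wp n (level (growth l D.joinCoins) a 7) (D.challenger n pk b) g' s st := by
    intro h
    refine Prog.le_wp_call hsupp ?_
    rw [DAAScheme.proofChallenger, if_neg (by simpa using h)]
    refine E_mono fun r _ => le_iInf fun hr => ?_
    have := hg r.2 (Function.update s 2 r.1) r.2 ⟨by simp [h0, h1, h3, h4, h5], rfl, hr⟩
    simpa using this
  rw [simHandler, Prog.wp]
  cases h2 : (s 2).hd with
  | nil =>
    rw [if_neg (by simp [Expr.eval, h2])]
    exact hpass (by simp [h2, Data.len])
  | cons c d =>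
    rw [if_pos (by simp [Expr.eval, h2]), Prog.wp]
    cases d with
    | cons d e =>
      rw [if_pos (by simp [Expr.eval, h2])]
      exact hpass (by simp [h2, Data.len])
    | nil =>
      have hlen : ((s 2).nth 0).len = 1 := by simp [h2, Data.len]
      rw [if_neg (by simp [Expr.eval, h2]), Prog.wp]
      refine Prog.le_wp_call hsupp ?_
      rw [DAAScheme.proofChallenger, if_pos hlen, DAAScheme.proofJoin, DAAScheme.challenger, Expr.eval,
        hlen]
      simp only [DAAScheme.joinQuery, E_ite, E_do, E_return]
      split_ifs with hs
      · refine le_iInf fun hr => ?_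
        simp [Prog.wp, Expr.eval]
        have := hg st (Function.update (Function.update s 6 .nil) 2 .nil) st
          ⟨by simp [h0, h1, h3, h4, h5], rfl, hr⟩
        simpa using this
      · refine E_mono fun sk _ => E_mono fun c _ => le_iInf fun hr => ?_
        simp [Prog.wp, Expr.eval, h1, h3, h4, h5, Expr.tuple]
        refine E_mono fun π _ => ?_
        refine le_trans (le_of_eq ?_) (hg _ _ _ ⟨?_, rfl, hr⟩)
        · simp
        · simp [h0, h1, h3, h4, h5]

/-- The index is the output of `S₁`: reference string and trapdoor are drawn once, at the start, and
stay in permanent variables. -/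
theorem simReduction_simulates {D : DAAScheme} {S₁ S₂ : PPTAlgorithm} {l : List PPTAlgorithm}
    (hkey : D.keyAlg ∈ l) (hjoin : D.joinAlg.toPPT ∈ l) (hsign : D.signAlg ∈ l) (hS : S₁ ∈ l)
    {n t a : ℕ} (ha : n + t + 1 ≤ a) {pk sk : Data}
    (hpk : (Data.cons pk sk).size ≤ level (growth l D.joinCoins) a 1) (b : Bool) :
    (simReduction S₁ S₂).Simulates n (level (growth l D.joinCoins) a 7) t
      (level (growth l D.joinCoins) a 8) (S₁.out n .nil)
      (fun crs => D.proofChallenger n pk b fun x _ => S₂.out n (Data.tuple [crs.hd, crs.tl, x]))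
      (SimRel D n pk (level (growth l D.joinCoins) a 5))
      (fun crs => withParam n (Data.tuple [crs.hd, pk, sk])) DAAScheme.GameState.init
      (D.challenger n pk b) (withParam n (Data.tuple [sk, pk])) DAAScheme.GameState.init := by
  obtain ⟨hl0, hl1, hl2, hl3, hl4, hl5, hl6⟩ := levels (l := l) (p := D.joinCoins) a
  have hl7 := level_succ_ge (l := l) (p := D.joinCoins) a 7
  have hl : level (growth l D.joinCoins) a 0 = a := rfl
  simp only [Nat.reduceAdd] at hl7
  simp at hpk
  refine ⟨?_, ?_, ?_, ?_, by omega, by omega, ?_⟩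
  · intro g g' hg
    simp [simReduction, Prog.wp, Expr.eval, start, withParam, Expr.tuple, Expr.nth]
    refine E_mono fun crs hcrs => hg crs hcrs _ _ ⟨?_, rfl, ?_⟩ ?_
    · simp
    · exact DAAScheme.GoodState.init _ _ _ _
    · simp [withParam]
  · exact fun crs _ => simHandler_handles hkey hjoin hsign ha (by omega) b S₂ crs
  · rintro crs k st s s' z h ⟨⟨h0, h1, h3, h4, h5⟩, h6⟩
    refine ⟨?_, h6⟩
    simp only [simReduction] at h
    rw [h 0, h 1, h 3, h 4, h 5]
    · exact ⟨h0, h1, h3, h4, h5⟩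
    all_goals norm_num
  · rintro crs hcrs k st s z ⟨⟨h0, h1, h3, h4, h5⟩, -⟩ hk i hi hi2
    have hc : crs.size ≤ level (growth l D.joinCoins) a 1 :=
      size_out_le_level hS hcrs (by simp; omega)
    have := crs.size_hd_le
    have := crs.size_tl_le
    simp only [simReduction] at hi
    interval_cases i
    · simp [h0]; omega
    · simp [h1, size_unary]; omega
    · omega
    · simp [h3]; omega
    · simp [h4]; omega
    · simp [h5]; omega
  · simp [size_withParam]; omega

end Troll

namespace Troll

open scoped ENNReal

/-! ## Association lists -/

theorem assoc_cons (k v l k' : Data) :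
    assoc (.cons (.cons k v) l) k' = if k = k' then v else assoc l k' := rfl

/-- A new entry shadows the older ones, so a table is updated by pushing. As `nil` is also the code
of `none`, deletion is an update too. -/
theorem assoc_update {α : Type} {F : α → Data} {f : Data → α} {l : Data}
    (h : ∀ k, assoc l k = F (f k)) (k : Data) (v : α) (k' : Data) :
    assoc (.cons (.cons k (F v)) l) k' = F (Function.update f k v k') := by
  rw [assoc_cons]
  split_ifs with hk
  · subst hk; simp
  · rw [Function.update_of_ne (Ne.symm hk), h]

/-- The program that stores the normal form of the code of an optional value. -/
def Prog.normOpt (x : ℕ) (e : Expr) : Prog :=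
  .cond e (.assign x (.cons .nil (.tl e))) (.assign x .nil)

/-- `Data.toOpt` ignores the head of a pair, so several values denote the same basename; as part of
a key in a table it needs a unique code. -/
theorem Prog.wp_normOpt {σ : Type} (N cap : ℕ) (O : σ → Data → PMF (Data × σ)) (x : ℕ) (e : Expr)
    (g : Store → σ → ℝ≥0∞) (s : Store) (z : σ) :
    (normOpt x e).wp N cap O g s z = g (Function.update s x (Data.opt (e.eval s).toOpt)) z := by
  rw [normOpt, wp, wp, wp]
  cases h : e.eval s <;> simp [Expr.eval, h, Data.toOpt]

theorem Data.opt_injective : Function.Injective Data.opt := by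
  intro a b h
  cases a <;> cases b <;> simp_all

/-! ## The reduction to zero-knowledge -/

/-- The tables in which the distinguisher for the proof system keeps the state of the challenger. -/
structure ChallengerTables (st : DAAScheme.GameState) (C k : ℕ)
    (x₁ x₂ x₃ x₄ x₅ : Data) : Prop where
  sessions : ∀ S, assoc x₁ S = Data.opt (st.sessions S)
  signers : ∀ S, assoc x₂ S = Data.opt ((st.signers S).map fun u => .cons u.1 u.2)
  corrupted : ∀ S, assoc x₃ S = Data.bit (decide (S ∈ st.corrupted))
  signed : ∀ S dom, assoc x₄ (.cons S (Data.opt dom)) = Data.bit (decide ((S, dom) ∈ st.signed))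
  challenge : x₅ = Data.opt (st.challenge.map fun c => Data.tuple [c.1, c.2.1, Data.opt c.2.2])
  size_sessions : x₁.size ≤ 1 + k * C
  size_signers : x₂.size ≤ 1 + k * C
  size_corrupted : x₃.size ≤ 1 + k * C
  size_signed : x₄.size ≤ 1 + k * C
  size_challenge : x₅.size ≤ C

namespace ChallengerTables

variable {st : DAAScheme.GameState} {C k : ℕ} {x₁ x₂ x₃ x₄ x₅ : Data}

theorem init (hC : 1 ≤ C) : ChallengerTables .init C 0 .nil .nil .nil .nil .nil := by
  refine ⟨?_, ?_, ?_, ?_, ?_, ?_, ?_, ?_, ?_, ?_⟩ <;> simp [DAAScheme.GameState.init, assoc, hC, Data.bit]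

theorem mono (h : ChallengerTables st C k x₁ x₂ x₃ x₄ x₅) :
    ChallengerTables st C (k + 1) x₁ x₂ x₃ x₄ x₅ := by
  obtain ⟨h1, h2, h3, h4, h5, h6, h7, h8, h9, h10⟩ := h
  exact ⟨h1, h2, h3, h4, h5, by linarith, by linarith, by linarith, by linarith, h10⟩

theorem setSession (h : ChallengerTables st C k x₁ x₂ x₃ x₄ x₅) {S : Data} {v : Option Data}
    (hC : S.size + (Data.opt v).size + 2 ≤ C) :
    ChallengerTables { st with sessions := Function.update st.sessions S v } C (k + 1)
      (.cons (.cons S (Data.opt v)) x₁) x₂ x₃ x₄ x₅ := by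
  obtain ⟨h1, h2, h3, h4, h5, h6, h7, h8, h9, h10⟩ := h
  refine ⟨fun S' => assoc_update h1 S v S', h2, h3, h4, h5, ?_, by linarith, by linarith, by linarith,
    h10⟩
  simp only [Data.size_cons]
  linarith

theorem accept (h : ChallengerTables st C k x₁ x₂ x₃ x₄ x₅) {S : Data} {u : Data × Data}
    (hC : S.size + u.1.size + u.2.size + 6 ≤ C) :
    ChallengerTables { st with
        sessions := Function.update st.sessions S none
        signers := Function.update st.signers S (some u) } C (k + 1)
      (.cons (.cons S .nil) x₁) (.cons (.cons S (.cons .nil (.cons u.1 u.2))) x₂) x₃ x₄ x₅ := by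
  obtain ⟨h1, h2, h3, h4, h5, h6, h7, h8, h9, h10⟩ := h
  refine ⟨fun S' => assoc_update h1 S none S', fun S' => assoc_update
    (F := fun v : Option (Data × Data) => Data.opt (v.map fun w : Data × Data => Data.cons w.1 w.2)) h2 S (some u) S',
    h3, h4, h5, ?_, ?_, by linarith, by linarith, h10⟩
  all_goals
    simp only [Data.size_cons, Data.size_nil]
    linarith

theorem corrupt (h : ChallengerTables st C k x₁ x₂ x₃ x₄ x₅) {S : Data} (hC : S.size + 5 ≤ C) :
    ChallengerTables { st with corrupted := insert S st.corrupted } C (k + 1)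
      x₁ x₂ (.cons (.cons S (.cons .nil .nil)) x₃) x₄ x₅ := by
  obtain ⟨h1, h2, h3, h4, h5, h6, h7, h8, h9, h10⟩ := h
  refine ⟨h1, h2, fun S' => ?_, h4, h5, by linarith, by linarith, ?_, by linarith, h10⟩
  · rw [assoc_cons, h3]
    by_cases hS : S = S' <;> simp [hS, eq_comm, Data.bit]
  · simp only [Data.size_cons, Data.size_nil]
    linarith

/-- The keys of this table are pairs; injectivity of `Data.opt` ensures that different pairs `(S,
dom)` have different codes. -/
theorem sign (h : ChallengerTables st C k x₁ x₂ x₃ x₄ x₅) {S : Data} {dom : Option Data}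
    (hC : S.size + (Data.opt dom).size + 6 ≤ C) :
    ChallengerTables { st with signed := insert (S, dom) st.signed } C (k + 1)
      x₁ x₂ x₃ (.cons (.cons (.cons S (Data.opt dom)) (.cons .nil .nil)) x₄) x₅ := by
  obtain ⟨h1, h2, h3, h4, h5, h6, h7, h8, h9, h10⟩ := h
  refine ⟨h1, h2, h3, fun S' dom' => ?_, h5, by linarith, by linarith, by linarith, ?_, h10⟩
  · rw [assoc_cons, h4]
    by_cases hS : (S', dom') = (S, dom)
    · simp only [Prod.mk.injEq] at hS
      simp [hS, Data.bit]
    · have : ¬ Data.cons S (Data.opt dom) = Data.cons S' (Data.opt dom') := fun h' => hS <| by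
        injection h' with h₁ h₂
        rw [h₁, Data.opt_injective h₂]
      simp only [if_neg this, Finset.mem_insert, hS, false_or]
  · simp only [Data.size_cons, Data.size_nil]
    linarith

theorem setChallenge (h : ChallengerTables st C k x₁ x₂ x₃ x₄ x₅) {S₀ S₁ : Data} {dom : Option Data}
    (hC : S₀.size + S₁.size + (Data.opt dom).size + 6 ≤ C) :
    ChallengerTables { st with challenge := some (S₀, S₁, dom) } C (k + 1)
      x₁ x₂ x₃ x₄ (.cons .nil (Data.tuple [S₀, S₁, Data.opt dom])) := by
  obtain ⟨h1, h2, h3, h4, h5, h6, h7, h8, h9, h10⟩ := h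
  refine ⟨h1, h2, h3, h4, rfl, by linarith, by linarith, by linarith, by linarith, ?_⟩
  simp
  linarith

end ChallengerTables

namespace TrollThrottle

variable (T : TrollThrottle)

/-- Entry number `i` of the query that a handler has to answer. -/
def queryArg (i : ℕ) : Expr := .nth (.var 2) i

theorem eval_queryArg (s : Store) (i : ℕ) : (queryArg i).eval s = (s 2).nth i :=
  Expr.eval_nth _ _ _

/-- The handler for signatures. -/
noncomputable def zkSign : Prog :=
  .lookup 10 (.var 6) (queryArg 1) ;;
    .cond (.var 10)
      (.normOpt 11 (queryArg 2) ;;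
        .alg T.daa.signAlg 12
          (.tuple [.var 3, .hd (.tl (.var 10)), .tl (.tl (.var 10)), .var 11, queryArg 3]) ;;
        .assign 8 (.cons (.cons (.cons (queryArg 1) (.var 11)) (.cons .nil .nil)) (.var 8)) ;;
        .assign 2 (.cons .nil (.var 12)))
      (.assign 2 .nil)

/-- The handler for the first half of joins. -/
noncomputable def zkJoin : Prog :=
  .lookup 10 (.var 6) (queryArg 1) ;;
    .cond (.var 10) (.assign 2 .nil)
      (.alg T.daa.keyAlg 11 (.var 3) ;; .coins 12 T.daa.joinCoins ;;
        .alg T.daa.joinAlg.toPPT 13 (.tuple [.var 3, .var 11, .var 12]) ;;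
        .call 14 (.tuple [.tuple [.var 13, .var 3], .tuple [.var 11, .var 12]]) ;;
        .assign 5 (.cons (.cons (queryArg 1) (.cons .nil (.var 11))) (.var 5)) ;;
        .assign 2 (.cons .nil (.tuple [.var 13, .tl (.var 14)])))

/-- The handler for the second half of joins. -/
noncomputable def zkCred : Prog :=
  .lookup 10 (.var 5) (queryArg 1) ;; .lookup 11 (.var 6) (queryArg 1) ;;
    .cond (.var 10)
      (.alg T.daa.checkAlg.toPPT 12 (.tuple [.var 3, .tl (.var 10), queryArg 2]) ;;
        .assign 5 (.cons (.cons (queryArg 1) .nil) (.var 5)) ;;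
        .cond (.var 11) (.assign 2 .nil)
          (.cond (.var 12)
            (.assign 6 (.cons (.cons (queryArg 1) (.cons .nil
              (.cons (.tl (.var 10)) (queryArg 2)))) (.var 6)) ;;
              .assign 2 (.cons .nil (.cons .nil .nil)))
            (.assign 2 .nil)))
      (.assign 2 .nil)

/-- The handler for corruptions. -/
def zkCorrupt : Prog :=
  .lookup 10 (.var 6) (queryArg 1) ;;
    .cond (.var 10)
      (.assign 7 (.cons (.cons (queryArg 1) (.cons .nil .nil)) (.var 7)) ;;
        .assign 2 (.cons .nil (.hd (.tl (.var 10)))))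
      (.assign 2 .nil)

/-- The handler for the challenge. -/
noncomputable def zkChallenge : Prog :=
  .lookup 10 (.var 6) (queryArg 1) ;; .lookup 11 (.var 6) (queryArg 2) ;;
    .normOpt 12 (queryArg 3) ;;
    .cond (.var 9) (.assign 2 .nil) (.cond (.var 10) (.cond (.var 11)
      (.cond (.var 4) (.assign 13 (.tl (.var 11))) (.assign 13 (.tl (.var 10))) ;;
        .alg T.daa.signAlg 14
          (.tuple [.var 3, .hd (.var 13), .tl (.var 13), .var 12, queryArg 4]) ;;
        .assign 9 (.cons .nil (.tuple [queryArg 1, queryArg 2, .var 12])) ;;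
        .assign 2 (.cons .nil (.var 14)))
      (.assign 2 .nil)) (.assign 2 .nil))

/-- A handler that implements the challenger of user-controlled anonymity with an oracle for proofs.
Variable `3` contains the key of the issuer, variable `4` the bit, and the variables `5` to `9`
contain the state of the challenger. -/
noncomputable def zkHandler : Prog :=
  .dispatch (.assign 2 .nil) [T.zkSign, T.zkJoin, T.zkCred, zkCorrupt, T.zkChallenge] (queryArg 0)

/-- The program that decides whether the game of user-controlled anonymity is won. -/
def zkFinal : Prog :=
  .lookup 10 (.var 7) (.nth (.tl (.var 9)) 0) ;; .lookup 11 (.var 7) (.nth (.tl (.var 9)) 1) ;;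
  .lookup 12 (.var 8) (.cons (.nth (.tl (.var 9)) 0) (.nth (.tl (.var 9)) 2)) ;;
  .lookup 13 (.var 8) (.cons (.nth (.tl (.var 9)) 1) (.nth (.tl (.var 9)) 2)) ;;
  .cond (.nth (.tl (.var 9)) 2) (.assign 0 .nil) (.assign 12 .nil ;; .assign 13 .nil) ;;
  .cond (.var 2) (.assign 14 (.cons .nil .nil)) (.assign 14 .nil) ;;
  .cond (.var 10) (.assign 0 .nil) (.cond (.var 11) (.assign 0 .nil) (.cond (.var 12) (.assign 0 .nil)
    (.cond (.var 13) (.assign 0 .nil) (.cond (.var 9) (.assign 0 (.eq (.var 14) (.var 4)))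
      (.assign 0 .nil)))))

/-- The reduction that plays the challenger of user-controlled anonymity with the proofs of an oracle. -/
noncomputable def zkReduction : Reduction where
  init := .assign 1 (.hd (.var 0)) ;; .assign 11 (.tl (.var 0)) ;; .alg T.daa.setupAlg 10 .nil ;;
    .assign 3 (.hd (.var 10)) ;; .flip 4 ;;
    .assign 2 (.cons (.var 1) (.tuple [.var 11, .hd (.var 10), .tl (.var 10)])) ;; .assign 0 .nil
  handler := T.zkHandler
  final := zkFinal
  perm := 10
  width := 15
  two_lt := by norm_num
  init_vars := by simp [Prog.vars, Expr.vars, Expr.tuple]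
  handler_vars := by
    simp [zkHandler, zkSign, zkJoin, zkCred, zkCorrupt, zkChallenge, Prog.vars, Expr.vars, Expr.tuple, Expr.nth, Prog.dispatch, Prog.normOpt, queryArg]
  final_vars := by simp [zkFinal, Prog.vars, Expr.vars, Expr.nth]
  two_lt_width := by norm_num

/-- The relation between the variables and the state of the challenger for `zkReduction`. -/
def ZKRel (n : ℕ) (pk : Data) (b : Bool) (C k : ℕ) (st : DAAScheme.GameState) (s : Store)
    (_ : Unit) : Prop :=
  (s 0 = .nil ∧ s 1 = Data.unary n ∧ s 3 = pk ∧ s 4 = Data.bit b) ∧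
    ChallengerTables st C k (s 5) (s 6) (s 7) (s 8) (s 9)

variable {T} {l : List PPTAlgorithm} {n t a : ℕ} {pk : Data} {b : Bool}

local notation "L" => level (growth l (DAAScheme.joinCoins (TrollThrottle.daa T))) a

theorem ZKRel.le_of_nil {C k : ℕ} {st : DAAScheme.GameState} {s s' : Store} {z : Unit}
    (h : ZKRel n pk b C k st s z) {g : Data × DAAScheme.GameState → ℝ≥0∞} {g' : Store → Unit → ℝ≥0∞}
    (hg : ∀ st' s' z', ZKRel n pk b C (k + 1) st' s' z' → g (s' 2, st') ≤ g' s' z')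
    (hs : s' 0 = s 0 ∧ s' 1 = s 1 ∧ s' 3 = s 3 ∧ s' 4 = s 4 ∧ s' 5 = s 5 ∧ s' 6 = s 6 ∧ s' 7 = s 7 ∧
      s' 8 = s 8 ∧ s' 9 = s 9) (h2 : s' 2 = .nil) : g (.nil, st) ≤ g' s' z := by
  obtain ⟨⟨h0, h1, h3, h4⟩, htab⟩ := h
  have := hg st s' z ⟨by simp [hs, h0, h1, h3, h4], by simpa [hs] using htab.mono⟩
  rwa [h2] at this

/-! ### The challenger's queries, answered one by one by the distinguisher -/

section

variable {cap C k : ℕ} {st : DAAScheme.GameState} {s : Store} {z : Unit}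
  {g : Data × DAAScheme.GameState → ℝ≥0∞} {g' : Store → Unit → ℝ≥0∞}

theorem le_wp_zkSign {O : Unit → Data → PMF (Data × Unit)} (h : ZKRel n pk b C k st s z)
    (hC : 20 * (s 2).size ≤ C)
    (hg : ∀ st' s' z', ZKRel n pk b C (k + 1) st' s' z' → g (s' 2, st') ≤ g' s' z') :
    E (T.daa.signQuery n pk ((s 2).nth 1) ((s 2).nth 2).toOpt ((s 2).nth 3) st) g ≤
      T.zkSign.wp n cap O g' s z := by
  have ⟨⟨h0, h1, h3, h4⟩, htab⟩ := h
  have hS := (s 2).size_nth_le 1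
  have hd := (Data.size_opt_toOpt_le _).trans ((s 2).size_nth_le 2)
  have := (s 2).one_le_size
  simp at hS hd
  simp only [zkSign, DAAScheme.signQuery, Prog.wp, Prog.wp_normOpt, eval_queryArg, Expr.eval,
    htab.signers]
  cases hu : st.signers ((s 2).nth 1) with
  | none =>
    rw [E_return]
    exact h.le_of_nil hg (by simp) (by simp)
  | some u =>
    simp only [E_do, E_return, DAAScheme.sign]
    simp [h1, h3, Expr.tuple, Expr.eval, eval_queryArg]
    refine E_mono fun σ _ => le_trans (le_of_eq ?_) (hg _ _ z ⟨?_, htab.sign (by omega)⟩)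
    · simp
    · simp [h0, h1, h3, h4]

/-- The distinguisher plays the user and so holds a witness `(sk, r)` of the statement that it
sends; the oracle therefore never answers `⊥`. As `prove` is arbitrary up to the sizes of proofs,
honest and simulated proofs are covered at once. -/
theorem le_wp_zkJoin {prove : Data → Data → PMF Data} (h : ZKRel n pk b C k st s z)
    (hC : 20 * (s 2).size + 20 ≤ C)
    (hkey : ∀ sk ∈ (T.daa.userKey n pk).support, 20 * sk.size ≤ C)
    (hprove : ∀ sk ∈ (T.daa.userKey n pk).support, ∀ r ∈ (coins (T.daa.joinCoins.eval n)).support,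
      ∀ π ∈ (prove (Data.tuple [T.daa.join n pk sk r, pk]) (Data.tuple [sk, Data.bits r])).support,
      π.size + 2 ≤ cap)
    (hg : ∀ st' s' z', ZKRel n pk b C (k + 1) st' s' z' → g (s' 2, st') ≤ g' s' z') :
    E (T.daa.proofJoin n pk prove ((s 2).nth 1) st) g ≤
      T.zkJoin.wp n cap (ProofSystem.proofOracle (T.joinRelation n) prove) g' s z := by
  have ⟨⟨h0, h1, h3, h4⟩, htab⟩ := h
  have hS := (s 2).size_nth_le 1
  simp at hS
  simp only [zkJoin, DAAScheme.proofJoin, Prog.wp, eval_queryArg, Expr.eval, htab.signers]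
  cases hu : st.signers ((s 2).nth 1) with
  | some u =>
    simp only [Option.isSome_some, if_true, E_return]
    exact h.le_of_nil hg (by simp) (by simp)
  | none =>
    simp only [Option.isSome_none, Bool.false_eq_true, if_false, E_do, E_return]
    simp [h1, h3, Expr.tuple, Expr.eval, PTAlgorithm.out_toPPT, E_pure]
    refine E_mono fun sk hsk => E_mono fun r hr => ?_
    have hrel : T.joinRelation n (Data.tuple [T.daa.join n pk sk r, pk]) (Data.tuple [sk, Data.bits r]) :=
      ⟨_, _, _, r, length_of_mem_coins hr, rfl, rfl, rfl⟩
    have hk := hkey sk hsk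
    simp [DAAScheme.join] at hrel
    rw [ProofSystem.proofOracle]
    simp [hrel, E_map]
    refine E_mono fun π hπ => ?_
    rw [if_pos (by have := hprove sk hsk r hr π (by simpa using hπ); omega)]
    refine le_trans (le_of_eq ?_) (hg _ _ z ⟨?_, htab.setSession (v := some sk) (by simp; omega)⟩)
    · simp [DAAScheme.join]
    · simp [h0, h1, h3, h4]

/-- An open session is closed whether or not the credential is accepted, so the session table is
updated before the outcome is tested. -/
theorem le_wp_zkCred {O : Unit → Data → PMF (Data × Unit)} (h : ZKRel n pk b C k st s z)
    (hC : 20 * (s 2).size + 20 ≤ C)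
    (hkey : ∀ S sk, st.sessions S = some sk → 20 * sk.size ≤ C)
    (hg : ∀ st' s' z', ZKRel n pk b C (k + 1) st' s' z' → g (s' 2, st') ≤ g' s' z') :
    E (T.daa.credQuery n pk ((s 2).nth 1) ((s 2).nth 2) st) g ≤ T.zkCred.wp n cap O g' s z := by
  have ⟨⟨h0, h1, h3, h4⟩, htab⟩ := h
  have hS := (s 2).size_nth_le 1
  have hc := (s 2).size_nth_le 2
  simp at hS hc
  simp only [zkCred, DAAScheme.credQuery, Prog.wp, eval_queryArg, Expr.eval]
  simp [-Data.nth_succ, htab.signers, htab.sessions]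
  cases hu : st.sessions ((s 2).nth 1) with
  | none =>
    rw [E_return]
    exact h.le_of_nil hg (by simp) (by simp)
  | some sk =>
    have hk := hkey _ _ hu
    have hleave := htab.setSession (S := (s 2).nth 1) (v := none) (by simp; omega)
    simp [-Data.nth_succ, h1, h3, Expr.tuple, Expr.eval, eval_queryArg, PTAlgorithm.out_toPPT, E_pure]
    have hcheck : T.daa.check n pk sk ((s 2).nth 2) = (T.daa.checkAlg.out n
      (pk.cons (sk.cons (((s 2).nth 2).cons Data.nil)))).toBool := rfl
    cases hv : st.signers ((s 2).nth 1) with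
    | some u =>
      rw [if_neg (by simp), E_return]
      refine le_trans (le_of_eq ?_) (hg _ _ z ⟨?_, hleave⟩)
      · simp
      · simp [h0, h1, h3, h4]
    | none =>
      simp [-Data.nth_succ, hcheck]
      split_ifs with hok
      · rw [E_return]
        refine le_trans (le_of_eq ?_) (hg _ _ z ⟨?_, htab.accept (u := (sk, (s 2).nth 2)) ?_⟩)
        · simp [Data.bit]
        · simp [h0, h1, h3, h4]
        · simp; omega
      · rw [E_return]
        refine le_trans (le_of_eq ?_) (hg _ _ z ⟨?_, hleave⟩)
        · simp
        · simp [h0, h1, h3, h4]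

theorem le_wp_zkCorrupt {O : Unit → Data → PMF (Data × Unit)} (h : ZKRel n pk b C k st s z)
    (hC : 20 * (s 2).size + 20 ≤ C)
    (hg : ∀ st' s' z', ZKRel n pk b C (k + 1) st' s' z' → g (s' 2, st') ≤ g' s' z') :
    E (DAAScheme.corruptQuery ((s 2).nth 1) st) g ≤ zkCorrupt.wp n cap O g' s z := by
  have ⟨⟨h0, h1, h3, h4⟩, htab⟩ := h
  have hS := (s 2).size_nth_le 1
  simp at hS
  simp only [zkCorrupt, DAAScheme.corruptQuery, Prog.wp, eval_queryArg, Expr.eval, htab.signers]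
  cases hu : st.signers ((s 2).nth 1) with
  | none =>
    rw [E_return]
    exact h.le_of_nil hg (by simp) (by simp)
  | some u =>
    simp [E_return]
    refine le_trans (le_of_eq ?_) (hg _ _ z ⟨?_, htab.corrupt (by omega)⟩)
    · simp
    · simp [h0, h1, h3, h4]

theorem le_wp_zkChallenge {O : Unit → Data → PMF (Data × Unit)} (h : ZKRel n pk b C k st s z)
    (hC : 20 * (s 2).size + 20 ≤ C)
    (hg : ∀ st' s' z', ZKRel n pk b C (k + 1) st' s' z' → g (s' 2, st') ≤ g' s' z') :
    E (T.daa.challengeQuery n pk b ((s 2).nth 1) ((s 2).nth 2) ((s 2).nth 3).toOpt ((s 2).nth 4) st) g ≤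
      T.zkChallenge.wp n cap O g' s z := by
  have ⟨⟨h0, h1, h3, h4⟩, htab⟩ := h
  have hS₀ := (s 2).size_nth_le 1
  have hS₁ := (s 2).size_nth_le 2
  have hd := (Data.size_opt_toOpt_le _).trans ((s 2).size_nth_le 3)
  simp at hS₀ hS₁ hd
  simp only [zkChallenge, DAAScheme.challengeQuery, Prog.wp, Prog.wp_normOpt, eval_queryArg, Expr.eval]
  simp [-Data.nth_succ, -bind_pure_comp, htab.signers, htab.challenge, h4]
  cases hc : st.challenge with
  | some c =>
    simp only [E_return]
    exact h.le_of_nil hg (by simp) (by simp)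
  | none =>
    cases hu₀ : st.signers ((s 2).nth 1) with
    | none =>
      simp only [E_return]
      exact h.le_of_nil hg (by simp) (by simp)
    | some u₀ =>
      cases hu₁ : st.signers ((s 2).nth 2) with
      | none =>
        simp only [E_return]
        exact h.le_of_nil hg (by simp) (by simp)
      | some u₁ =>
        simp only [E_do, E_return, DAAScheme.sign]
        cases b <;>
        · simp [h1, h3, Expr.tuple, Expr.eval, eval_queryArg]
          refine E_mono fun σ _ => le_trans (le_of_eq ?_) (hg _ _ z ⟨?_, htab.setChallenge (S₀ := (s 2).nth 1)
            (S₁ := (s 2).nth 2) (dom := ((s 2).nth 3).toOpt) ?_⟩)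
          · simp
          · simp [h0, h1, h3, h4]
          · simp; omega

/-- An equality, since the verdict is used in both directions. For the basename `⊥` the entries on
signatures are ignored; without a challenge, variable `9` is `nil` and the verdict is `0`. -/
theorem wp_zkFinal {O : Unit → Data → PMF (Data × Unit)} (h : ZKRel n pk b C k st s z)
    (ψ : Data → ℝ≥0∞) : zkFinal.wp n cap O (fun s _ => ψ (s 0)) s z =
      ψ (Data.bit (open Classical in decide (DAAScheme.Wins b (some (s 2), st)))) := by
  classical
  obtain ⟨⟨h0, h1, h3, h4⟩, htab⟩ := h
  simp only [zkFinal, Prog.wp, Expr.eval, Expr.nth]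
  cases hc : st.challenge with
  | none =>
    simp [htab.challenge, hc, htab.corrupted, DAAScheme.Wins]
    rfl
  | some c =>
    obtain ⟨S₀, S₁, dom⟩ := c
    cases dom with
    | none =>
      have hW : DAAScheme.Wins b (some (s 2), st) ↔
          (s 2).toBool = b ∧ S₀ ∉ st.corrupted ∧ S₁ ∉ st.corrupted := by
        simp [DAAScheme.Wins, hc]
      simp [htab.challenge, hc, htab.corrupted, hW]
      rw [h4]
      cases b <;> cases (s 2).toBool <;> by_cases c₀ : S₀ ∈ st.corrupted <;>
        by_cases c₁ : S₁ ∈ st.corrupted <;> simp [c₀, c₁, Data.bit]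
    | some dom =>
      have hW : DAAScheme.Wins b (some (s 2), st) ↔
          (s 2).toBool = b ∧ S₀ ∉ st.corrupted ∧ S₁ ∉ st.corrupted ∧
            (S₀, some dom) ∉ st.signed ∧ (S₁, some dom) ∉ st.signed := by
        simp [DAAScheme.Wins, hc]
      have e₀ := htab.signed S₀ (some dom)
      have e₁ := htab.signed S₁ (some dom)
      simp at e₀ e₁
      simp [htab.challenge, hc, htab.corrupted, hW, e₀, e₁]
      rw [h4]
      cases b <;> cases (s 2).toBool <;> by_cases c₀ : S₀ ∈ st.corrupted <;>
        by_cases c₁ : S₁ ∈ st.corrupted <;> by_cases d₀ : (S₀, some dom) ∈ st.signed <;>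
        by_cases d₁ : (S₁, some dom) ∈ st.signed <;> simp [c₀, c₁, d₀, d₁, Data.bit]

end

theorem zkHandler_handles (hkey : T.daa.keyAlg ∈ l)
    (hjoin : T.daa.joinAlg.toPPT ∈ l) (hsign : T.daa.signAlg ∈ l) (ha : n + t + 1 ≤ a)
    (hpk : pk.size ≤ L 1) (b : Bool) {prove : Data → Data → PMF Data}
    (hprove : ∀ x w π, x.size + w.size ≤ 10 * L 3 + 10 → π ∈ (prove x w).support → π.size ≤ L 6) :
    Handles n (L 7) t (T.daa.proofChallenger n pk b prove)
      (ProofSystem.proofOracle (T.joinRelation n) prove)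
      (fun k st s z => T.daa.GoodState n pk (L 5) st ∧ ZKRel n pk b (L 6) k st s z) T.zkHandler := by
  obtain ⟨hl0, hl1, hl2, hl3, hl4, hl5, hl6⟩ := levels (l := l) (p := T.daa.joinCoins) a
  have hl : L 0 = a := rfl
  refine Handles.of_invariant (fun st q hst hq r hr => (DAAScheme.proofChallenger_support hkey hjoin
    hsign (by omega) hpk hprove hst (by omega) hr).2) ?_
  intro k st s z h hst hk hq g g' hg
  have hks : ∀ sk ∈ (T.daa.userKey n pk).support, sk.size ≤ L 2 := fun sk hsk =>
    DAAScheme.size_key_le hkey (by omega) hpk hsk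
  rw [zkHandler, Prog.wp_dispatch, eval_queryArg, DAAScheme.proofChallenger, DAAScheme.challenger]
  match hlen : ((s 2).nth 0).len with
  | 0 => exact le_wp_zkSign h (by omega) hg
  | 1 =>
    refine le_wp_zkJoin h (by omega) (fun sk hsk => ?_) (fun sk hsk r hr π hπ => ?_) hg
    · have := hks sk hsk
      omega
    · have h1 := hks sk hsk
      have h2 := DAAScheme.size_join_le hkey hjoin (by omega) hpk hsk hr
      have := hprove _ _ π (by simp; omega) hπ
      omega
  | 2 =>
    refine le_wp_zkCred h (by omega) (fun S sk hsk => ?_) hg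
    have := hks sk (hst.session S sk hsk)
    omega
  | 3 => exact le_wp_zkCorrupt h (by omega) hg
  | 4 => exact le_wp_zkChallenge h (by omega) hg
  | m + 5 =>
    change E (pure (Data.opt none, st)) g ≤ g' (Function.update s 2 .nil) z
    rw [E_return]
    exact h.le_of_nil hg (by simp) (by simp)

/-- The index consists of the issuer's keys and the bit, which the distinguisher draws itself. A
query adds at most `L 6` to each table, whence the term `t * L 6`. -/
theorem zkReduction_simulates (hsetup : T.daa.setupAlg ∈ l) (hkey : T.daa.keyAlg ∈ l)
    (hjoin : T.daa.joinAlg.toPPT ∈ l) (hsign : T.daa.signAlg ∈ l) (ha : n + t + 1 ≤ a) {ρ : Data}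
    (hρ : ρ.size ≤ L 1) {prove : Data → Data → PMF Data}
    (hprove : ∀ x w π, x.size + w.size ≤ 10 * L 3 + 10 → π ∈ (prove x w).support → π.size ≤ L 6)
    {B : ℕ} (hB : t * L 6 + L 8 ≤ B) :
    T.zkReduction.Simulates n (L 7) t B
      (T.daa.setup n >>= fun k => PMF.uniformOfFintype Bool >>= fun b => pure (k, b))
      (fun i => T.daa.proofChallenger n i.1.1 i.2 prove)
      (fun i k st s z => T.daa.GoodState n i.1.1 (L 5) st ∧ ZKRel n i.1.1 i.2 (L 6) k st s z)
      (fun i => withParam n (Data.tuple [ρ, i.1.1, i.1.2])) DAAScheme.GameState.init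
      (ProofSystem.proofOracle (T.joinRelation n) prove) (withParam n ρ) () := by
  obtain ⟨hl0, hl1, hl2, hl3, hl4, hl5, hl6⟩ := levels (l := l) (p := T.daa.joinCoins) a
  have hl7 := level_succ_ge (l := l) (p := T.daa.joinCoins) a 7
  have hl : L 0 = a := rfl
  simp only [Nat.reduceAdd] at hl7
  have hpk : ∀ i ∈ (T.daa.setup n >>= fun k => PMF.uniformOfFintype Bool >>= fun b =>
      pure (k, b)).support, i.1.1.size ≤ L 1 := by
    intro i hi
    obtain ⟨k, hk, hi⟩ := mem_support_do.1 hi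
    obtain ⟨b, -, hi⟩ := mem_support_do.1 hi
    rw [mem_support_return] at hi
    subst hi
    obtain ⟨x, hx, rfl⟩ := (PMF.mem_support_map_iff _ _ _).1 hk
    exact x.size_hd_le.trans (size_out_le_level hsetup hx (by simp; omega))
  refine ⟨?_, ?_, ?_, ?_, by omega, by omega, ?_⟩
  · intro g g' hg
    simp only [E_do, E_return, DAAScheme.setup, E_map]
    simp [zkReduction, Prog.wp, Expr.eval, start, withParam, Expr.tuple]
    refine E_mono fun k hk => E_mono fun b hb => ?_
    refine hg ((k.hd, k.tl), b) ?_ _ _ ⟨DAAScheme.GoodState.init _ _ _ _, ⟨?_, ?_⟩⟩ ?_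
    · exact mem_support_do.2 ⟨(k.hd, k.tl), (PMF.mem_support_map_iff _ _ _).2 ⟨k, hk, rfl⟩,
        mem_support_do.2 ⟨b, hb, mem_support_return.2 rfl⟩⟩
    · simp
    · simpa using ChallengerTables.init (by omega)
    · simp [withParam]
  · exact fun i hi => zkHandler_handles hkey hjoin hsign ha (hpk i hi) i.2 hprove
  · rintro i k st s s' z h ⟨h5, ⟨⟨h0, h1, h3, h4⟩, htab⟩⟩
    simp only [zkReduction] at h
    refine ⟨h5, ⟨?_, ?_⟩⟩
    · rw [h 0, h 1, h 3, h 4]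
      · exact ⟨h0, h1, h3, h4⟩
      all_goals norm_num
    · rw [h 5, h 6, h 7, h 8, h 9]
      · exact htab
      all_goals norm_num
  · rintro i hi k st s z ⟨-, ⟨⟨h0, h1, h3, h4⟩, htab⟩⟩ hk j hj hj2
    have := hpk i hi
    have hkt : k * L 6 ≤ t * L 6 := Nat.mul_le_mul_right _ hk
    have := htab.size_sessions
    have := htab.size_signers
    have := htab.size_corrupted
    have := htab.size_signed
    have := htab.size_challenge
    have := Data.size_bit_le i.2
    simp only [zkReduction] at hj
    interval_cases j
    · simp [h0]; omega
    · simp [h1, size_unary]; omega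
    · omega
    · rw [h3]; omega
    · rw [h4]; omega
    all_goals omega
  · simp [size_withParam]; omega

end TrollThrottle

end Troll

namespace Troll

open scoped ENNReal

namespace TrollThrottle

/-! ## The game of anonymity and the challenger of user-controlled anonymity -/

/-- The code of the status of a user: corrupted, honest, or neither. -/
def GameState.status (st : GameState) (U : Data) : Data :=
  if U ∈ st.CU then .cons .nil (.cons .nil .nil) else if U ∈ st.HU then .cons .nil .nil else .nil

/-- The identity of the user that joins for the challenge. -/
def freshId : Data := .cons (Data.unary 2) .nil

/-- A user `U` is represented by the identity `(tag, U)`, where `tag` is a value of size at most `3`. -/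
structure UserTables (T : TrollThrottle) (n : ℕ) (pk : Data) (Q C k : ℕ) (st : GameState)
    (z : DAAScheme.GameState) (users status chosen flag : Data) : Prop where
  good : T.daa.GoodState n pk Q z
  disjoint : ∀ U ∈ st.CU, U ∉ st.HU
  status_eq : ∀ U, assoc status U = st.status U
  user : ∀ U u, st.USK U = some u → ∃ tag : Data, tag.size ≤ 3 ∧
    assoc users U = .cons .nil (.cons tag u.cred) ∧ z.signers (.cons tag U) = some (u.key, u.cred)
  no_user : ∀ U, st.USK U = none → assoc users U = .nil
  known : ∀ U ∈ st.HU, ∃ u, st.USK U = some u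
  new : ∀ U, U ∉ st.HU ∪ st.CU → ∀ tag : Data, tag.size ≤ 3 → z.signers (.cons tag U) = none
  session : ∀ U, U ∉ st.HU ∪ st.CU → z.sessions (.cons .nil U) = (st.sessions U).map Prod.fst
  corrupted : ∀ S ∈ z.corrupted, S.hd.size ≤ 3 ∧ S.tl ∈ st.CU
  signed : ∀ p ∈ z.signed, p.1.hd.size ≤ 3 ∧ ∃ c ∈ st.COMM, c.user = p.1.tl ∧ p.2 = some c.dom
  chosen_eq : chosen = Data.opt (st.challenge.map Prod.fst)
  challenge : flag = .nil ∧ z.challenge = none ∨ flag = .cons .nil .nil ∧ ∃ U dom, ∃ tag : Data,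
    tag.size ≤ 3 ∧ st.challenge = some (U, dom) ∧ z.challenge = some (.cons tag U, freshId, some dom)
  fresh : st.challenge = none → z.challenge = none ∧ z.signers freshId = none
  size_users : users.size ≤ 1 + k * C
  size_status : status.size ≤ 1 + k * C
  size_chosen : chosen.size ≤ C
  size_flag : flag.size ≤ 3

/-- The tag of the fresh user has size `5`, above the limit `3` for the tags of named users. -/
theorem ne_freshId {tag U : Data} (h : tag.size ≤ 3) : Data.cons tag U ≠ freshId := by
  intro h'
  injection h' with h' _
  subst h'
  simp [Data.unary] at h

namespace UserTables

variable {T : TrollThrottle} {n Q C k : ℕ} {pk : Data} {st st' : GameState}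
  {z z' : DAAScheme.GameState} {x₁ x₂ x₃ x₄ : Data}

theorem init (hC : 1 ≤ C) : UserTables T n pk Q C 0 .init .init .nil .nil .nil .nil := by
  refine ⟨DAAScheme.GoodState.init _ _ _ _, ?_, ?_, ?_, ?_, ?_, ?_, ?_, ?_, ?_, ?_, ?_, ?_, ?_, ?_, ?_,
    ?_⟩ <;>
  simp [GameState.init, DAAScheme.GameState.init, GameState.status, assoc, hC]

/-- Open sessions change. -/
theorem of_sessions (h : UserTables T n pk Q C k st z x₁ x₂ x₃ x₄) (hg : T.daa.GoodState n pk Q z')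
    (h1 : st'.HU = st.HU) (h2 : st'.CU = st.CU) (h3 : st'.USK = st.USK) (h4 : st'.COMM = st.COMM)
    (h5 : st'.challenge = st.challenge) (h6 : z'.signers = z.signers)
    (h7 : z'.corrupted = z.corrupted) (h8 : z'.signed = z.signed) (h9 : z'.challenge = z.challenge)
    (hs : ∀ U, U ∉ st.HU ∪ st.CU → z'.sessions (.cons .nil U) = (st'.sessions U).map Prod.fst) :
    UserTables T n pk Q C (k + 1) st' z' x₁ x₂ x₃ x₄ := by
  obtain ⟨a1, a2, a3, a4, a5, a6, a7, a8, a9, a10, a11, a12, a13, a14, a15, a16, a17⟩ := h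
  refine ⟨hg, ?_, ?_, ?_, ?_, ?_, ?_, ?_, ?_, ?_, ?_, ?_, ?_, by linarith, by linarith, a16, a17⟩ <;>
  simp only [GameState.status, h1, h2, h3, h4, h5, h6, h7, h8, h9] <;> assumption

theorem mono (h : UserTables T n pk Q C k st z x₁ x₂ x₃ x₄) :
    UserTables T n pk Q C (k + 1) st z x₁ x₂ x₃ x₄ :=
  h.of_sessions h.good rfl rfl rfl rfl rfl rfl rfl rfl rfl h.session

theorem status_cons (h : ∀ U, assoc x₂ U = st.status U) {U v : Data}
    (hU : st'.status U = v) (hne : ∀ U' ≠ U, st'.status U' = st.status U') (U' : Data) :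
    assoc (.cons (.cons U v) x₂) U' = st'.status U' := by
  rw [assoc_cons]
  split_ifs with hc
  · rw [← hc, hU]
  · rw [h, hne U' (Ne.symm hc)]

/-- A user has joined. -/
theorem addUser (h : UserTables T n pk Q C k st z x₁ x₂ x₃ x₄) (hg : T.daa.GoodState n pk Q z')
    {U tag key cred V : Data} (hU : U ∉ st.HU ∪ st.CU) (htag : tag.size ≤ 3)
    (h1 : st'.HU = insert U st.HU) (h2 : st'.CU = st.CU)
    (h3 : st'.USK = Function.update st.USK U (some ⟨key, cred, V⟩)) (h4 : st'.COMM = st.COMM)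
    (h5 : st'.challenge = st.challenge)
    (h6 : z'.signers = Function.update z.signers (.cons tag U) (some (key, cred)))
    (h7 : z'.corrupted = z.corrupted) (h8 : z'.signed = z.signed) (h9 : z'.challenge = z.challenge)
    (hs : ∀ U' ≠ U, st'.sessions U' = st.sessions U')
    (hz : ∀ U' ≠ U, z'.sessions (.cons .nil U') = z.sessions (.cons .nil U'))
    (hC : U.size + cred.size + 8 ≤ C) :
    UserTables T n pk Q C (k + 1) st' z' (.cons (.cons U (.cons .nil (.cons tag cred))) x₁)
      (.cons (.cons U (.cons .nil .nil)) x₂) x₃ x₄ := by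
  obtain ⟨a1, a2, a3, a4, a5, a6, a7, a8, a9, a10, a11, a12, a13, a14, a15, a16, a17⟩ := h
  have hU' := hU
  simp only [Finset.mem_union, not_or] at hU'
  have hne : ∀ {U' tag'}, U' ≠ U → z'.signers (.cons tag' U') = z.signers (.cons tag' U') := by
    intro U' tag' hne
    rw [h6, Function.update_of_ne]
    intro h'
    injection h' with _ h'
    exact hne h'
  refine ⟨hg, ?_, ?_, ?_, ?_, ?_, ?_, ?_, by rwa [h7, h2], by rwa [h8, h4], by rwa [h5],
    by rwa [h9, h5], ?_, ?_, ?_, a16, a17⟩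
  · rw [h1, h2]
    intro U' hc
    rw [Finset.mem_insert, not_or]
    exact ⟨fun h => hU'.2 (h ▸ hc), a2 U' hc⟩
  · refine status_cons a3 ?_ fun U' hc => ?_
    · simp [GameState.status, h1, h2, hU'.2]
    · simp [GameState.status, h1, h2, hc]
  · rw [h3]
    intro U' u hu
    by_cases hc : U' = U
    · subst hc
      simp at hu
      subst hu
      exact ⟨tag, htag, by simp [assoc_cons], by simp [h6]⟩
    · rw [Function.update_of_ne hc] at hu
      obtain ⟨tag', b1, b2, b3⟩ := a4 U' u hu
      exact ⟨tag', b1, by rwa [assoc_cons, if_neg (Ne.symm hc)], by rwa [hne hc]⟩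
  · rw [h3]
    intro U' hu
    by_cases hc : U' = U
    · subst hc
      simp at hu
    · rw [Function.update_of_ne hc] at hu
      rw [assoc_cons, if_neg (Ne.symm hc)]
      exact a5 U' hu
  · rw [h1, h3]
    intro U' hc
    by_cases hc' : U' = U
    · subst hc'
      simp
    · rw [Function.update_of_ne hc']
      exact a6 U' (Finset.mem_of_mem_insert_of_ne hc hc')
  · rw [h1, h2]
    intro U' hc tag' htag'
    simp only [Finset.mem_union, Finset.mem_insert, not_or] at hc
    rw [hne hc.1.1]
    exact a7 U' (by simp [hc]) tag' htag'
  · rw [h1, h2]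
    intro U' hc
    simp only [Finset.mem_union, Finset.mem_insert, not_or] at hc
    rw [hz U' hc.1.1, hs U' hc.1.1]
    exact a8 U' (by simp [hc])
  · rw [h5, h9, h6, Function.update_of_ne (ne_freshId htag).symm]
    exact a13
  · simp only [Data.size_cons, Data.size_nil]
    linarith
  · simp only [Data.size_cons, Data.size_nil]
    linarith

/-- A user is corrupted; `z'` is the new state of the challenger. -/
theorem corrupt (h : UserTables T n pk Q C k st z x₁ x₂ x₃ x₄) (hg : T.daa.GoodState n pk Q z')
    {U : Data} (h6 : z'.signers = z.signers) (hz : z'.sessions = z.sessions)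
    (h7 : ∀ S ∈ z'.corrupted, S ∈ z.corrupted ∨ S.hd.size ≤ 3 ∧ S.tl = U)
    (h8 : z'.signed = z.signed) (h9 : z'.challenge = z.challenge) (hC : U.size + 8 ≤ C) :
    UserTables T n pk Q C (k + 1) { st with CU := insert U st.CU, HU := st.HU.erase U } z' x₁
      (.cons (.cons U (.cons .nil (.cons .nil .nil))) x₂) x₃ x₄ := by
  obtain ⟨a1, a2, a3, a4, a5, a6, a7, a8, a9, a10, a11, a12, a13, a14, a15, a16, a17⟩ := h
  have hnew : ∀ {U'}, U' ∉ st.HU.erase U ∪ insert U st.CU → U' ∉ st.HU ∪ st.CU := by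
    intro U' hc
    simp only [Finset.mem_union, Finset.mem_insert, Finset.mem_erase, not_or, not_and] at hc ⊢
    exact ⟨hc.1 hc.2.1, hc.2.2⟩
  refine ⟨hg, ?_, ?_, ?_, a5, ?_, ?_, ?_, ?_, by rwa [h8], a11, by rwa [h9], by rwa [h6, h9], ?_, ?_,
    a16, a17⟩
  · intro U' hc
    simp only [Finset.mem_insert, Finset.mem_erase, not_and] at hc ⊢
    intro hc'
    exact a2 U' (hc.resolve_left hc')
  · refine status_cons a3 ?_ fun U' hc => ?_
    · simp [GameState.status]
    · simp [GameState.status, hc]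
  · rwa [h6]
  · exact fun U' hc => a6 U' (Finset.mem_of_mem_erase hc)
  · rw [h6]
    exact fun U' hc => a7 U' (hnew hc)
  · rw [hz]
    exact fun U' hc => a8 U' (hnew hc)
  · intro S hS
    rcases h7 S hS with hS | ⟨b1, b2⟩
    · exact ⟨(a9 S hS).1, Finset.mem_insert_of_mem (a9 S hS).2⟩
    · exact ⟨b1, by simp [b2]⟩
  · linarith
  · simp only [Data.size_cons, Data.size_nil]
    linarith

/-- A comment is made. -/
theorem comment (h : UserTables T n pk Q C k st z x₁ x₂ x₃ x₄) {U tag dom : Data}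
    {c : CommentRecord} (htag : tag.size ≤ 3) (hU : c.user = U) (hdom : c.dom = dom)
    (hg : T.daa.GoodState n pk Q { z with signed := insert (.cons tag U, some dom) z.signed }) :
    UserTables T n pk Q C (k + 1) { st with COMM := c :: st.COMM }
      { z with signed := insert (.cons tag U, some dom) z.signed } x₁ x₂ x₃ x₄ := by
  obtain ⟨a1, a2, a3, a4, a5, a6, a7, a8, a9, a10, a11, a12, a13, a14, a15, a16, a17⟩ := h
  refine ⟨hg, a2, a3, a4, a5, a6, a7, a8, a9, fun p hp => ?_, a11, a12, a13, by linarith,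
    by linarith, a16, a17⟩
  rcases Finset.mem_insert.1 hp with rfl | hp
  · exact ⟨htag, c, by simp, hU, by rw [hdom]⟩
  · obtain ⟨b1, c', b2, b3⟩ := a10 p hp
    exact ⟨b1, c', List.mem_cons_of_mem _ b2, b3⟩

/-- The challenge is chosen. -/
theorem choose (h : UserTables T n pk Q C k st z x₁ x₂ x₃ x₄) (hg : T.daa.GoodState n pk Q z')
    {U dom x₄' : Data} (h6 : ∀ S ≠ freshId, z'.signers S = z.signers S)
    (hz : ∀ S ≠ freshId, z'.sessions S = z.sessions S) (h7 : z'.corrupted = z.corrupted)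
    (h8 : z'.signed = z.signed)
    (h9 : x₄' = .nil ∧ z'.challenge = none ∨ x₄' = .cons .nil .nil ∧ ∃ tag : Data, tag.size ≤ 3 ∧
      z'.challenge = some (.cons tag U, freshId, some dom)) (hC : U.size + 2 ≤ C) :
    UserTables T n pk Q C (k + 1) { st with challenge := some (U, dom) } z' x₁ x₂ (.cons .nil U)
      x₄' := by
  obtain ⟨a1, a2, a3, a4, a5, a6, a7, a8, a9, a10, a11, a12, a13, a14, a15, a16, a17⟩ := h
  refine ⟨hg, a2, a3, ?_, a5, a6, ?_, ?_, by rwa [h7], by rwa [h8], rfl, ?_, by simp, by linarith,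
    by linarith, by simp; omega, ?_⟩
  · intro U' u hu
    obtain ⟨tag, b1, b2, b3⟩ := a4 U' u hu
    exact ⟨tag, b1, b2, by rwa [h6 _ (ne_freshId b1)]⟩
  · intro U' hU' tag htag
    rw [h6 _ (ne_freshId htag)]
    exact a7 U' hU' tag htag
  · intro U' hU'
    rw [hz _ (ne_freshId (by simp))]
    exact a8 U' hU'
  · exact h9.imp_right fun ⟨b1, tag, b2, b3⟩ => ⟨b1, U, dom, tag, b2, rfl, b3⟩
  · rcases h9 with h9 | h9 <;> simp [h9.1]

end UserTables

/-! ## Queries to the challenger with proofs -/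

section Calls

/-- The bounds for the sizes of the values in the game of anonymity. -/
structure Bounds (T : TrollThrottle) (l : List PPTAlgorithm) (n a : ℕ) (ρ pk sk : Data) : Prop where
  key : T.daa.keyAlg ∈ l
  join : T.daa.joinAlg.toPPT ∈ l
  sign : T.daa.signAlg ∈ l
  issue : T.daa.issueAlg ∈ l
  hash : T.hashAlg.toPPT ∈ l
  create : T.zk.createAlg ∈ l
  le : n + 1 ≤ a
  size_keys : (Data.cons pk sk).size ≤ level (growth l T.daa.joinCoins) a 1
  size_crs : ρ.size ≤ level (growth l T.daa.joinCoins) a 1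

variable {T : TrollThrottle} {l : List PPTAlgorithm} {n a : ℕ} {ρ pk sk : Data} {b : Bool}

local notation "L" => level (growth l (DAAScheme.joinCoins (TrollThrottle.daa T))) a

theorem Bounds.size_pk (hb : Bounds T l n a ρ pk sk) : pk.size ≤ L 1 := by
  have := hb.size_keys
  simp at this
  omega

theorem Bounds.size_proof (hb : Bounds T l n a ρ pk sk) {x w π : Data}
    (h : x.size + w.size ≤ 10 * L 3 + 10) (hπ : π ∈ (T.zk.createProof n ρ x w).support) :
    π.size ≤ L 6 := by
  obtain ⟨hl0, hl1, hl2, hl3, hl4, hl5, hl6⟩ := levels (l := l) (p := T.daa.joinCoins) a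
  have hl : L 0 = a := rfl
  have h1 := hb.le
  have h2 := hb.size_crs
  have : π.size ≤ L 4 := size_out_le_level (i := 3) hb.create hπ (by simp; omega)
  omega

variable {cap : ℕ} {x : ℕ} {e : Expr} {s : Store} {z : DAAScheme.GameState}
  {g : Store → DAAScheme.GameState → ℝ≥0∞} {S : Data} {c : ℝ≥0∞}

variable (T n ρ pk b) in
/-- The challenger of user-controlled anonymity with honest proofs. -/
noncomputable def realChallenger : DAAScheme.GameState → Data → PMF (Data × DAAScheme.GameState) :=
  T.daa.proofChallenger n pk b (T.zk.createProof n ρ)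

/-- The infimum over the proposition `GoodState` is the value itself if the invariant holds and `⊤`
otherwise; it makes the invariant of the new state available to the user of the rule. -/
theorem Bounds.le_wp_call (hb : Bounds T l n a ρ pk sk) {q : Data} (he : e.eval s = q)
    (hq : q.size ≤ L 5) (hg : T.daa.GoodState n pk (L 5) z)
    (h : c ≤ E (T.realChallenger n ρ pk b z q) fun r => ⨅ _ : T.daa.GoodState n pk (L 5) r.2,
      g (Function.update s x r.1) r.2) :
    c ≤ (Prog.call x e).wp n (L 7) (T.realChallenger n ρ pk b) g s z := by
  subst he
  exact Prog.le_wp_call (J := T.daa.GoodState n pk (L 5)) (fun r hr =>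
    DAAScheme.proofChallenger_support hb.key hb.join hb.sign hb.le hb.size_pk
      (fun x w π => hb.size_proof) hg hq hr) h

theorem Bounds.le_wp_callSign (hb : Bounds T l n a ρ pk sk) {dom m key cred : Data}
    (he : e.eval s = Data.tuple [.nil, S, .cons .nil dom, m])
    (hq : S.size + dom.size + m.size + 10 ≤ L 5) (hg : T.daa.GoodState n pk (L 5) z)
    (hS : z.signers S = some (key, cred)) {f : Data → ℝ≥0∞}
    (h : ∀ σ ∈ (T.daa.sign n pk key cred (some dom) m).support,
      T.daa.GoodState n pk (L 5) { z with signed := insert (S, some dom) z.signed } →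
      f σ ≤ g (Function.update s x (.cons .nil σ)) { z with signed := insert (S, some dom) z.signed }) :
    E (T.daa.sign n pk key cred (some dom) m) f ≤
      (Prog.call x e).wp n (L 7) (T.realChallenger n ρ pk b) g s z := by
  refine hb.le_wp_call he (by simp; omega) hg ?_
  rw [realChallenger, DAAScheme.proofChallenger, if_neg (by simp [Data.len]), DAAScheme.challenger]
  simp only [Data.tuple_cons, Data.nth_zero, Data.nth_succ, Data.hd_cons, Data.tl_cons, Data.len,
    Data.toOpt, DAAScheme.signQuery, hS, E_do, E_return]
  exact E_mono fun σ hσ => le_iInf fun hg' => h σ hσ hg'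

/-- The extended join draws key, coins and proof exactly as the user of the protocol does, so the
user's first message is one query. -/
theorem Bounds.le_wp_callJoin (hb : Bounds T l n a ρ pk sk)
    (he : e.eval s = Data.tuple [.cons .nil .nil, S]) (hq : S.size + 10 ≤ L 5)
    (hg : T.daa.GoodState n pk (L 5) z) (hS : z.signers S = none) {f : Data → Data × Data → ℝ≥0∞}
    (h : ∀ key ∈ (T.daa.userKey n pk).support, ∀ com π : Data, com.size ≤ L 3 →
      T.daa.GoodState n pk (L 5) { z with sessions := Function.update z.sessions S (some key) } →
      f key (com, π) ≤ g (Function.update s x (.cons .nil (Data.tuple [com, π])))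
        { z with sessions := Function.update z.sessions S (some key) }) :
    E (T.daa.userKey n pk) (fun key =>
      E (T.joinMessage n (Data.tuple [Data.unary n, ρ]) pk key) (f key)) ≤
      (Prog.call x e).wp n (L 7) (T.realChallenger n ρ pk b) g s z := by
  refine hb.le_wp_call he (by simp; omega) hg ?_
  rw [realChallenger, DAAScheme.proofChallenger, if_pos (by simp [Data.len])]
  simp only [Data.tuple_cons, Data.tuple_nil, Data.nth_zero, Data.nth_succ, Data.hd_cons, Data.tl_cons,
    DAAScheme.proofJoin, hS, joinMessage, E_do, E_return, Option.isSome_none, Bool.false_eq_true,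
    if_false]
  refine E_mono fun key hkey => E_mono fun r hr => E_mono fun π hπ => le_iInf fun hg' => ?_
  exact h key hkey _ π (DAAScheme.size_join_le hb.key hb.join hb.le hb.size_pk hkey hr).2 hg'

theorem Bounds.le_wp_callCred (hb : Bounds T l n a ρ pk sk) {key cred : Data}
    (he : e.eval s = Data.tuple [Data.unary 2, S, cred]) (hq : S.size + cred.size + 10 ≤ L 5)
    (hg : T.daa.GoodState n pk (L 5) z) (hz : z.sessions S = some key) (hS : z.signers S = none)
    (h : T.daa.check n pk key cred = true → ∀ z',
      z' = { z with sessions := Function.update z.sessions S none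
                    signers := Function.update z.signers S (some (key, cred)) } →
      T.daa.GoodState n pk (L 5) z' → c ≤ g (Function.update s x (.cons .nil (.cons .nil .nil))) z')
    (h' : T.daa.check n pk key cred = false → ∀ z',
      z' = { z with sessions := Function.update z.sessions S none } →
      T.daa.GoodState n pk (L 5) z' → c ≤ g (Function.update s x .nil) z') :
    c ≤ (Prog.call x e).wp n (L 7) (T.realChallenger n ρ pk b) g s z := by
  refine hb.le_wp_call he (by simp [Data.unary]; omega) hg ?_
  rw [realChallenger, DAAScheme.proofChallenger, if_neg (by simp [Data.len, Data.unary]),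
    DAAScheme.challenger]
  simp only [Data.tuple_cons, Data.tuple_nil, Data.nth_zero, Data.nth_succ, Data.hd_cons, Data.tl_cons,
    Data.unary, Data.len, DAAScheme.credQuery, hz, hS, Option.isNone_none, true_and]
  split_ifs with hc
  · rw [E_return]
    exact le_iInf fun hg' => h hc _ rfl hg'
  · rw [E_return]
    exact le_iInf fun hg' => h' (by simpa using hc) _ rfl hg'

theorem Bounds.le_wp_callCred_none (hb : Bounds T l n a ρ pk sk) {cred : Data}
    (he : e.eval s = Data.tuple [Data.unary 2, S, cred]) (hq : S.size + cred.size + 10 ≤ L 5)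
    (hg : T.daa.GoodState n pk (L 5) z) (hz : z.sessions S = none)
    (h : c ≤ g (Function.update s x .nil) z) :
    c ≤ (Prog.call x e).wp n (L 7) (T.realChallenger n ρ pk b) g s z := by
  refine hb.le_wp_call he (by simp [Data.unary]; omega) hg ?_
  rw [realChallenger, DAAScheme.proofChallenger, if_neg (by simp [Data.len, Data.unary]),
    DAAScheme.challenger]
  simp only [Data.tuple_cons, Data.tuple_nil, Data.nth_zero, Data.nth_succ, Data.hd_cons, Data.tl_cons,
    Data.unary, Data.len, DAAScheme.credQuery, hz]
  rw [E_return]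
  exact le_iInf fun _ => h

theorem Bounds.le_wp_callCorrupt (hb : Bounds T l n a ρ pk sk) {key cred : Data}
    (he : e.eval s = Data.tuple [Data.unary 3, S]) (hq : S.size + 10 ≤ L 5)
    (hg : T.daa.GoodState n pk (L 5) z) (hS : z.signers S = some (key, cred))
    (h : T.daa.GoodState n pk (L 5) { z with corrupted := insert S z.corrupted } →
      c ≤ g (Function.update s x (.cons .nil key)) { z with corrupted := insert S z.corrupted }) :
    c ≤ (Prog.call x e).wp n (L 7) (T.realChallenger n ρ pk b) g s z := by
  refine hb.le_wp_call he (by simp [Data.unary]; omega) hg ?_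
  rw [realChallenger, DAAScheme.proofChallenger, if_neg (by simp [Data.len, Data.unary]),
    DAAScheme.challenger]
  simp only [Data.tuple_cons, Data.tuple_nil, Data.nth_zero, Data.nth_succ, Data.hd_cons, Data.tl_cons,
    Data.unary, Data.len, DAAScheme.corruptQuery, hS]
  rw [E_return]
  exact le_iInf fun hg' => h hg'

theorem Bounds.le_wp_callChallenge (hb : Bounds T l n a ρ pk sk) {S₁ dom m : Data}
    {u₀ u₁ : Data × Data} (he : e.eval s = Data.tuple [Data.unary 4, S, S₁, dom, m])
    (hq : S.size + S₁.size + dom.size + m.size + 20 ≤ L 5)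
    (hg : T.daa.GoodState n pk (L 5) z) (hz : z.challenge = none) (hS : z.signers S = some u₀)
    (hS₁ : z.signers S₁ = some u₁) {f : Data → ℝ≥0∞}
    (h : ∀ σ ∈ (T.daa.sign n pk (if b then u₁ else u₀).1 (if b then u₁ else u₀).2 dom.toOpt m).support,
      T.daa.GoodState n pk (L 5) { z with challenge := some (S, S₁, dom.toOpt) } →
      f σ ≤ g (Function.update s x (.cons .nil σ)) { z with challenge := some (S, S₁, dom.toOpt) }) :
    E (T.daa.sign n pk (if b then u₁ else u₀).1 (if b then u₁ else u₀).2 dom.toOpt m) f ≤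
      (Prog.call x e).wp n (L 7) (T.realChallenger n ρ pk b) g s z := by
  refine hb.le_wp_call he (by simp [Data.unary]; omega) hg ?_
  rw [realChallenger, DAAScheme.proofChallenger, if_neg (show ¬ ((Data.tuple [Data.unary 4, S, S₁, dom, m]).nth 0).len = 1 by
      simp [Data.len, Data.unary]),
    DAAScheme.challenger]
  simp only [Data.tuple_cons, Data.tuple_nil, Data.nth_zero, Data.nth_succ, Data.hd_cons, Data.tl_cons,
    Data.unary, Data.len, DAAScheme.challengeQuery, hz, hS, hS₁, E_do, E_return]
  exact E_mono fun σ hσ => le_iInf fun hg' => h σ hσ hg'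

end Calls

end TrollThrottle

end Troll

namespace Troll

open scoped ENNReal

namespace TrollThrottle

/-! ## The reduction to user-controlled anonymity with honest proofs -/

section

variable {σ : Type} (N cap : ℕ) (O : σ → Data → PMF (Data × σ)) (g : Store → σ → ℝ≥0∞) (s : Store)
  (z : σ)

theorem wp_seq (P Q : Prog) : (P ;; Q).wp N cap O g s z = P.wp N cap O (Q.wp N cap O g) s z := rfl

theorem wp_cond (e : Expr) (P Q : Prog) : (Prog.cond e P Q).wp N cap O g s z =
    if (e.eval s).toBool then P.wp N cap O g s z else Q.wp N cap O g s z := rfl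

theorem wp_cond_true {e : Expr} (h : (e.eval s).toBool = true) (P Q : Prog) :
    (Prog.cond e P Q).wp N cap O g s z = P.wp N cap O g s z := if_pos h

theorem wp_cond_false {e : Expr} (h : (e.eval s).toBool = false) (P Q : Prog) :
    (Prog.cond e P Q).wp N cap O g s z = Q.wp N cap O g s z := if_neg (by simp [h])

theorem eval_var (i : ℕ) : (Expr.var i).eval s = s i := rfl

theorem wp_assign (x : ℕ) (e : Expr) :
    (Prog.assign x e).wp N cap O g s z = g (Function.update s x (e.eval s)) z := rfl

theorem wp_lookup (x : ℕ) (e f : Expr) : (Prog.lookup x e f).wp N cap O g s z =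
    g (Function.update s x (assoc (e.eval s) (f.eval s))) z := rfl

theorem wp_alg (F : PPTAlgorithm) (x : ℕ) (e : Expr) (h : s 1 = Data.unary N) :
    (Prog.alg F x e).wp N cap O g s z =
      E (F.out N (e.eval s)) fun y => g (Function.update s x y) z := if_pos h

theorem wp_toPPT (F : PTAlgorithm) (x : ℕ) (e : Expr) (h : s 1 = Data.unary N) :
    (Prog.alg F.toPPT x e).wp N cap O g s z =
      g (Function.update s x (F.out N (e.eval s))) z := by
  rw [wp_alg _ _ _ _ _ _ _ _ _ h, PTAlgorithm.out_toPPT, E_pure]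

end

section

variable (T : TrollThrottle)

/-- An honest run of the join protocol for the identity in variable `10`. Then variable `17` contains
the credential, and variable `18` tells whether the run was successful. -/
noncomputable def joinProg : Prog :=
  .call 15 (.tuple [.cons .nil .nil, .var 10]) ;;
  .alg T.zk.verifyAlg 16
    (.tuple [.var 3, .tuple [.hd (.tl (.var 15)), .var 4], .hd (.tl (.tl (.var 15)))]) ;;
  .cond (.var 16)
    (.alg T.daa.issueAlg 17 (.tuple [.var 4, .var 5, .hd (.tl (.var 15))]) ;;
      .call 18 (.tuple [.cons .nil (.cons .nil .nil), .var 10, .var 17]))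
    (.assign 18 .nil)

/-- The handler for corruptions. -/
def corruptProg : Prog :=
  .lookup 10 (.var 6) (queryArg 1) ;;
  .assign 7 (.cons (.cons (queryArg 1) (.cons .nil (.cons .nil .nil))) (.var 7)) ;;
  .cond (.var 10)
    (.call 11 (.tuple [.cons .nil (.cons .nil (.cons .nil .nil)),
        .cons (.hd (.tl (.var 10))) (queryArg 1)]) ;;
      .assign 2 (.cons .nil (.tuple [.tl (.var 11), .tl (.tl (.var 10))])))
    (.assign 2 .nil)

/-- The handler for honest runs of the join protocol. -/
noncomputable def createProg : Prog :=
  .lookup 11 (.var 7) (queryArg 1) ;;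
  .cond (.var 11) (.assign 2 .nil)
    (.assign 10 (.cons (.cons .nil .nil) (queryArg 1)) ;; T.joinProg ;;
      .cond (.var 18)
        (.assign 6 (.cons (.cons (queryArg 1) (.cons .nil (.cons (.cons .nil .nil) (.var 17)))) (.var 6)) ;;
          .assign 7 (.cons (.cons (queryArg 1) (.cons .nil .nil)) (.var 7)) ;;
          .assign 2 (.cons .nil (.var 17)))
        (.assign 2 .nil))

/-- The handler for the first half of joins with the adversary. -/
def startProg : Prog :=
  .lookup 11 (.var 7) (queryArg 1) ;;
  .cond (.var 11) (.assign 2 .nil)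
    (.call 2 (.tuple [.cons .nil .nil, .cons .nil (queryArg 1)]))

/-- The handler for the second half of joins with the adversary. -/
def finishProg : Prog :=
  .lookup 11 (.var 7) (queryArg 1) ;;
  .cond (.var 11) (.assign 2 .nil)
    (.call 12 (.tuple [.cons .nil (.cons .nil .nil), .cons .nil (queryArg 1), queryArg 2]) ;;
      .cond (.var 12)
        (.assign 6 (.cons (.cons (queryArg 1) (.cons .nil (.cons .nil (queryArg 2)))) (.var 6)) ;;
          .assign 7 (.cons (.cons (queryArg 1) (.cons .nil .nil)) (.var 7)) ;;
          .assign 2 (.var 12))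
        (.assign 2 .nil))

/-- The answer that consists of a pseudonym and a comment, for the signature in variable `13`. -/
noncomputable def answerProg : Prog :=
  .alg T.daa.nymExtractAlg.toPPT 14 (.tuple [.var 4, .tl (.var 13)]) ;;
  .assign 2 (.cons .nil (.tuple [.var 14,
    .tuple [.tl (.var 13), .var 14, queryArg 2, .var 12]]))

/-- The handler for comments. -/
noncomputable def commentProg : Prog :=
  .lookup 10 (.var 7) (queryArg 1) ;; .lookup 11 (.var 6) (queryArg 1) ;;
  .cond (.eq (.var 10) (.cons .nil .nil))
    (.alg T.hashAlg.toPPT 12 (queryArg 3) ;;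
      .call 13 (.tuple [.nil, .cons (.hd (.tl (.var 11))) (queryArg 1), .cons .nil (queryArg 2),
        .var 12]) ;;
      T.answerProg)
    (.assign 2 .nil)

/-- The handler for the challenge. -/
noncomputable def challengeProg : Prog :=
  .cond (.var 8) (.assign 2 .nil)
    (.assign 8 (.cons .nil (queryArg 1)) ;;
      .lookup 10 (.var 7) (queryArg 1) ;; .lookup 11 (.var 6) (queryArg 1) ;;
      .cond (.eq (.var 10) (.cons .nil .nil))
        (.assign 10 (.cons (.cons .nil (.cons .nil .nil)) .nil) ;; T.joinProg ;;
          .cond (.var 18)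
            (.alg T.hashAlg.toPPT 12 (queryArg 3) ;;
              .call 13 (.tuple [.cons .nil (.cons .nil (.cons .nil (.cons .nil .nil))),
                .cons (.hd (.tl (.var 11))) (queryArg 1), .var 10, .cons .nil (queryArg 2),
                .var 12]) ;;
              .assign 9 (.cons .nil .nil) ;; T.answerProg)
            (.assign 2 .nil))
        (.assign 2 .nil))

/-- The handler that implements the oracles of the game of anonymity. -/
noncomputable def userHandler : Prog :=
  .dispatch (.assign 2 .nil) [corruptProg, T.createProg, startProg, finishProg, T.commentProg,
    T.challengeProg] (queryArg 0)

/-- A challenge is made if none was made before. -/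
def userFinal : Prog :=
  .cond (.var 9) (.assign 0 (.var 2))
    (.lookup 10 (.var 6) (.tl (.var 8)) ;;
      .call 11 (.tuple [.cons .nil (.cons .nil (.cons .nil (.cons .nil .nil))),
        .cons (.hd (.tl (.var 10))) (.tl (.var 8)), .cons (.hd (.tl (.var 10))) (.tl (.var 8)),
        .nil, .nil]) ;;
      .assign 0 (.var 2))

/-- The reduction that implements the game of anonymity with the challenger of user-controlled
anonymity with honest proofs. -/
noncomputable def userReduction : Reduction where
  init := .assign 1 (.hd (.var 0)) ;; .assign 10 (.tl (.var 0)) ;; .assign 3 (.nth (.var 10) 0) ;;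
    .assign 4 (.nth (.var 10) 1) ;; .assign 5 (.nth (.var 10) 2) ;;
    .assign 2 (.cons (.var 1) (.tuple [.tuple [.var 1, .var 3], .tuple [.var 4, .var 5]])) ;;
    .assign 0 .nil
  handler := T.userHandler
  final := userFinal
  perm := 10
  width := 19
  two_lt := by norm_num
  init_vars := by simp [Prog.vars, Expr.vars, Expr.tuple, Expr.nth]
  handler_vars := by
    simp [userHandler, corruptProg, createProg, startProg, finishProg, commentProg, challengeProg,
      joinProg, answerProg, Prog.vars, Expr.vars, Expr.tuple, Expr.nth, Prog.dispatch, queryArg]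
  final_vars := by simp [userFinal, Prog.vars, Expr.vars, Expr.tuple]
  two_lt_width := by norm_num

/-- The relation between the variables and the states for `userReduction`. -/
def UserRel (n : ℕ) (ρ pk sk : Data) (Q C k : ℕ) (st : GameState) (s : Store)
    (z : DAAScheme.GameState) : Prop :=
  (s 0 = .nil ∧ s 1 = Data.unary n ∧ s 3 = ρ ∧ s 4 = pk ∧ s 5 = sk) ∧
    UserTables T n pk Q C k st z (s 6) (s 7) (s 8) (s 9)

end

/-! ### Joins and corruptions in the reduction with honest proofs -/

section Calls

variable {T : TrollThrottle} {l : List PPTAlgorithm} {n a : ℕ} {ρ pk sk : Data} {b : Bool}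

local notation "L" => level (growth l (DAAScheme.joinCoins (TrollThrottle.daa T))) a

/-- An honest run, with the challenger as the user and the reduction, which knows `sk`, as the
issuer. It aborts if the proof is rejected or the credential is invalid; then no signer is added,
and at most the session of this one identity has changed. -/
theorem Bounds.le_wp_joinProg (hb : Bounds T l n a ρ pk sk) {s : Store} {z : DAAScheme.GameState}
    {g : Store → DAAScheme.GameState → ℝ≥0∞} (h1 : s 1 = Data.unary n) (h3 : s 3 = ρ) (h4 : s 4 = pk)
    (h5 : s 5 = sk) (hq : (s 10).size + 10 ≤ 2 * L 4) (hg : T.daa.GoodState n pk (L 5) z)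
    (hS : z.signers (s 10) = none) {f : Option (Data × Data) → ℝ≥0∞}
    (h : ∀ (s' : Store) (z' : DAAScheme.GameState) (key cred : Data), (∀ i < 15, s' i = s i) →
      s' 17 = cred → (s' 18).toBool = true → cred.size ≤ L 4 → T.daa.GoodState n pk (L 5) z' →
      z'.signers = Function.update z.signers (s 10) (some (key, cred)) →
      (∀ S' ≠ s 10, z'.sessions S' = z.sessions S') → z'.corrupted = z.corrupted →
      z'.signed = z.signed → z'.challenge = z.challenge → f (some (key, cred)) ≤ g s' z')
    (h' : ∀ (s' : Store) (z' : DAAScheme.GameState), (∀ i < 15, s' i = s i) →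
      (s' 18).toBool = false → T.daa.GoodState n pk (L 5) z' → z'.signers = z.signers →
      (∀ S' ≠ s 10, z'.sessions S' = z.sessions S') → z'.corrupted = z.corrupted →
      z'.signed = z.signed → z'.challenge = z.challenge → f none ≤ g s' z') :
    E (T.joinIssue n (Data.tuple [Data.unary n, ρ]) pk (Data.tuple [pk, sk])) f ≤
      T.joinProg.wp n (L 7) (T.realChallenger n ρ pk b) g s z := by
  obtain ⟨hl0, hl1, hl2, hl3, hl4, hl5, hl6⟩ := levels (l := l) (p := T.daa.joinCoins) a
  have hl : L 0 = a := rfl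
  have hle := hb.le
  have hkeys := hb.size_keys
  simp at hkeys
  rw [joinProg, wp_seq, joinIssue]
  simp only [E_do]
  refine hb.le_wp_callJoin (by simp [Expr.eval, Expr.tuple]) (by omega) hg hS
    fun key hkey com π hcom hg₁ => ?_
  have hsess : ∀ (v w : Option Data), ∀ S' ≠ s 10, Function.update (Function.update z.sessions (s 10) v)
      (s 10) w S' = z.sessions S' := fun v w S' hS' => by simp [hS']
  simp only [TrollThrottle.issue, ProofSystem.verifyProof, E_do, E_map]
  simp [-bind_pure_comp, wp_seq, wp_cond, wp_assign, wp_alg, h1, h3, h4, h5, Expr.eval, Expr.tuple]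
  refine E_mono fun ok _ => ?_
  cases hok : ok.toBool with
  | false =>
    simp [E_return]
    exact h' _ _ (fun i hi => by simp [show i ≠ 15 by omega, show i ≠ 16 by omega, show i ≠ 18 by omega])
      (by simp) hg₁ rfl (fun S' hS' => by simp [hS']) rfl rfl rfl
  | true =>
    simp [-bind_pure_comp, E_do, E_return, DAAScheme.issue]
    refine E_mono fun cred hcred => ?_
    have hsize : cred.size ≤ L 4 := size_out_le_level (i := 3) hb.issue hcred (by simp; omega)
    refine hb.le_wp_callCred (key := key) (S := s 10) (cred := cred)
      (by simp [Expr.eval, Data.unary]) (by omega) hg₁ (by simp) hS ?_ ?_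
    · intro hc z' hz' hg'
      simp [joinAccepts, Option.filter, hc]
      subst hz'
      exact h _ _ _ _ (fun i hi => by simp [show i ≠ 15 by omega, show i ≠ 16 by omega,
        show i ≠ 17 by omega, show i ≠ 18 by omega]) (by simp) (by simp) hsize hg' rfl
        (hsess _ _) rfl rfl rfl
    · intro hc z' hz' hg'
      simp [joinAccepts, Option.filter, hc]
      subst hz'
      exact h' _ _ (fun i hi => by simp [show i ≠ 15 by omega, show i ≠ 16 by omega,
        show i ≠ 17 by omega, show i ≠ 18 by omega]) (by simp) hg' rfl
        (hsess _ _) rfl rfl rfl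

variable {C k : ℕ} {st : GameState} {s : Store} {z : DAAScheme.GameState}
  {g : Data × GameState → ℝ≥0∞} {g' : Store → DAAScheme.GameState → ℝ≥0∞}

/-- The answer `⊥`, where only open sessions change. -/
theorem UserRel.le_of_nil {Q : ℕ} (h : T.UserRel n ρ pk sk Q C k st s z) {st' : GameState}
    {s' : Store} {z' : DAAScheme.GameState}
    (hg : ∀ st' s' z', T.UserRel n ρ pk sk Q C (k + 1) st' s' z' → g (s' 2, st') ≤ g' s' z')
    (hs : ∀ i < 10, i ≠ 2 → s' i = s i) (hs2 : s' 2 = .nil)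
    (htab : ∀ x₁ x₂ x₃ x₄, UserTables T n pk Q C k st z x₁ x₂ x₃ x₄ →
      UserTables T n pk Q C (k + 1) st' z' x₁ x₂ x₃ x₄) : g (.nil, st') ≤ g' s' z' := by
  obtain ⟨⟨h0, h1, h3, h4, h5⟩, ht⟩ := h
  have := hg st' s' z' ⟨by simp [hs, h0, h1, h3, h4, h5], by simpa [hs] using htab _ _ _ _ ht⟩
  rwa [hs2] at this

/-- The challenger reveals the key; the credential is in the reduction's own table, having passed
through its hands. For a user without a record there is nothing to ask, but the user becomes
corrupted all the same. -/
theorem Bounds.le_wp_corruptProg (hb : Bounds T l n a ρ pk sk)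
    (h : T.UserRel n ρ pk sk (L 5) C k st s z) (hq : (s 2).size ≤ L 0) (hC : 2 * L 4 ≤ C)
    (hg : ∀ st' s' z', T.UserRel n ρ pk sk (L 5) C (k + 1) st' s' z' → g (s' 2, st') ≤ g' s' z') :
    E (corruptUser ((s 2).nth 1) st) g ≤
      corruptProg.wp n (L 7) (T.realChallenger n ρ pk b) g' s z := by
  obtain ⟨hl0, hl1, hl2, hl3, hl4, hl5, hl6⟩ := levels (l := l) (p := T.daa.joinCoins) a
  have hU := (s 2).size_nth_le 1
  have ⟨⟨h0, h1, h3, h4, h5⟩, ht⟩ := h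
  simp only [corruptUser, corruptProg, wp_seq, wp_cond, wp_assign, wp_lookup, Expr.eval, eval_queryArg, E_return]
  cases hu : st.USK ((s 2).nth 1) with
  | none =>
    simp [-Data.nth_succ, ht.no_user _ hu]
    refine le_trans (le_of_eq ?_) (hg _ _ _ ⟨?_, ht.corrupt ht.good (U := (s 2).nth 1) rfl rfl
      (fun S hS => Or.inl hS) rfl rfl (by omega)⟩)
    · simp
    · simp [h0, h1, h3, h4, h5]
  | some u =>
    obtain ⟨tag, htag, hass, hsig⟩ := ht.user _ _ hu
    simp [-Data.nth_succ, hass]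
    refine hb.le_wp_callCorrupt (S := .cons tag ((s 2).nth 1)) ?_ (by simp [-Data.nth_succ]; omega)
      ht.good hsig fun hgood => ?_
    · simp [Expr.eval, Expr.tuple, eval_queryArg, Data.unary]
    refine le_trans (le_of_eq ?_) (hg _ _ _ ⟨?_, ht.corrupt hgood (U := (s 2).nth 1) rfl rfl
      (fun S hS => ?_) rfl rfl (by omega)⟩)
    · simp [Expr.eval, Expr.tuple]
    · simp [h0, h1, h3, h4, h5]
    · rcases Finset.mem_insert.1 hS with rfl | hS
      · exact Or.inr ⟨htag, rfl⟩
      · exact Or.inl hS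

theorem UserTables.status_eq_nil {Q : ℕ} {x₁ x₂ x₃ x₄ U : Data}
    (ht : UserTables T n pk Q C k st z x₁ x₂ x₃ x₄) :
    (assoc x₂ U).toBool = decide (U ∈ st.HU ∪ st.CU) := by
  rw [ht.status_eq, GameState.status]
  by_cases h1 : U ∈ st.CU <;> by_cases h2 : U ∈ st.HU <;> simp [h1, h2]

theorem UserTables.status_honest {Q : ℕ} {x₁ x₂ x₃ x₄ U : Data}
    (ht : UserTables T n pk Q C k st z x₁ x₂ x₃ x₄) :
    assoc x₂ U = .cons .nil .nil ↔ U ∈ st.HU := by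
  rw [ht.status_eq, GameState.status]
  by_cases h1 : U ∈ st.CU
  · simp [h1, ht.disjoint U h1]
  · by_cases h2 : U ∈ st.HU <;> simp [h1, h2]

theorem Bounds.le_wp_startProg (hb : Bounds T l n a ρ pk sk)
    (h : T.UserRel n ρ pk sk (L 5) C k st s z) (hq : (s 2).size ≤ L 0) (V : Data)
    (hg : ∀ st' s' z', T.UserRel n ρ pk sk (L 5) C (k + 1) st' s' z' → g (s' 2, st') ≤ g' s' z') :
    E (T.hJoinStart n (Data.tuple [Data.unary n, ρ]) pk ((s 2).nth 1) V st) g ≤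
      startProg.wp n (L 7) (T.realChallenger n ρ pk b) g' s z := by
  obtain ⟨hl0, hl1, hl2, hl3, hl4, hl5, hl6⟩ := levels (l := l) (p := T.daa.joinCoins) a
  have hU := (s 2).size_nth_le 1
  have ⟨⟨h0, h1, h3, h4, h5⟩, ht⟩ := h
  simp only [hJoinStart, startProg, wp_seq, wp_cond, wp_assign, wp_lookup, Expr.eval, eval_queryArg, Function.update_self,
    ht.status_eq_nil, decide_eq_true_eq]
  split_ifs with hc
  · rw [E_return]
    exact h.le_of_nil hg (fun i hi hi2 => by simp [show i ≠ 11 by omega, hi2]) (by simp)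
      fun _ _ _ _ ht => ht.mono
  · simp only [E_do, E_return]
    refine hb.le_wp_callJoin (S := .cons .nil ((s 2).nth 1)) ?_ (by simp [-Data.nth_succ]; omega)
      ht.good (ht.new _ hc _ (by simp)) fun key hkey com π hcom hgood => ?_
    · simp [Expr.eval, Expr.tuple, eval_queryArg]
    refine le_trans (le_of_eq ?_) (hg { st with
        ver := insert (V, (s 2).nth 1) st.ver
        sessions := Function.update st.sessions ((s 2).nth 1) (some (key, V)) } _ _
      ⟨?_, ht.of_sessions hgood rfl rfl rfl rfl rfl rfl rfl rfl rfl
      fun U hU' => ?_⟩)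
    · simp
    · simp [h0, h1, h3, h4, h5]
    · by_cases hUe : U = (s 2).nth 1
      · subst hUe
        simp
      · have : Data.cons .nil U ≠ .cons .nil ((s 2).nth 1) := fun h => by
          injection h with _ h
          exact hUe h
        simp only
        rw [Function.update_of_ne this, Function.update_of_ne hUe]
        exact ht.session U hU'

/-- If `U` has meanwhile become honest or corrupted, the answer is `⊥` without a query, and a
session of the challenger may stay open. This is why the invariant on sessions is restricted to
users who are neither. -/
theorem Bounds.le_wp_finishProg (hb : Bounds T l n a ρ pk sk)
    (h : T.UserRel n ρ pk sk (L 5) C k st s z) (hq : (s 2).size ≤ L 0) (hC : 2 * L 4 ≤ C)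
    (hg : ∀ st' s' z', T.UserRel n ρ pk sk (L 5) C (k + 1) st' s' z' → g (s' 2, st') ≤ g' s' z') :
    E (T.hJoinFinish n pk ((s 2).nth 1) ((s 2).nth 2) st) g ≤
      finishProg.wp n (L 7) (T.realChallenger n ρ pk b) g' s z := by
  obtain ⟨hl0, hl1, hl2, hl3, hl4, hl5, hl6⟩ := levels (l := l) (p := T.daa.joinCoins) a
  have hU := (s 2).size_nth_le 1
  have hcred := (s 2).size_nth_le 2
  have ⟨⟨h0, h1, h3, h4, h5⟩, ht⟩ := h
  simp only [hJoinFinish, finishProg, wp_seq, wp_cond, wp_assign, wp_lookup, Expr.eval, eval_queryArg,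
    Function.update_self, ht.status_eq_nil, decide_eq_true_eq]
  have hne : ∀ U ≠ (s 2).nth 1, Data.cons .nil U ≠ .cons .nil ((s 2).nth 1) := fun U hU h => by
    injection h with _ h
    exact hU h
  split_ifs with hc
  · have hleave : ∀ x₁ x₂ x₃ x₄, UserTables T n pk (L 5) C k st z x₁ x₂ x₃ x₄ →
        UserTables T n pk (L 5) C (k + 1)
          { st with sessions := Function.update st.sessions ((s 2).nth 1) none } z x₁ x₂ x₃ x₄ :=
      fun _ _ _ _ ht => ht.of_sessions ht.good rfl rfl rfl rfl rfl rfl rfl rfl rfl fun U hU' => by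
        have : U ≠ (s 2).nth 1 := fun h => hU' (h ▸ hc)
        simp only
        rw [Function.update_of_ne this]
        exact ht.session U hU'
    split
    · rw [E_return]
      exact h.le_of_nil hg (fun i hi hi2 => by simp [show i ≠ 11 by omega, hi2]) (by simp)
        fun _ _ _ _ ht => ht.mono
    · rw [if_neg (by simp [-Data.nth_succ, Finset.mem_union.1 hc]), E_return]
      exact h.le_of_nil hg (fun i hi hi2 => by simp [show i ≠ 11 by omega, hi2]) (by simp) hleave
  · have hsess := ht.session _ hc
    have hsig := ht.new _ hc .nil (by simp)
    have heval : (Expr.tuple [.cons .nil (.cons .nil .nil), .cons .nil (queryArg 1), queryArg 2]).eval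
        (Function.update s 11 (assoc (s 7) ((s 2).nth 1))) =
        Data.tuple [Data.unary 2, .cons .nil ((s 2).nth 1), (s 2).nth 2] := by
      simp [Expr.eval, Expr.tuple, eval_queryArg, Data.unary]
    cases hs : st.sessions ((s 2).nth 1) with
    | none =>
      rw [hs] at hsess
      simp only [E_return]
      refine hb.le_wp_callCred_none heval (by simp [-Data.nth_succ]; omega) ht.good hsess ?_
      rw [wp_cond, if_neg (by simp [Expr.eval]), wp_assign]
      exact h.le_of_nil hg (fun i hi hi2 => by simp [show i ≠ 11 by omega, show i ≠ 12 by omega, hi2])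
        (by simp [Expr.eval]) fun _ _ _ _ ht => ht.mono
    | some v =>
      obtain ⟨key, V⟩ := v
      rw [hs] at hsess
      refine hb.le_wp_callCred (key := key) heval (by simp [-Data.nth_succ]; omega) ht.good hsess hsig
        ?_ ?_
      · rintro hcheck z' rfl hgood
        simp only
        rw [if_pos ⟨hc, hcheck⟩, E_return]
        simp [-Data.nth_succ, wp_seq, wp_cond, wp_assign, Expr.eval, eval_queryArg]
        refine le_trans (le_of_eq ?_) (hg { st with
            sessions := Function.update st.sessions ((s 2).nth 1) none
            USK := Function.update st.USK ((s 2).nth 1) (some ⟨key, (s 2).nth 2, V⟩)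
            HU := insert ((s 2).nth 1) st.HU } _ _
          ⟨?_, ht.addUser hgood hc (tag := .nil) (by simp) rfl rfl rfl rfl rfl rfl rfl rfl rfl ?_ ?_
            (by omega)⟩)
        · simp [Data.bit]
        · simp [h0, h1, h3, h4, h5]
        · exact fun U hU => Function.update_of_ne hU _ _
        · exact fun U hU => Function.update_of_ne (hne U hU) _ _
      · rintro hcheck z' rfl hgood
        simp only
        rw [if_neg fun hc => Bool.false_ne_true (hcheck.symm.trans hc.2), E_return, wp_cond,
          if_neg (by simp [Expr.eval]), wp_assign]
        refine h.le_of_nil hg (fun i hi hi2 => by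
          simp [show i ≠ 11 by omega, show i ≠ 12 by omega, hi2]) (by simp [Expr.eval])
          fun _ _ _ _ ht => ht.of_sessions hgood rfl rfl rfl rfl rfl rfl rfl rfl rfl fun U hU' => ?_
        by_cases hUe : U = (s 2).nth 1
        · subst hUe
          simp
        · simp only
          rw [Function.update_of_ne (hne U hUe), Function.update_of_ne hUe]
          exact ht.session U hU'

/-- Honest runs use the tag `cons nil nil`. A session of `U` with the adversary, kept under the tag
`nil`, is thus not disturbed by an honest run for the same `U`. -/
theorem Bounds.le_wp_createProg (hb : Bounds T l n a ρ pk sk)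
    (h : T.UserRel n ρ pk sk (L 5) C k st s z) (hq : (s 2).size ≤ L 0) (hC : 2 * L 4 ≤ C) (V : Data)
    (hg : ∀ st' s' z', T.UserRel n ρ pk sk (L 5) C (k + 1) st' s' z' → g (s' 2, st') ≤ g' s' z') :
    E (T.createHonestUser n (Data.tuple [Data.unary n, ρ]) pk (Data.tuple [pk, sk]) ((s 2).nth 1) V st)
      g ≤ T.createProg.wp n (L 7) (T.realChallenger n ρ pk b) g' s z := by
  obtain ⟨hl0, hl1, hl2, hl3, hl4, hl5, hl6⟩ := levels (l := l) (p := T.daa.joinCoins) a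
  have hU := (s 2).size_nth_le 1
  have ⟨⟨h0, h1, h3, h4, h5⟩, ht⟩ := h
  simp only [createHonestUser, createProg, wp_seq, wp_cond, wp_assign, wp_lookup, Expr.eval,
    eval_queryArg, Function.update_self, ht.status_eq_nil, decide_eq_true_eq]
  split_ifs with hc
  · rw [E_return]
    exact h.le_of_nil hg (fun i hi hi2 => by simp [show i ≠ 11 by omega, hi2]) (by simp)
      fun _ _ _ _ ht => ht.mono
  · rw [E_do]
    refine hb.le_wp_joinProg (by simpa using h1) (by simpa using h3) (by simpa using h4)
      (by simpa using h5) (by simp [-Data.nth_succ]; omega) ht.good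
      (by simpa [-Data.nth_succ] using ht.new _ hc _ (by simp)) ?_ ?_
    · intro s' z' key cred hs h17 h18 hsize hgood e1 e2 e3 e4 e5
      have hs' : ∀ i < 15, i ≠ 10 → i ≠ 11 → s' i = s i := fun i hi h10 h11 => by
        rw [hs i hi, Function.update_of_ne h10, Function.update_of_ne h11]
      simp only [E_return]
      simp [-Data.nth_succ, wp_seq, wp_cond, wp_assign, Expr.eval, eval_queryArg, h17, h18, hs']
      have := ht.addUser (st' := { st with
          ver := insert (V, (s 2).nth 1) st.ver
          USK := Function.update st.USK ((s 2).nth 1) (some ⟨key, cred, V⟩)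
          HU := insert ((s 2).nth 1) st.HU }) hgood hc (tag := .cons .nil .nil) (by simp) rfl rfl rfl rfl
        rfl (by simpa [-Data.nth_succ] using e1) e3 e4 e5 (fun U _ => rfl)
        (fun U _ => e2 _ (by simp)) (by omega)
      refine le_trans (le_of_eq ?_) (hg _ _ _ ⟨?_, by simpa [-Data.nth_succ, hs'] using this⟩)
      · simp
      · simp [hs', h0, h1, h3, h4, h5]
    · intro s' z' hs h18 hgood e1 e2 e3 e4 e5
      simp only [E_return]
      rw [wp_cond, if_neg (by simp [Expr.eval, h18]), wp_assign]
      refine h.le_of_nil hg (fun i hi hi2 => ?_) (by simp [Expr.eval])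
        fun _ _ _ _ ht => ht.of_sessions hgood rfl rfl rfl rfl rfl e1 e3 e4 e5 fun U hU' => ?_
      · simp only [hi2, ne_eq, not_false_eq_true, Function.update_of_ne, hs i (show i < 15 by omega),
          show i ≠ 10 by omega, show i ≠ 11 by omega]
      · rw [e2 _ (by simp)]
        exact ht.session U hU'

end Calls

end TrollThrottle

end Troll

/-! ### Comments, the challenge and the verdict in the reduction with honest proofs -/

namespace Troll

open scoped ENNReal

namespace TrollThrottle

variable {T : TrollThrottle} {l : List PPTAlgorithm} {n a : ℕ} {ρ pk sk : Data} {b : Bool}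

local notation "L" => level (growth l (DAAScheme.joinCoins (TrollThrottle.daa T))) a

/-- The reduction lacks the key that `NymGen` takes. For generated keys and valid credentials,
`NymsMatch` allows the pseudonym to be extracted from the signature instead. -/
theorem E_comment (hnym : T.daa.NymsMatch) (hk : (pk, sk) ∈ (T.daa.setup n).support)
    {key cred : Data} (hkey : key ∈ (T.daa.userKey n pk).support)
    (hcheck : T.daa.check n pk key cred = true) (dom m : Data) (f : Data × Data → ℝ≥0∞) :
    E (T.comment n pk key cred dom m) f = E (T.daa.sign n pk key cred (some dom) (T.hash n m))
      fun σ => f (T.daa.nymExtract n pk σ,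
        Data.tuple [σ, T.daa.nymExtract n pk σ, dom, T.hash n m]) := by
  simp only [comment, E_do, E_return]
  exact E_congr fun σ hσ => by rw [hnym n pk sk key cred dom _ σ hk hkey hcheck hσ]

theorem wp_answerProg {N cap : ℕ} {σ : Type} {O : σ → Data → PMF (Data × σ)} {g : Store → σ → ℝ≥0∞}
    {s : Store} {z : σ} (h1 : s 1 = Data.unary N) : T.answerProg.wp N cap O g s z =
      g (Function.update (Function.update s 14 (T.daa.nymExtract N (s 4) (s 13).tl)) 2
        (.cons .nil (Data.tuple [T.daa.nymExtract N (s 4) (s 13).tl,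
          Data.tuple [(s 13).tl, T.daa.nymExtract N (s 4) (s 13).tl, (s 2).nth 2, s 12]]))) z := by
  rw [answerProg, wp_seq, wp_toPPT _ _ _ _ _ _ _ _ _ h1]
  simp [wp_assign, Expr.eval, Expr.tuple, eval_queryArg, DAAScheme.nymExtract]

theorem Bounds.size_hash (hb : Bounds T l n a ρ pk sk) {m : Data} (hm : m.size ≤ L 0) :
    (T.hash n m).size ≤ L 1 := by
  have hl : L 0 = a := rfl
  have hle := hb.le
  refine size_out_le_level (i := 0) hb.hash (n := n) (x := m) ?_ (by omega)
  rw [PTAlgorithm.out_toPPT]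
  exact (PMF.mem_support_pure_iff _ _).2 rfl

variable {C k : ℕ} {st : GameState} {s : Store} {z : DAAScheme.GameState}
  {g : Data × GameState → ℝ≥0∞} {g' : Store → DAAScheme.GameState → ℝ≥0∞}

theorem Bounds.le_wp_commentProg (hb : Bounds T l n a ρ pk sk) (hnym : T.daa.NymsMatch)
    (hk : (pk, sk) ∈ (T.daa.setup n).support)
    (h : T.UserRel n ρ pk sk (L 5) C k st s z) (hq : (s 2).size ≤ L 0)
    (hg : ∀ st' s' z', T.UserRel n ρ pk sk (L 5) C (k + 1) st' s' z' → g (s' 2, st') ≤ g' s' z') :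
    E (T.createComment n pk ((s 2).nth 1) ((s 2).nth 2) ((s 2).nth 3) st) g ≤
      T.commentProg.wp n (L 7) (T.realChallenger n ρ pk b) g' s z := by
  obtain ⟨hl0, hl1, hl2, hl3, hl4, hl5, hl6⟩ := levels (l := l) (p := T.daa.joinCoins) a
  have hU := (s 2).size_nth_le 1
  have hdom := (s 2).size_nth_le 2
  have hm := hb.size_hash (((s 2).size_nth_le 3).trans hq)
  have ⟨⟨h0, h1, h3, h4, h5⟩, ht⟩ := h
  have hst := ht.status_honest (U := (s 2).nth 1)
  simp only [createComment, commentProg, wp_seq, wp_lookup, eval_var, eval_queryArg]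
  by_cases hc : (s 2).nth 1 ∈ st.HU
  · obtain ⟨u, hu⟩ := ht.known _ hc
    obtain ⟨tag, htag, hass, hsig⟩ := ht.user _ _ hu
    obtain ⟨hkey, hcheck, -⟩ := ht.good.signer _ _ hsig
    rw [if_pos hc, hu]
    simp only [E_do, E_return]
    rw [E_comment hnym hk hkey hcheck, wp_cond_true _ _ _ _ _ _ (by simpa [-Data.nth_succ, Expr.eval, eval_queryArg] using hst.2 hc),
      wp_seq, wp_toPPT _ _ _ _ _ _ _ _ _ (by simpa using h1), wp_seq]
    refine hb.le_wp_callSign (S := .cons tag ((s 2).nth 1)) ?_ (by simp [-Data.nth_succ]; omega)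
      ht.good hsig fun σ hσ hgood => ?_
    · simp [-Data.nth_succ, Expr.eval, Expr.tuple, eval_queryArg, hass, TrollThrottle.hash]
    rw [wp_answerProg (by simpa using h1)]
    refine le_trans (le_of_eq ?_) (hg { st with
        COMM := ⟨(s 2).nth 1, T.daa.nymExtract n pk σ, (s 2).nth 2, (s 2).nth 3, Data.tuple [σ,
          T.daa.nymExtract n pk σ, (s 2).nth 2, T.hash n ((s 2).nth 3)]⟩ :: st.COMM } _ _
      ⟨?_, ht.comment htag rfl rfl hgood⟩)
    · simp [h4, TrollThrottle.hash, eval_queryArg]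
    · simp [h0, h1, h3, h4, h5]
  · rw [if_neg hc, wp_cond_false _ _ _ _ _ _
      (by simpa [-Data.nth_succ, Expr.eval, eval_queryArg] using fun h => hc (hst.1 h)), wp_assign]
    simp only [E_return, Expr.eval]
    exact h.le_of_nil hg (fun i hi hi2 => by simp [show i ≠ 10 by omega, show i ≠ 11 by omega, hi2])
      (by simp) fun _ _ _ _ ht => ht.mono

/-- The challenge, after the fresh user has joined. -/
theorem Bounds.le_wp_challengeSign (hb : Bounds T l n a ρ pk sk) (hnym : T.daa.NymsMatch)
    (hk : (pk, sk) ∈ (T.daa.setup n).support)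
    (h : T.UserRel n ρ pk sk (L 5) C k st s z) (hq : (s 2).size ≤ L 0) (hC : 2 * L 4 ≤ C)
    (hg : ∀ st' s' z', T.UserRel n ρ pk sk (L 5) C (k + 1) st' s' z' → g (s' 2, st') ≤ g' s' z')
    (hz : z.challenge = none) {u : UserRecord} {tag : Data} (htag : tag.size ≤ 3)
    (hsig : z.signers (.cons tag ((s 2).nth 1)) = some (u.key, u.cred)) {s' : Store}
    {z' : DAAScheme.GameState} {key cred : Data}
    (hs' : ∀ i < 10, i ≠ 8 → s' i = s i) (hs8 : s' 8 = .cons .nil ((s 2).nth 1))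
    (hs10 : s' 10 = freshId) (hs11 : s' 11 = .cons .nil (.cons tag u.cred))
    (hgood : T.daa.GoodState n pk (L 5) z')
    (e1 : z'.signers = Function.update z.signers freshId (some (key, cred)))
    (e2 : ∀ S ≠ freshId, z'.sessions S = z.sessions S) (e3 : z'.corrupted = z.corrupted)
    (e4 : z'.signed = z.signed) (e5 : z'.challenge = z.challenge) :
    E (T.comment n pk (if b then (key, cred) else (u.key, u.cred)).1
      (if b then (key, cred) else (u.key, u.cred)).2 ((s 2).nth 2) ((s 2).nth 3)) (fun c =>
        g (Data.opt (some (Data.tuple [c.1, c.2])),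
          { st with challenge := some ((s 2).nth 1, (s 2).nth 2) })) ≤
      (Prog.alg T.hashAlg.toPPT 12 (queryArg 3) ;;
        .call 13 (.tuple [.cons .nil (.cons .nil (.cons .nil (.cons .nil .nil))),
          .cons (.hd (.tl (.var 11))) (queryArg 1), .var 10, .cons .nil (queryArg 2), .var 12]) ;;
        .assign 9 (.cons .nil .nil) ;; T.answerProg).wp n (L 7) (T.realChallenger n ρ pk b) g' s' z' := by
  obtain ⟨hl0, hl1, hl2, hl3, hl4, hl5, hl6⟩ := levels (l := l) (p := T.daa.joinCoins) a
  have hU := (s 2).size_nth_le 1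
  have hdom := (s 2).size_nth_le 2
  have hm := hb.size_hash (((s 2).size_nth_le 3).trans hq)
  have ⟨⟨h0, h1, h3, h4, h5⟩, ht⟩ := h
  have hsig₀ : z'.signers (.cons tag ((s 2).nth 1)) = some (u.key, u.cred) := by
    rw [e1, Function.update_of_ne (ne_freshId htag), hsig]
  have hsig₁ : z'.signers freshId = some (key, cred) := by rw [e1, Function.update_self]
  have hgood' : (if b then (key, cred) else (u.key, u.cred)).1 ∈ (T.daa.userKey n pk).support ∧
      T.daa.check n pk (if b then (key, cred) else (u.key, u.cred)).1
        (if b then (key, cred) else (u.key, u.cred)).2 = true := by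
    split_ifs
    · exact ⟨(hgood.signer _ _ hsig₁).1, (hgood.signer _ _ hsig₁).2.1⟩
    · exact ⟨(hgood.signer _ _ hsig₀).1, (hgood.signer _ _ hsig₀).2.1⟩
  have hs2 : s' 2 = s 2 := hs' 2 (by norm_num) (by norm_num)
  have hs1 : s' 1 = Data.unary n := by rw [hs' 1 (by norm_num) (by norm_num), h1]
  have hs4 : s' 4 = pk := by rw [hs' 4 (by norm_num) (by norm_num), h4]
  rw [E_comment hnym hk hgood'.1 hgood'.2, wp_seq, wp_toPPT _ _ _ _ _ _ _ _ _ hs1, wp_seq]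
  refine hb.le_wp_callChallenge (S := .cons tag ((s 2).nth 1)) (S₁ := freshId)
    (dom := .cons .nil ((s 2).nth 2)) (m := T.hash n ((s 2).nth 3)) ?_ ?_ hgood ?_ hsig₀ hsig₁
    fun σ hσ hgood'' => ?_
  · simp [-Data.nth_succ, Expr.eval, Expr.tuple, eval_queryArg, hs2, hs10, hs11, TrollThrottle.hash,
      Data.unary]
  · simp [-Data.nth_succ, freshId, Data.unary]
    omega
  · rw [e5, hz]
  · rw [wp_seq, wp_assign, wp_answerProg (by simpa using hs1)]
    have := ht.choose (U := (s 2).nth 1) (dom := (s 2).nth 2) (x₄' := .cons .nil .nil) hgood''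
      (fun S hS => by simp [e1, hS]) e2 e3 e4 (Or.inr ⟨rfl, tag, htag, rfl⟩) (by omega)
    refine le_trans (le_of_eq ?_) (hg { st with challenge := some ((s 2).nth 1, (s 2).nth 2) } _ _
      ⟨?_, ?_⟩)
    rotate_left 2
    · simpa [-Data.nth_succ, hs', hs8, Expr.eval] using this
    · simp [-Data.nth_succ, hs2, hs4, TrollThrottle.hash, eval_queryArg]
    · simp [hs', h0, h1, h3, h4, h5]

/-- A first choice is forwarded only if `U` is honest and the fresh user has joined. Otherwise the
answer is `⊥` for either bit, the choice is recorded, and the flag in variable `9` remains `nil`,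
which tells the final program to make a challenge of its own. -/
theorem Bounds.le_wp_challengeProg (hb : Bounds T l n a ρ pk sk) (hnym : T.daa.NymsMatch)
    (hk : (pk, sk) ∈ (T.daa.setup n).support)
    (h : T.UserRel n ρ pk sk (L 5) C k st s z) (hq : (s 2).size ≤ L 0) (hC : 2 * L 4 ≤ C)
    (hg : ∀ st' s' z', T.UserRel n ρ pk sk (L 5) C (k + 1) st' s' z' → g (s' 2, st') ≤ g' s' z') :
    E (T.challengeQuery n (Data.tuple [Data.unary n, ρ]) pk (Data.tuple [pk, sk]) b ((s 2).nth 1)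
      ((s 2).nth 2) ((s 2).nth 3) st) g ≤
      T.challengeProg.wp n (L 7) (T.realChallenger n ρ pk b) g' s z := by
  obtain ⟨hl0, hl1, hl2, hl3, hl4, hl5, hl6⟩ := levels (l := l) (p := T.daa.joinCoins) a
  have hU := (s 2).size_nth_le 1
  have hdom := (s 2).size_nth_le 2
  have hm := hb.size_hash (((s 2).size_nth_le 3).trans hq)
  have ⟨⟨h0, h1, h3, h4, h5⟩, ht⟩ := h
  have hst := ht.status_honest (U := (s 2).nth 1)
  rw [challengeQuery, challengeProg, wp_cond, Expr.eval, ht.chosen_eq]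
  cases hch : st.challenge with
  | some c =>
    simp only [Option.isSome_some, if_true, E_return, Option.map_some, Data.opt_some,
      Data.toBool_cons, wp_assign]
    exact h.le_of_nil hg (fun i hi hi2 => by simp [hi2]) (by simp [Expr.eval])
      fun _ _ _ _ ht => ht.mono
  | none =>
    -- Before the adversary's choice the fresh identity has not joined, and the challenger's only
    -- challenge is still available.
    obtain ⟨hz, hfresh⟩ := ht.fresh hch
    have hflag : s 9 = .nil := by
      rcases ht.challenge with h | ⟨-, U, dom, tag, -, h, -⟩
      · exact h.1
      · simp [hch] at h
    simp only [Option.isSome_none, Bool.false_eq_true, if_false, E_do, E_return, Option.map_none,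
      Data.opt_none, Data.toBool_nil, chall, wp_seq, wp_lookup, wp_assign, eval_var, eval_queryArg]
    by_cases hc : (s 2).nth 1 ∈ st.HU
    · obtain ⟨u, hu⟩ := ht.known _ hc
      obtain ⟨tag, htag, hass, hsig⟩ := ht.user _ _ hu
      rw [if_pos hc, hu, wp_cond_true _ _ _ _ _ _ (by simpa [-Data.nth_succ, Expr.eval, eval_queryArg] using hst.2 hc)]
      simp only [wp_seq, wp_assign, Expr.eval, eval_queryArg]
      simp only [E_do]
      refine hb.le_wp_joinProg (by simpa using h1) (by simpa using h3) (by simpa using h4)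
        (by simpa using h5) (by simp; omega) ht.good (by simpa [freshId, Data.unary] using hfresh) ?_ ?_
      · intro s' z' key cred hs h17 h18 hsize hgood e1 e2 e3 e4 e5
        -- The bit selects the fresh user, who is the second signer, or `U`, who is the first, in
        -- both games alike.
        have hcomment (F : Data × Data → PMF Data) :
            (if b then T.comment n pk key cred ((s 2).nth 2) ((s 2).nth 3) >>= F
            else T.comment n pk u.key u.cred ((s 2).nth 2) ((s 2).nth 3) >>= F) =
            T.comment n pk (if b then (key, cred) else (u.key, u.cred)).1
              (if b then (key, cred) else (u.key, u.cred)).2 ((s 2).nth 2) ((s 2).nth 3) >>= F := by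
          cases b <;> rfl
        simp only [hcomment, E_do, E_return]
        rw [wp_cond_true _ _ _ _ _ _ (by simpa [Expr.eval] using h18)]
        refine hb.le_wp_challengeSign hnym hk h hq hC hg hz htag hsig
          (fun i hi h8 => ?_) ?_ ?_ ?_ hgood
          (by simpa [freshId, Data.unary] using e1)
          (fun S hS => e2 S (by simpa [freshId, Data.unary] using hS)) e3 e4 e5
        · simp [hs i (by omega), h8, show i ≠ 10 by omega, show i ≠ 11 by omega]
        · simp [hs]
        · simp [hs, freshId, Data.unary]
        · rw [hs 11 (by norm_num)]
          simpa [-Data.nth_succ] using hass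
      · intro s' z' hs h18 hgood e1 e2 e3 e4 e5
        have hs' : ∀ i < 15, i ≠ 8 → i ≠ 10 → i ≠ 11 → s' i = s i := fun i hi h8 h10 h11 => by
          simp [hs i hi, h8, h10, h11]
        have hs8 : s' 8 = .cons .nil ((s 2).nth 1) := by simp [hs]
        simp only [E_return]
        rw [wp_cond_false _ _ _ _ _ _ (by simp [Expr.eval, h18]), wp_assign]
        have := ht.choose (U := (s 2).nth 1) (dom := (s 2).nth 2) (x₄' := .nil) hgood
          (fun S hS => by rw [e1]) (fun S hS => e2 S (by simpa [freshId, Data.unary] using hS))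
          e3 e4 (Or.inl ⟨rfl, by rw [e5, hz]⟩) (by omega)
        refine le_trans (le_of_eq ?_) (hg { st with challenge := some ((s 2).nth 1, (s 2).nth 2) } _ _
          ⟨?_, ?_⟩)
        rotate_left
        · simp [hs', h0, h1, h3, h4, h5]
        · simpa [-Data.nth_succ, hs', hs8, hflag] using this
        · simp [Expr.eval]
    · rw [if_neg hc, wp_cond_false _ _ _ _ _ _
      (by simpa [-Data.nth_succ, Expr.eval, eval_queryArg] using fun h => hc (hst.1 h)), wp_assign]
      simp only [E_return, Expr.eval, eval_queryArg]
      have := ht.choose (U := (s 2).nth 1) (dom := (s 2).nth 2) (x₄' := .nil) ht.good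
        (fun S hS => rfl) (fun S hS => rfl) rfl rfl (Or.inl ⟨rfl, hz⟩) (by omega)
      refine le_trans (le_of_eq ?_) (hg { st with challenge := some ((s 2).nth 1, (s 2).nth 2) } _ _
          ⟨?_, ?_⟩)
      rotate_left
      · simp [h0, h1, h3, h4, h5]
      · simpa [-Data.nth_succ, hflag] using this
      · simp

theorem userHandler_handles (hb : Bounds T l n a ρ pk sk) (hnym : T.daa.NymsMatch)
    (hk : (pk, sk) ∈ (T.daa.setup n).support) (hC : 2 * L 4 ≤ C) {t : ℕ} (ht : t ≤ a) :
    Handles n (L 7) t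
      (T.oracles n (Data.tuple [Data.unary n, ρ]) pk (Data.tuple [pk, sk]) b)
      (T.realChallenger n ρ pk b) (T.UserRel n ρ pk sk (L 5) C) T.userHandler := by
  intro k st s z h hkt hq g g' hg
  have hq : (s 2).size ≤ L 0 := hq.trans ht
  rw [userHandler, Prog.wp_dispatch, eval_queryArg, oracles]
  match hlen : ((s 2).nth 0).len with
  | 0 => exact hb.le_wp_corruptProg h hq hC hg
  | 1 => exact hb.le_wp_createProg h hq hC _ hg
  | 2 => exact hb.le_wp_startProg h hq _ hg
  | 3 => exact hb.le_wp_finishProg h hq hC hg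
  | 4 => exact hb.le_wp_commentProg hnym hk h hq hg
  | 5 => exact hb.le_wp_challengeProg hnym hk h hq hC hg
  | m + 6 =>
    change E (pure (Data.opt none, st)) g ≤ g' (Function.update s 2 .nil) z
    rw [E_return]
    exact h.le_of_nil hg (fun i hi hi2 => by simp [hi2]) (by simp) fun _ _ _ _ ht => ht.mono

/-- A run that wins the game of anonymity wins the game of user-controlled anonymity. -/
theorem Bounds.le_wp_userFinal (hb : Bounds T l n a ρ pk sk) (hC : C ≤ 2 * L 4)
    (h : T.UserRel n ρ pk sk (L 5) C k st s z) :
    (if (open Classical in decide (Wins b (some (s 2), st))) then 1 else 0 : ℝ≥0∞) ≤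
      userFinal.wp n (L 7) (T.realChallenger n ρ pk b) (fun s z =>
        if (open Classical in decide (DAAScheme.Wins b (some (s 0), z))) then 1 else 0) s z := by
  obtain ⟨hl0, hl1, hl2, hl3, hl4, hl5, hl6⟩ := levels (l := l) (p := T.daa.joinCoins) a
  have ⟨⟨h0, h1, h3, h4, h5⟩, ht⟩ := h
  by_cases hw : Wins b (some (s 2), st)
  swap
  · simp [hw]
  obtain ⟨hout, U, dom, hch, hU, hcomm⟩ := hw
  simp only at hout hch hU hcomm
  have hCU : U ∉ st.CU := fun h => ht.disjoint U h hU
  have hcor : ∀ S ∈ z.corrupted, S.tl ≠ U := fun S hS h => hCU (h ▸ (ht.corrupted S hS).2)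
  obtain ⟨u, hu⟩ := ht.known U hU
  obtain ⟨tag, htag, hass, hsig⟩ := ht.user U u hu
  have htl : ∀ S ∈ z.corrupted, S ≠ .cons tag U := fun S hS h => hcor S hS (by rw [h]; rfl)
  have hchosen : (s 8).size ≤ C := ht.size_chosen
  rw [ht.chosen_eq, hch] at hchosen
  simp at hchosen
  have hl4' : 10 ≤ L 4 := by omega
  -- If no challenge was forwarded, the adversary may still have won with the answer `⊥`, while
  -- user-controlled anonymity cannot be won without a challenge.
  rcases ht.challenge with ⟨hflag, hz⟩ | ⟨hflag, U', dom', tag', htag', hch', hz⟩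
  · rw [userFinal, wp_cond_false _ _ _ _ _ _ (by simp [Expr.eval, hflag]), if_pos (by simpa using
      ⟨hout, U, dom, hch, hU, hcomm⟩)]
    simp only [wp_seq, wp_lookup, Expr.eval]
    -- The dummy challenge has `U` in both roles. Its basename `⊥` lifts the restriction on
    -- signatures, and `U` is uncorrupted. The answer is not used, so the expectation of the
    -- constant one remains.
    refine le_trans (le_of_eq (E_const (T.daa.sign n pk _ _ (Data.toOpt .nil) .nil) 1).symm)
      (hb.le_wp_callChallenge (S := .cons tag U) (S₁ := .cons tag U) (dom := .nil) (m := .nil)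
        ?_ (by simp; omega) ht.good hz hsig hsig fun σ _ _ => ?_)
    · simp [Expr.eval, Expr.tuple, ht.chosen_eq, hch, hass, Data.unary]
    · rw [wp_assign, if_pos]
      simp only [decide_eq_true_eq]
      exact ⟨by simpa [Expr.eval] using hout, _, _, _, rfl, fun h => htl _ h rfl, fun h => htl _ h rfl, by simp [Data.toOpt]⟩
  · rw [hch] at hch'
    simp only [Option.some.injEq, Prod.mk.injEq] at hch'
    obtain ⟨rfl, rfl⟩ := hch'
    rw [userFinal, wp_cond_true _ _ _ _ _ _ (by simp [Expr.eval, hflag]), wp_assign, if_pos (by simpa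
      using ⟨hout, U, dom, hch, hU, hcomm⟩), if_pos]
    simp only [decide_eq_true_eq]
    refine ⟨by simpa [Expr.eval] using hout, _, _, _, hz, fun h => hcor _ h rfl, fun h => ?_,
      fun _ => ⟨fun h => ?_, fun h => ?_⟩⟩
    -- The tag of `freshId` is too large for an identity that was corrupted or asked to sign.
    · have := (ht.corrupted _ h).1
      simp [freshId, Data.unary] at this
    · obtain ⟨-, c, hc, h1, h2⟩ := ht.signed _ h
      exact hcomm c hc ⟨h1, by simpa using h2.symm⟩
    · have := (ht.signed _ h).1
      simp [freshId, Data.unary] at this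

/-- The index is trivial, as reference string, keys and bit are fixed by the surrounding game. An
entry of a table takes at most `2 * L 4`. -/
theorem userReduction_simulates (hb : Bounds T l n a ρ pk sk) (hnym : T.daa.NymsMatch)
    (hk : (pk, sk) ∈ (T.daa.setup n).support) {t B : ℕ} (ht : t ≤ a) (hB : t * (2 * L 4) + L 8 ≤ B) :
    T.userReduction.Simulates n (L 7) t B (PMF.pure ())
      (fun _ => T.oracles n (Data.tuple [Data.unary n, ρ]) pk (Data.tuple [pk, sk]) b)
      (fun _ => T.UserRel n ρ pk sk (L 5) (2 * L 4))
      (fun _ => withParam n (Data.tuple [Data.tuple [Data.unary n, ρ], Data.tuple [pk, sk]])) .init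
      (T.realChallenger n ρ pk b) (withParam n (Data.tuple [ρ, pk, sk])) .init := by
  obtain ⟨hl0, hl1, hl2, hl3, hl4, hl5, hl6⟩ := levels (l := l) (p := T.daa.joinCoins) a
  have hl7 := level_succ_ge (l := l) (p := T.daa.joinCoins) a 7
  have hl : L 0 = a := rfl
  have hle := hb.le
  have hkeys := hb.size_keys
  have hcrs := hb.size_crs
  simp at hkeys
  simp only [Nat.reduceAdd] at hl7
  refine ⟨?_, fun _ _ => userHandler_handles hb hnym hk le_rfl ht, ?_, ?_, by omega, by omega, ?_⟩
  · intro g g' hg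
    rw [E_pure]
    simp [userReduction, Prog.wp, Expr.eval, start, withParam, Expr.tuple, Expr.nth]
    refine hg () (by simp) _ _ ⟨?_, ?_⟩ ?_
    · simp
    · simpa using UserTables.init (by omega)
    · simp [withParam]
  · rintro i k st s s' z h ⟨⟨h0, h1, h3, h4, h5⟩, htab⟩
    simp only [userReduction] at h
    refine ⟨?_, ?_⟩
    · rw [h 0, h 1, h 3, h 4, h 5]
      · exact ⟨h0, h1, h3, h4, h5⟩
      all_goals norm_num
    · rw [h 6, h 7, h 8, h 9]
      · exact htab
      all_goals norm_num
  · rintro i hi k st s z ⟨⟨h0, h1, h3, h4, h5⟩, htab⟩ hk j hj hj2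
    have hkt : k * (2 * L 4) ≤ t * (2 * L 4) := Nat.mul_le_mul_right _ hk
    have := htab.size_users
    have := htab.size_status
    have := htab.size_chosen
    have := htab.size_flag
    simp only [userReduction] at hj
    interval_cases j
    · simp [h0]; omega
    · simp [h1, size_unary]; omega
    · omega
    · rw [h3]; omega
    · rw [h4]; omega
    · rw [h5]; omega
    all_goals omega
  · simp [size_withParam]; omega

end TrollThrottle

end Troll

namespace Troll

open scoped ENNReal

/-! ## The experiments -/

/-- Runs that are stopped by the clock have no output and win nothing, so every experiment becomes
an expression in `W`. -/
theorem Adversary.E_play {σ : Type} (A : Adversary) (n : ℕ) (x : Data)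
    (O : σ → Data → PMF (Data × σ)) (z : σ) (h : Option Data × σ → ℝ≥0∞) (hn : ∀ z, h (none, z) = 0) :
    E ((A.run n x).play O z) h = W O (A.time.eval n) [A.code] (start (withParam n x)) z
      fun _ s z => h (some (s 0), z) := by
  rw [Interaction.E_play O h hn, Adversary.run, Cmd.run, Interaction.wp_map, wp_exec]
  rfl

theorem DAAScheme.anonExp_true (D : DAAScheme) (A : Adversary) (n : ℕ) : D.anonExp A n true =
    E (PMF.uniformOfFintype Bool) fun b => E (D.setup n) fun k =>
      W (D.challenger n k.1 b) (A.time.eval n) [A.code]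
        (start (withParam n (Data.tuple [k.2, k.1]))) GameState.init
        fun _ s z => if (open Classical in decide (Wins b (some (s 0), z))) then 1 else 0 := by
  rw [← E_indicator, anonExp]
  simp only [E_do, E_return]
  refine E_congr fun b _ => E_congr fun k _ => A.E_play _ _ _ _ _ fun z => ?_
  simp [Wins]

theorem TrollThrottle.anonExp_true (T : TrollThrottle) (A : Adversary) (n : ℕ) :
    T.anonExp A n true = E (T.zk.setup n) fun ρ => E (T.daa.setup n) fun k =>
      E (PMF.uniformOfFintype Bool) fun b =>
        W (T.oracles n (Data.tuple [Data.unary n, ρ]) k.1 (Data.tuple [k.1, k.2]) b) (A.time.eval n)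
          [A.code] (start (withParam n (Data.tuple [Data.tuple [Data.unary n, ρ],
            Data.tuple [k.1, k.2]]))) GameState.init
          fun _ s z => if (open Classical in decide (Wins b (some (s 0), z))) then 1 else 0 := by
  rw [← E_indicator, anonExp]
  simp only [E_do, E_return, setup, keyGen, E_map]
  refine E_congr fun ρ _ => E_congr fun k _ => E_congr fun b _ => A.E_play _ _ _ _ _ fun z => ?_
  simp [Wins]

namespace ProofSystem

variable (P : ProofSystem) (R : ℕ → Data → Data → Prop) (A : Adversary) (n : ℕ)

theorem realExp_true : P.realExp R A n true = E (P.setup n) fun ρ =>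
    W (proofOracle (R n) fun x w => P.createProof n ρ x w) (A.time.eval n) [A.code]
      (start (withParam n ρ)) () fun _ s _ => if (s 0).toBool then 1 else 0 := by
  rw [← E_indicator, realExp]
  simp only [E_do, E_return]
  exact E_congr fun ρ _ => A.E_play _ _ _ _ _ fun z => by simp [accepts]

theorem simExp_true (S₁ S₂ : PPTAlgorithm) : simExp S₁ S₂ R A n true =
    E (S₁.out n Data.nil) fun crs =>
      W (proofOracle (R n) fun x _ => S₂.out n (Data.tuple [crs.hd, crs.tl, x])) (A.time.eval n)
        [A.code] (start (withParam n crs.hd)) () fun _ s _ => if (s 0).toBool then 1 else 0 := by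
  rw [← E_indicator, simExp]
  simp only [E_do, E_return]
  exact E_congr fun ρ _ => A.E_play _ _ _ _ _ fun z => by simp [accepts]

end ProofSystem

/-! ## The adversaries -/

/-- A bound for the sizes of the values in a reduction, for an adversary with running time `t`. -/
noncomputable def sizeBound (G t : Polynomial ℕ) : Polynomial ℕ :=
  t * (2 * levelPoly G (.X + t + 1) 6 + 3) + levelPoly G (.X + t + 1) 8

theorem eval_sizeBound (G t : Polynomial ℕ) (n : ℕ) : (sizeBound G t).eval n =
    t.eval n * (2 * level G (n + t.eval n + 1) 6 + 3) + level G (n + t.eval n + 1) 8 := by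
  simp [sizeBound, eval_levelPoly]

/-- The adversary that runs a reduction with a given adversary. -/
noncomputable def Reduction.adversary (R : Reduction) (G : Polynomial ℕ) (A : Adversary) : Adversary :=
  ⟨R.code A.code, R.timePoly (sizeBound G A.time) A.time⟩

namespace TrollThrottle

variable (T : TrollThrottle) (S₁ S₂ : PPTAlgorithm) (A : Adversary) (n : ℕ)

/-- The algorithms that are run in the games. -/
noncomputable def algorithms : List PPTAlgorithm :=
  [T.daa.setupAlg, T.daa.keyAlg, T.daa.joinAlg.toPPT, T.daa.issueAlg, T.daa.signAlg,
    T.hashAlg.toPPT, T.zk.setupAlg, T.zk.createAlg, S₁, S₂]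

/-- A polynomial that bounds the sizes of outputs in the games. -/
noncomputable def gamePoly : Polynomial ℕ := growth (T.algorithms S₁ S₂) T.daa.joinCoins

local notation "G" => gamePoly T S₁ S₂

/-- The adversary against user-controlled anonymity with honest proofs. -/
noncomputable def userAdversary : Adversary := T.userReduction.adversary G A

/-- The distinguisher of honest and simulated proofs. -/
noncomputable def zkAdversary : Adversary := T.zkReduction.adversary G (T.userAdversary S₁ S₂ A)

/-- The adversary against user-controlled anonymity. -/
noncomputable def anonAdversary : Adversary :=
  ⟨(simReduction S₁ S₂).code (T.userAdversary S₁ S₂ A).code,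
    (simReduction S₁ S₂).timePoly
      (levelPoly G (.X + (T.zkAdversary S₁ S₂ A).time + 1) 8) (T.zkAdversary S₁ S₂ A).time⟩

/-! ### The inequalities between consecutive games -/

theorem size_setup_le {a : ℕ} {k : Data × Data} (hk : k ∈ (T.daa.setup n).support) (ha : n + 1 ≤ a) :
    (Data.cons k.1 k.2).size ≤ level G a 1 := by
  obtain ⟨x, hx, rfl⟩ := (PMF.mem_support_map_iff _ _ _).1 hk
  have h : x.size ≤ level G a 1 := size_out_le_level (i := 0) (l := T.algorithms S₁ S₂)
    (A := T.daa.setupAlg) (by simp [algorithms]) hx (by simp [level]; omega)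
  have h1 : 20 * level G a 0 + 20 ≤ level G a 1 := level_succ_ge _ _
  -- A malformed output `nil` is read as the pair `(nil, nil)`, which is larger than the output
  -- itself.
  cases x with
  | nil => simp; omega
  | cons a b => exact h

theorem bounds {a : ℕ} {ρ : Data} {k : Data × Data} (hρ : ρ ∈ (T.zk.setup n).support)
    (hk : k ∈ (T.daa.setup n).support) (ha : n + 1 ≤ a) :
    Bounds T (T.algorithms S₁ S₂) n a ρ k.1 k.2 := by
  refine ⟨?_, ?_, ?_, ?_, ?_, ?_, ha, T.size_setup_le S₁ S₂ n hk ha,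
    size_out_le_level (i := 0) (A := T.zk.setupAlg) ?_ hρ (by simp [level]; omega)⟩ <;>
  simp [algorithms]

/-- A game of anonymity is won at most as often as the one that `userAdversary` plays with honest
proofs. -/
theorem anonExp_le (hnym : T.daa.NymsMatch) : T.anonExp A n true ≤ E (T.zk.setup n) fun ρ => E (T.daa.setup n) fun k =>
    E (PMF.uniformOfFintype Bool) fun b =>
      W (T.realChallenger n ρ k.1 b) ((T.userAdversary S₁ S₂ A).time.eval n)
        [(T.userAdversary S₁ S₂ A).code] (start (withParam n (Data.tuple [ρ, k.1, k.2])))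
        DAAScheme.GameState.init
        fun _ s z => if (open Classical in decide (DAAScheme.Wins b (some (s 0), z))) then 1 else 0 := by
  rw [anonExp_true]
  refine E_mono fun ρ hρ => E_mono fun k hk => E_mono fun b _ => ?_
  set t := A.time.eval n with ht
  have hb := T.bounds S₁ S₂ n hρ hk (a := n + t + 1) (by omega)
  obtain ⟨hl0, hl1, hl2, hl3, hl4, hl5, hl6⟩ := levels (l := T.algorithms S₁ S₂)
    (p := T.daa.joinCoins) (n + t + 1)
  have hl7 := level_succ_ge (l := T.algorithms S₁ S₂) (p := T.daa.joinCoins) (n + t + 1) 7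
  have hl : level (growth (T.algorithms S₁ S₂) T.daa.joinCoins) (n + t + 1) 0 = n + t + 1 := rfl
  simp only [Nat.reduceAdd] at hl7
  have hkeys := hb.size_keys
  have hcrs := hb.size_crs
  simp at hkeys
  have hB := eval_sizeBound G A.time n
  rw [← ht, gamePoly] at hB
  -- `sizeBound` serves two reductions: per query, the tables grow by twice level `4` here and by
  -- level `6` for `zkReduction`, and the `3` per step accounts for the growth of the output.
  have hmul := Nat.mul_le_mul_left t (show 2 * level (growth (T.algorithms S₁ S₂) T.daa.joinCoins)
    (n + t + 1) 4 + 3 ≤ 2 * level (growth (T.algorithms S₁ S₂) T.daa.joinCoins) (n + t + 1) 6 + 3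
    by omega)
  have h := userReduction_simulates hb (b := b) hnym hk (t := t) (by omega)
    (B := (sizeBound G A.time).eval n) (by rw [gamePoly, hB]; rw [mul_add] at hmul; omega)
  have := h.le_W A.code (n := (T.userAdversary S₁ S₂ A).time.eval n) ?_ ?_
    (fun _ d st => if (open Classical in decide (Wins b (some d, st))) then 1 else 0)
    (fun d z => if (open Classical in decide (DAAScheme.Wins b (some d, z))) then 1 else 0) ?_
  · rwa [E_pure] at this
  · rw [userAdversary, Reduction.adversary, Reduction.eval_timePoly]
  · intro _ _
    rw [gamePoly, hB]
    simp [size_withParam, size_unary]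
    rw [mul_add] at hmul
    omega
  · exact fun _ _ k st s z h _ _ => hb.le_wp_userFinal le_rfl h

/-- With honest proofs, `zkAdversary` accepts at least as often as `userAdversary` wins. -/
theorem le_realExp : (E (T.zk.setup n) fun ρ => E (T.daa.setup n) fun k =>
    E (PMF.uniformOfFintype Bool) fun b =>
      W (T.realChallenger n ρ k.1 b) ((T.userAdversary S₁ S₂ A).time.eval n)
        [(T.userAdversary S₁ S₂ A).code] (start (withParam n (Data.tuple [ρ, k.1, k.2])))
        DAAScheme.GameState.init
        fun _ s z => if (open Classical in decide (DAAScheme.Wins b (some (s 0), z))) then 1 else 0) ≤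
    T.zk.realExp T.joinRelation (T.zkAdversary S₁ S₂ A) n true := by
  rw [ProofSystem.realExp_true]
  refine E_mono fun ρ hρ => ?_
  set t := (T.userAdversary S₁ S₂ A).time.eval n with ht
  obtain ⟨hl0, hl1, hl2, hl3, hl4, hl5, hl6⟩ := levels (l := T.algorithms S₁ S₂)
    (p := T.daa.joinCoins) (n + t + 1)
  have hl7 := level_succ_ge (l := T.algorithms S₁ S₂) (p := T.daa.joinCoins) (n + t + 1) 7
  have hl : level (growth (T.algorithms S₁ S₂) T.daa.joinCoins) (n + t + 1) 0 = n + t + 1 := rfl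
  simp only [Nat.reduceAdd] at hl7
  have hB := eval_sizeBound G (T.userAdversary S₁ S₂ A).time n
  rw [← ht, gamePoly] at hB
  have hmul := Nat.mul_le_mul_left t (show level (growth (T.algorithms S₁ S₂) T.daa.joinCoins)
    (n + t + 1) 6 + 3 ≤ 2 * level (growth (T.algorithms S₁ S₂) T.daa.joinCoins) (n + t + 1) 6 + 3
    by omega)
  rw [mul_add] at hmul
  have hcrs : ρ.size ≤ level (growth (T.algorithms S₁ S₂) T.daa.joinCoins) (n + t + 1) 1 :=
    size_out_le_level (i := 0) (A := T.zk.setupAlg) (by simp [algorithms]) hρ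
      (by simp [level]; omega)
  have hprove : ∀ x w π, x.size + w.size ≤
      10 * level (growth (T.algorithms S₁ S₂) T.daa.joinCoins) (n + t + 1) 3 + 10 →
      π ∈ (T.zk.createProof n ρ x w).support →
      π.size ≤ level (growth (T.algorithms S₁ S₂) T.daa.joinCoins) (n + t + 1) 6 := by
    intro x w π h hπ
    have := size_out_le_level (i := 3) (l := T.algorithms S₁ S₂) (p := T.daa.joinCoins)
      (A := T.zk.createAlg) (by simp [algorithms]) hπ (a := n + t + 1) (by simp; omega)
    simp only [Nat.reduceAdd] at this
    omega
  have h := zkReduction_simulates (T := T) (l := T.algorithms S₁ S₂) (n := n) (t := t)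
    (a := n + t + 1) (by simp [algorithms]) (by simp [algorithms]) (by simp [algorithms])
    (by simp [algorithms]) (by omega) hcrs hprove
    (B := (sizeBound G (T.userAdversary S₁ S₂ A).time).eval n) (by rw [gamePoly, hB]; omega)
  have := h.le_W (T.userAdversary S₁ S₂ A).code (n := (T.zkAdversary S₁ S₂ A).time.eval n) ?_ ?_
    (fun i d st => if (open Classical in decide (DAAScheme.Wins i.2 (some d, st))) then 1 else 0)
    (fun d _ => if d.toBool then 1 else 0) ?_
  · simp only [E_do, E_return] at this
    exact this
  · rw [zkAdversary, Reduction.adversary, Reduction.eval_timePoly]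
  · intro i hi
    obtain ⟨k, hk, hi⟩ := mem_support_do.1 hi
    obtain ⟨b, -, hi⟩ := mem_support_do.1 hi
    rw [mem_support_return] at hi
    subst hi
    have hkeys := T.size_setup_le S₁ S₂ n hk (a := n + t + 1) (by omega)
    rw [gamePoly] at hkeys ⊢
    simp at hkeys
    rw [hB]
    simp [size_withParam]
    omega
  · rintro i hi k st s z ⟨-, h⟩ - -
    refine le_trans (le_of_eq ?_)
      (wp_zkFinal h fun d => if d.toBool then (1 : ℝ≥0∞) else 0).ge
    cases (open Classical in decide (DAAScheme.Wins i.2 (some (s 2), st))) <;> rfl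

/-- With simulated proofs, `zkAdversary` accepts at most as often as `userAdversary` wins. -/
theorem simExp_le : ProofSystem.simExp S₁ S₂ T.joinRelation (T.zkAdversary S₁ S₂ A) n true ≤
    E (S₁.out n Data.nil) fun crs => E (T.daa.setup n) fun k => E (PMF.uniformOfFintype Bool) fun b =>
      W (T.daa.proofChallenger n k.1 b fun x _ => S₂.out n (Data.tuple [crs.hd, crs.tl, x]))
        ((T.zkAdversary S₁ S₂ A).time.eval n) [(T.userAdversary S₁ S₂ A).code]
        (start (withParam n (Data.tuple [crs.hd, k.1, k.2]))) DAAScheme.GameState.init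
        fun _ s z => if (open Classical in decide (DAAScheme.Wins b (some (s 0), z))) then 1 else 0 := by
  rw [ProofSystem.simExp_true]
  refine E_mono fun crs hcrs => ?_
  set t := (T.zkAdversary S₁ S₂ A).time.eval n with ht
  obtain ⟨hl0, hl1, hl2, hl3, hl4, hl5, hl6⟩ := levels (l := T.algorithms S₁ S₂)
    (p := T.daa.joinCoins) (n + t + 1)
  have hl : level (growth (T.algorithms S₁ S₂) T.daa.joinCoins) (n + t + 1) 0 = n + t + 1 := rfl
  have hcrs : crs.size ≤ level (growth (T.algorithms S₁ S₂) T.daa.joinCoins) (n + t + 1) 1 :=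
    size_out_le_level (i := 0) (A := S₁) (by simp [algorithms]) hcrs (by simp [level]; omega)
  have h1 := crs.size_hd_le
  have h2 := crs.size_tl_le
  -- The size bound `B` may be anything large enough, here the least one, because the upper
  -- direction does not involve the reduction's clock.
  have h := zkReduction_simulates (T := T) (l := T.algorithms S₁ S₂) (n := n) (t := t)
    (a := n + t + 1) (by simp [algorithms]) (by simp [algorithms]) (by simp [algorithms])
    (by simp [algorithms]) (by omega) (h1.trans hcrs)
    (prove := fun x _ => S₂.out n (Data.tuple [crs.hd, crs.tl, x])) (fun x w π h hπ => ?_) le_rfl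
  · have := h.W_le (T.userAdversary S₁ S₂ A).code
      (fun i d st => Data.bit (open Classical in decide (DAAScheme.Wins i.2 (some d, st))))
      (fun d => if d.toBool then 1 else 0) (fun d => by split_ifs <;> simp)
      (fun i hi k st s z h ψ => (wp_zkFinal h.2 ψ).ge)
    refine this.trans (le_of_eq ?_)
    simp only [E_do, E_return]
    refine E_congr fun k _ => E_congr fun b _ => ?_
    congr 1
    funext _ s z
    cases (open Classical in decide (DAAScheme.Wins b (some (s 0), z))) <;> rfl
  · have := size_out_le_level (i := 3) (l := T.algorithms S₁ S₂) (p := T.daa.joinCoins)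
      (A := S₂) (by simp [algorithms]) hπ (a := n + t + 1) (by simp; omega)
    simp only [Nat.reduceAdd] at this
    omega

/-- `anonAdversary` wins at least as often as `userAdversary` wins with simulated proofs. -/
theorem le_anonExp : (E (S₁.out n Data.nil) fun crs => E (T.daa.setup n) fun k =>
    E (PMF.uniformOfFintype Bool) fun b =>
      W (T.daa.proofChallenger n k.1 b fun x _ => S₂.out n (Data.tuple [crs.hd, crs.tl, x]))
        ((T.zkAdversary S₁ S₂ A).time.eval n) [(T.userAdversary S₁ S₂ A).code]
        (start (withParam n (Data.tuple [crs.hd, k.1, k.2]))) DAAScheme.GameState.init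
        fun _ s z => if (open Classical in decide (DAAScheme.Wins b (some (s 0), z))) then 1 else 0) ≤
    T.daa.anonExp (T.anonAdversary S₁ S₂ A) n true := by
  -- The simulated reference string, the keys and the bit are drawn independently, so their
  -- different orders in the two games do not matter.
  rw [DAAScheme.anonExp_true, E_comm, E_comm (PMF.uniformOfFintype Bool)]
  refine E_mono fun k hk => ?_
  rw [E_comm]
  refine E_mono fun b _ => ?_
  set t := (T.zkAdversary S₁ S₂ A).time.eval n with ht
  obtain ⟨hl0, hl1, hl2, hl3, hl4, hl5, hl6⟩ := levels (l := T.algorithms S₁ S₂)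
    (p := T.daa.joinCoins) (n + t + 1)
  have hl7 := level_succ_ge (l := T.algorithms S₁ S₂) (p := T.daa.joinCoins) (n + t + 1) 7
  have hl : level (growth (T.algorithms S₁ S₂) T.daa.joinCoins) (n + t + 1) 0 = n + t + 1 := rfl
  simp only [Nat.reduceAdd] at hl7
  have hkeys := T.size_setup_le S₁ S₂ n hk (a := n + t + 1) (by omega)
  rw [gamePoly] at hkeys
  have h := simReduction_simulates (D := T.daa) (S₁ := S₁) (S₂ := S₂) (l := T.algorithms S₁ S₂)
    (n := n) (t := t) (a := n + t + 1) (by simp [algorithms]) (by simp [algorithms])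
    (by simp [algorithms]) (by simp [algorithms]) (by omega) hkeys b
  refine h.le_W (T.userAdversary S₁ S₂ A).code (n := (T.anonAdversary S₁ S₂ A).time.eval n) ?_ ?_
    (fun _ d st => if (open Classical in decide (DAAScheme.Wins b (some d, st))) then 1 else 0)
    (fun d z => if (open Classical in decide (DAAScheme.Wins b (some d, z))) then 1 else 0) ?_
  -- `simExp_le` leaves `userAdversary` with the budget of `zkAdversary`, so the clock of
  -- `anonAdversary` is computed from that budget.
  · rw [anonAdversary, Reduction.eval_timePoly, eval_levelPoly, gamePoly]
    simp [ht]
  · intro crs hcrs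
    have hcrs : crs.size ≤ level (growth (T.algorithms S₁ S₂) T.daa.joinCoins) (n + t + 1) 1 :=
      size_out_le_level (i := 0) (A := S₁) (by simp [algorithms]) hcrs (by simp [level]; omega)
    have h1 := crs.size_hd_le
    simp at hkeys
    simp [size_withParam]
    omega
  · rintro crs hcrs k st s z ⟨-, rfl, -⟩ - -
    exact le_rfl

theorem Pr_anonExp_le (hnym : T.daa.NymsMatch) :
    Pr (T.anonExp A n) ≤ Pr (T.zk.realExp T.joinRelation (T.zkAdversary S₁ S₂ A) n) :=
  ENNReal.toReal_mono (PMF.apply_ne_top _ _)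
    ((T.anonExp_le S₁ S₂ A n hnym).trans (T.le_realExp S₁ S₂ A n))

theorem Pr_simExp_le : Pr (ProofSystem.simExp S₁ S₂ T.joinRelation (T.zkAdversary S₁ S₂ A) n) ≤
    Pr (T.daa.anonExp (T.anonAdversary S₁ S₂ A) n) :=
  ENNReal.toReal_mono (PMF.apply_ne_top _ _)
    ((T.simExp_le S₁ S₂ A n).trans (T.le_anonExp S₁ S₂ A n))

end TrollThrottle

end Troll

theorem mainTheorem3 (T : Troll.TrollThrottle)
    (hnym : T.daa.NymsMatch)
    (hanon : T.daa.UserControlledAnonymity)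
    (hzk : T.zk.ZeroKnowledge T.joinRelation) :
    T.Anonymity := by
  intro A
  -- The simulators come first: they serve every distinguisher, in particular `zkAdversary`, whose
  -- own clock depends on them through `gamePoly`.
  obtain ⟨S₁, S₂, hzk⟩ := hzk
  obtain ⟨ν, hν, h⟩ := hanon (T.anonAdversary S₁ S₂ A)
  -- The error is that of user-controlled anonymity plus the distinguishing advantage of
  -- `zkAdversary`.
  refine ⟨_, hν.add (hzk (T.zkAdversary S₁ S₂ A)), fun n => ?_⟩
  have h1 := T.Pr_anonExp_le S₁ S₂ A n hnym
  have h2 := T.Pr_simExp_le S₁ S₂ A n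
  have h3 := h n
  have h4 := le_abs_self (Troll.Pr (T.zk.realExp T.joinRelation (T.zkAdversary S₁ S₂ A) n) -
    Troll.Pr (Troll.ProofSystem.simExp S₁ S₂ T.joinRelation (T.zkAdversary S₁ S₂ A) n))
  simp only [Pi.add_apply]
  linarith
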